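/- Let $1\le t<n$. A (finite, abstract) complex is a family of nonempty subsets (simplices) of a finite vertex set that contains all singletons and is closed under passing to nonempty subsets. A colorless task is a triple $T=(\mathcal I,\mathcal O,\Delta)$ where $\mathcal I,\mathcal O$ are finite complexes and $\Delta$ assigns to each simplex $s\in\mathcal I$ a (possibly empty) subcomplex $\Delta(s)\subseteq\mathcal O$ such that $s'\subseteq s$ implies $\Delta(s')\subseteq\Delta(s)$. Consider $n$ asynchronous deterministic processes that communicate through atomic shared objects (each operation takes effect and responds in one indivisible step). An execution is an infinite interleaving of steps of the processes; a process is faulty in it if it takes only finitely many steps (a process that has decided is regarded as taking idle steps). A protocol solves $T$ $t$-resiliently if for every simplex $s\in\mathcal I$, every assignment of inputs $v_i\in s$ to the $n$ processes, and every execution with at most $t$ faulty processes, every non-faulty process eventually decides a value, and the set of all decided values is a simplex of $\Delta(s)$. The processes are anonymous if they all run the same code, which depends on the input value but on no process identity; they are non-anonymous if the code of a process may depend on its identity $p\in\{0,\dots,n-1\}$. A weak set object holds a set, initially $\emptyset$, and supports $\mathrm{add}(x)$ and $\mathrm{get}()$, the latter returning the set of all values added so far. A snapshot object is an array of $n$ components,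 all initially holding a default value, on which process $p$ can update component $p$ and every process can scan (read atomically) the whole array. A multi-writer/multi-reader (MWMR) register can be read and written by every process, and initially holds a default value. Objects may hold values from an arbitrary set, and a protocol may use an arbitrary family of weak set (respectively snapshot) objects. Theorem. Let $T$ be a colorless task. (1) $T$ is $t$-resilient solvable by $n$ anonymous processes with atomic weak set objects if and only if $T$ is $t$-resilient solvable by $n$ non-anonymous processes with atomic snapshot objects. (2) If $T$ is $t$-resilient solvable by $n$ anonymous processes, either with atomic weak set objects or with some finite number $m$ of atomic MWMR registers, then $T$ is $t$-resilient solvable by $n$ anonymous processes with only $n$ atomic MWMR registers. -/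

import Mathlib

namespace AnonTask

/-- A colorless task `(I, O, Δ)`. The vertex set of `I` is all of `V` and that of `O` is all of `W`
(`AbstractSimplicialComplex` contains every singleton). A carrier map sends each simplex of `I` to a
(possibly empty) subcomplex of `O`, monotonically. -/
structure ColorlessTask (V W : Type) where
  input : AbstractSimplicialComplex V
  output : AbstractSimplicialComplex W
  carrier : {s : Finset V // s ∈ input.faces} → PreAbstractSimplicialComplex W
  carrier_le : ∀ s, carrier s ≤ output.toPreAbstractSimplicialComplex
  carrier_mono : ∀ s s', s.1 ⊆ s'.1 → carrier s ≤ carrier s'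

/-- A shared memory accessed by `n` processes, given by its sequential specification: every
operation is atomic, i.e. it takes effect and responds in a single step. The caller `p : Fin n` is
an argument of `apply` only so that single-writer components can be expressed. -/
structure Memory (n : ℕ) where
  State : Type
  Op : Type
  Resp : Type
  init : State
  apply : Fin n → Op → State → State × Resp

/-! ### Atomic weak set objects -/

/-- Operations on a family, indexed by `K`, of weak set objects with values in `X`. -/
inductive WeakSetOp (K X : Type) : Type
  | add (k : K) (x : X)
  | get (k : K)

inductive WeakSetResp (X : Type) : Type
  | ack
  | values (s : Set X)

open Classical in
/-- A family of atomic weak sets, all initially empty. -/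
noncomputable def weakSetMemory (n : ℕ) (K X : Type) : Memory n where
  State := K → Set X
  Op := WeakSetOp K X
  Resp := WeakSetResp X
  init := fun _ => ∅
  apply := fun _ op m =>
    match op with
    | .add k x => (Function.update m k (insert x (m k)), .ack)
    | .get k => (m, .values (m k))

/-! ### Atomic snapshot objects -/

/-- Operations on a family, indexed by `K`, of `n`-component snapshot objects. A process can only
update its own component, so `update` does not name the component. -/
inductive SnapshotOp (K X : Type) : Type
  | update (k : K) (x : X)
  | scan (k : K)

inductive SnapshotResp (n : ℕ) (X : Type) : Type
  | ack
  | view (a : Fin n → X)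

open Classical in
/-- A family of atomic snapshot objects; the `p`-th component of each object is written by process
`p` only, and all components initially hold the default value `x₀`. -/
noncomputable def snapshotMemory (n : ℕ) (K X : Type) (x₀ : X) : Memory n where
  State := K → Fin n → X
  Op := SnapshotOp K X
  Resp := SnapshotResp n X
  init := fun _ _ => x₀
  apply := fun p op m =>
    match op with
    | .update k x => (Function.update m k (Function.update (m k) p x), .ack)
    | .scan k => (m, .view (m k))

/-! ### Atomic multi-writer/multi-reader registers -/

inductive RegisterOp (m : ℕ) (X : Type) : Type
  | read (i : Fin m)
  | write (i : Fin m) (x : X)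

inductive RegisterResp (X : Type) : Type
  | ack
  | value (x : X)

/-- An array of `m` atomic MWMR registers, all initially holding the default value `x₀`. -/
def registerMemory (n m : ℕ) (X : Type) (x₀ : X) : Memory n where
  State := Fin m → X
  Op := RegisterOp m X
  Resp := RegisterResp X
  init := fun _ => x₀
  apply := fun _ op r =>
    match op with
    | .read i => (r, .value (r i))
    | .write i x => (Function.update r i x, .ack)

/-! ### Protocols and executions -/

/-- A deterministic (non-anonymous) protocol: each process knows its identity `p`, and its code may
depend on it. In a given local state a process either invokes an operation or has decided an
output value. -/
structure Protocol {n : ℕ} (M : Memory n) (V W : Type) where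
  Local : Type
  start : Fin n → V → Local
  action : Fin n → Local → M.Op ⊕ W
  next : Fin n → Local → M.Resp → Local

/-- The code of an anonymous process: it does not depend on any identity. -/
structure AnonymousCode {n : ℕ} (M : Memory n) (V W : Type) where
  Local : Type
  start : V → Local
  action : Local → M.Op ⊕ W
  next : Local → M.Resp → Local

/-- All processes execute the same anonymous code. -/
def AnonymousCode.toProtocol {n : ℕ} {M : Memory n} {V W : Type} (C : AnonymousCode M V W) :
    Protocol M V W where
  Local := C.Local
  start := fun _ => C.start
  action := fun _ => C.action
  next := fun _ => C.next

namespace Protocol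

variable {n : ℕ} {M : Memory n} {V W : Type}

/-- The local states of all processes together with the state of the shared memory. -/
structure Config (P : Protocol M V W) where
  locals : Fin n → P.Local
  mem : M.State

def initial (P : Protocol M V W) (v : Fin n → V) : P.Config where
  locals := fun p => P.start p (v p)
  mem := M.init

/-- One step of process `p`: it executes its pending operation, or idles if it has decided. -/
def step (P : Protocol M V W) (p : Fin n) (c : P.Config) : P.Config :=
  match P.action p (c.locals p) with
  | .inl op =>
      { locals := Function.update c.locals p
          (P.next p (c.locals p) (M.apply p op c.mem).2)
        mem := (M.apply p op c.mem).1 }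
  | .inr _ => c

/-- The configuration after the first `k` steps of the schedule `σ`, from inputs `v`. -/
def run (P : Protocol M V W) (v : Fin n → V) (σ : ℕ → Fin n) : ℕ → P.Config
  | 0 => P.initial v
  | k + 1 => P.step (σ k) (P.run v σ k)

/-- Process `p` decides `w` at some point of the execution. -/
def Decides (P : Protocol M V W) (v : Fin n → V) (σ : ℕ → Fin n) (p : Fin n) (w : W) : Prop :=
  ∃ k, P.action p ((P.run v σ k).locals p) = .inr w

end Protocol

/-- The processes that crash under the schedule `σ`: those scheduled only finitely often.
(A process that has decided keeps being scheduled, without effect.) -/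
def faulty {n : ℕ} (σ : ℕ → Fin n) : Set (Fin n) :=
  {p | {k | σ k = p}.Finite}

/-- `P` solves `T` in the presence of at most `t` crashes: whatever the inputs taken from an input
simplex `s`, in every asynchronous execution with at most `t` faulty processes each non-faulty
process decides, and the set of all decided values is a simplex of `Δ(s)`. -/
def Protocol.SolvesResilient {n : ℕ} {M : Memory n} {V W : Type} (P : Protocol M V W)
    (t : ℕ) (T : ColorlessTask V W) : Prop :=
  ∀ (s : {s : Finset V // s ∈ T.input.faces}) (v : Fin n → V), (∀ p, v p ∈ s.1) →
    ∀ σ : ℕ → Fin n, (faulty σ).ncard ≤ t →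
      (∀ p, p ∉ faulty σ → ∃ w, P.Decides v σ p w) ∧
      ∃ τ ∈ (T.carrier s).faces, (τ : Set W) = {w | ∃ p, P.Decides v σ p w}

/-- `t`-resilient solvability by `n` anonymous processes with atomic weak set objects. -/
def AnonymousWeakSetSolvable (n t : ℕ) {V W : Type} (T : ColorlessTask V W) : Prop :=
  ∃ (K X : Type) (C : AnonymousCode (weakSetMemory n K X) V W), C.toProtocol.SolvesResilient t T

/-- `t`-resilient solvability by `n` non-anonymous processes with atomic snapshot objects. -/
def SnapshotSolvable (n t : ℕ) {V W : Type} (T : ColorlessTask V W) : Prop :=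
  ∃ (K X : Type) (x₀ : X) (P : Protocol (snapshotMemory n K X x₀) V W), P.SolvesResilient t T

/-- `t`-resilient solvability by `n` anonymous processes with `m` atomic MWMR registers. -/
def AnonymousRegisterSolvable (n t m : ℕ) {V W : Type} (T : ColorlessTask V W) : Prop :=
  ∃ (X : Type) (x₀ : X) (C : AnonymousCode (registerMemory n m X x₀) V W),
    C.toProtocol.SolvesResilient t T

end AnonTask

/-!
A family of snapshot objects implements weak sets, since each component can hold the values that its
process has added, and multi-writer registers, with timestamps whose ties are broken by identity: a
write overtaken by one with a newer stamp is regarded as executed just before it.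

Conversely, let anonymous processes publish their histories in a growing set, of which they obtain
totally ordered views. They simulate a protocol on snapshots by agreeing, one after the other, on
the local states of each simulated process; the views order these states, so that they form an
execution of the protocol. To agree on a state, a process enters successive levels with a proposal.
It posts some proposal made at its level together with the number of entries it sees there, and
commits if all proposals it sees at this level are equal to its own. The next level may be entered
only when all entries to the present one have been posted, and only with a value whose post shows
the least number of entries. Hence the first commit determines the agreed state, every agreement
eventually ends unless a process crashes between its entry and its post, and a process works on one
simulated process at a time, so that `t` crashes block at most `t` simulated processes.

A weak set is such a growing set. On `n` registers, a process adds to what it knows all that it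
reads, and writes what it knows to a register that holds something else. After `n * n + 1` passes
over the registers that all find the same values, these values have been present simultaneously: a
pass during which they were not contains a write of one of them, and no process writes the same
value twice, as values carry a counter. So a view is a set of items held by all registers at the
same time. Between two writes that lose items of this view, a process reads all registers, and would
learn the items from any of them that still holds the view. Hence no process loses items twice
before all registers have lost some, and a process that has written the view never loses any. So
some register always holds the view, and the views form a chain.
-/

namespace AnonTask

/-! ### Finite executions -/

lemma exists_limit_of_isPrefix {α : Type*} {l : ℕ → List α} (hl : ∀ k, l k <+: l (k + 1))
    (hlen : ∀ N, ∃ k, N < (l k).length) :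
    ∃ σ : ℕ → α, ∀ k, l k = (List.range (l k).length).map σ := by
  choose K hK using hlen
  refine ⟨fun j => (l (K j))[j]'(hK j), fun k => List.ext_getElem (by simp) fun j h₁ h₂ => ?_⟩
  simp only [List.getElem_map, List.getElem_range]
  have isPrefix_of_le := @Nat.rel_of_forall_rel_succ_of_le _ (· <+: ·) _ _ _ hl
  rcases le_total k (K j) with h | h
  · exact (isPrefix_of_le h).getElem h₁
  · exact ((isPrefix_of_le h).getElem (hK j)).symm

section Schedules

variable {n : ℕ} {σ : ℕ → Fin n} {p : Fin n}

lemma exists_step_ge_of_notMem_faulty (h : p ∉ faulty σ) (k : ℕ) : ∃ j ≥ k, σ j = p :=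
  Filter.frequently_atTop.1 (Nat.frequently_atTop_iff_infinite.2 h) k

lemma notMem_faulty_iff_forall_exists_lt_count :
    p ∉ faulty σ ↔ ∀ N, ∃ k, N < Nat.count (σ · = p) k := by
  refine ⟨fun h N => ?_, fun h hp => ?_⟩
  · obtain ⟨k, hk⟩ := Nat.surjective_count_of_infinite_setOfPred h (N + 1)
    exact ⟨k, by lia⟩
  · obtain ⟨k, hk⟩ := h hp.toFinset.card
    refine hk.not_ge ?_
    rw [Nat.count_eq_card_filter_range]
    exact Finset.card_le_card fun j hj => hp.mem_toFinset.2 (Finset.mem_filter.1 hj).2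

lemma count_map_range (σ : ℕ → Fin n) (p : Fin n) (k : ℕ) :
    ((List.range k).map σ).count p = Nat.count (σ · = p) k := by
  rw [Nat.count, List.count, List.countP_map]
  exact List.countP_congr fun i _ => by simp

end Schedules

namespace Protocol

variable {n : ℕ} {M : Memory n} {V W : Type} (P : Protocol M V W)

/-- The configuration reached from `c` when the processes in `l` take one step each, in order. -/
def exec (c : P.Config) (l : List (Fin n)) : P.Config :=
  l.foldl (fun c p => P.step p c) c

@[simp] lemma exec_nil (c : P.Config) : P.exec c [] = c := rfl

@[simp] lemma exec_cons (c : P.Config) (p : Fin n) (l : List (Fin n)) :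
    P.exec c (p :: l) = P.exec (P.step p c) l := rfl

@[simp] lemma exec_append (c : P.Config) (l l' : List (Fin n)) :
    P.exec c (l ++ l') = P.exec (P.exec c l) l' :=
  List.foldl_append

lemma run_eq_exec (v : Fin n → V) (σ : ℕ → Fin n) (k : ℕ) :
    P.run v σ k = P.exec (P.initial v) ((List.range k).map σ) := by
  induction k with
  | zero => rfl
  | succ k ih => simp [List.range_succ, run, ih]

/-- In the configuration `c`, process `p` has decided `w`. -/
def HasDecided (c : P.Config) (p : Fin n) (w : W) : Prop :=
  P.action p (c.locals p) = .inr w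

lemma step_of_action_eq_inl {p : Fin n} {c : P.Config} {op : M.Op}
    (h : P.action p (c.locals p) = .inl op) :
    P.step p c = ⟨Function.update c.locals p (P.next p (c.locals p) (M.apply p op c.mem).2),
      (M.apply p op c.mem).1⟩ := by
  simp only [step, h]

lemma step_locals_of_ne {p q : Fin n} (h : p ≠ q) (c : P.Config) :
    (P.step q c).locals p = c.locals p := by
  unfold step
  split <;> simp [Function.update_of_ne h]

variable {P} {c : P.Config} {p : Fin n} {w w' : W}

lemma HasDecided.step_self (h : P.HasDecided c p w) : P.step p c = c := by
  unfold HasDecided at h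
  simp only [step, h]

lemma HasDecided.unique (h : P.HasDecided c p w) (h' : P.HasDecided c p w') : w = w' :=
  Sum.inr_injective (h.symm.trans h')

lemma HasDecided.step (h : P.HasDecided c p w) (q : Fin n) : P.HasDecided (P.step q c) p w := by
  rcases eq_or_ne p q with rfl | hpq
  · rwa [h.step_self]
  · rwa [HasDecided, P.step_locals_of_ne hpq]

lemma HasDecided.exec (h : P.HasDecided c p w) (l : List (Fin n)) :
    P.HasDecided (P.exec c l) p w := by
  induction l generalizing c with
  | nil => exact h
  | cons q _ ih => exact ih (h.step q)

lemma HasDecided.exec_of_isPrefix {l l' : List (Fin n)} (h : P.HasDecided (P.exec c l) p w)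
    (hl : l <+: l') : P.HasDecided (P.exec c l') p w := by
  obtain ⟨m, rfl⟩ := hl
  simpa only [exec_append] using h.exec m

lemma HasDecided.run_of_le {v : Fin n → V} {σ : ℕ → Fin n} {k k' : ℕ}
    (h : P.HasDecided (P.run v σ k) p w) (hk : k ≤ k') : P.HasDecided (P.run v σ k') p w := by
  induction hk with
  | refl => exact h
  | step _ ih => exact ih.step _

lemma exists_step_ge_locals_eq {v : Fin n → V} {σ : ℕ → Fin n} (hp : p ∉ faulty σ) (k : ℕ) :
    ∃ j ≥ k, σ j = p ∧ (P.run v σ j).locals p = (P.run v σ k).locals p := by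
  obtain ⟨j, hj, hjp⟩ := exists_step_ge_of_notMem_faulty hp k
  induction hj using Nat.decreasingInduction with
  | self => exact ⟨j, le_rfl, hjp, rfl⟩
  | of_succ i _ ih =>
    rcases eq_or_ne (σ i) p with hi | hi
    · exact ⟨i, le_rfl, hi, rfl⟩
    · obtain ⟨j', hj', hjp', heq⟩ := ih
      exact ⟨j', by lia, hjp', heq.trans (P.step_locals_of_ne hi.symm _)⟩

/-! ### Resilient solvability through finite executions -/

lemma exists_schedule_faulty_eq_empty (hn : 0 < n) (l : List (Fin n)) :
    ∃ σ : ℕ → Fin n, faulty σ = ∅ ∧ (List.range l.length).map σ = l := by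
  let σ : ℕ → Fin n := fun k => if h : k < l.length then l[k] else ⟨k % n, Nat.mod_lt _ hn⟩
  refine ⟨σ, Set.eq_empty_of_forall_notMem fun p => ?_, ?_⟩
  · refine Set.infinite_of_forall_exists_gt fun a => ⟨p + n * (l.length + a + 1), ?_, ?_⟩ <;>
      have hle : l.length + a + 1 ≤ n * (l.length + a + 1) := Nat.le_mul_of_pos_left _ hn
    · have hlen : ¬ p + n * (l.length + a + 1) < l.length := by lia
      simp [σ, hlen, Fin.ext_iff, Nat.mod_eq_of_lt p.2]
    · lia
  · exact List.ext_getElem (by simp) fun j _ h => by simp [σ, h]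

variable {t : ℕ} {T : ColorlessTask V W}

lemma SolvesResilient.exists_face_of_exec (hP : P.SolvesResilient t T) (hn : 0 < n)
    (s : {s : Finset V // s ∈ T.input.faces}) (v : Fin n → V) (hv : ∀ p, v p ∈ s.1)
    (l : List (Fin n)) :
    ∃ τ ∈ (T.carrier s).faces, ∀ p w, P.HasDecided (P.exec (P.initial v) l) p w → w ∈ τ := by
  obtain ⟨σ, hσ, hl⟩ := exists_schedule_faulty_eq_empty hn l
  obtain ⟨-, τ, hτ, hdec⟩ := hP s v hv σ (by simp [hσ])
  refine ⟨τ, hτ, fun p w hw => ?_⟩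
  rw [← Finset.mem_coe, hdec]
  exact ⟨p, l.length, by rwa [run_eq_exec, hl]⟩

lemma SolvesResilient.exists_face_of_isPrefix (hP : P.SolvesResilient t T) (hn : 0 < n)
    (s : {s : Finset V // s ∈ T.input.faces}) (v : Fin n → V) (hv : ∀ p, v p ∈ s.1)
    {l : ℕ → List (Fin n)} (hl : ∀ k, l k <+: l (k + 1)) :
    ∃ τ ∈ (T.carrier s).faces, ∀ k p w,
      P.HasDecided (P.exec (P.initial v) (l k)) p w → w ∈ τ := by
  have isPrefix_of_le := @Nat.rel_of_forall_rel_succ_of_le _ (· <+: ·) _ _ _ hl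
  have all_decided_by : ∀ p, ∃ K, ∀ k w, P.HasDecided (P.exec (P.initial v) (l k)) p w →
      P.HasDecided (P.exec (P.initial v) (l K)) p w := by
    intro p
    by_cases h : ∃ K w, P.HasDecided (P.exec (P.initial v) (l K)) p w
    · obtain ⟨K, w, hw⟩ := h
      refine ⟨K, fun k w' hw' => ?_⟩
      have hKk := hw.exec_of_isPrefix (isPrefix_of_le (le_max_left K k))
      rwa [(hw'.exec_of_isPrefix (isPrefix_of_le (le_max_right K k))).unique hKk]
    · exact ⟨0, fun k w hw => absurd ⟨k, w, hw⟩ h⟩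
  choose K hK using all_decided_by
  obtain ⟨τ, hτ, hdec⟩ := hP.exists_face_of_exec hn s v hv (l (Finset.univ.sup K))
  exact ⟨τ, hτ, fun k p w hw => hdec p w <|
    (hK p k w hw).exec_of_isPrefix (isPrefix_of_le (Finset.le_sup (Finset.mem_univ p)))⟩

lemma SolvesResilient.exists_hasDecided_of_isPrefix (hP : P.SolvesResilient t T)
    (s : {s : Finset V // s ∈ T.input.faces}) (v : Fin n → V) (hv : ∀ p, v p ∈ s.1)
    {l : ℕ → List (Fin n)} (hl : ∀ k, l k <+: l (k + 1)) {F : Set (Fin n)} (hF : F.ncard ≤ t)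
    (hcount : ∀ p ∉ F, ∀ N, ∃ k, N < (l k).count p) (hp : p ∉ F) :
    ∃ k w, P.HasDecided (P.exec (P.initial v) (l k)) p w := by
  have hlen : ∀ N, ∃ k, N < (l k).length := fun N =>
    (hcount p hp N).imp fun k hk => hk.trans_le List.count_le_length
  obtain ⟨σ, hσ⟩ := exists_limit_of_isPrefix hl hlen
  have hsub : faulty σ ⊆ F := by
    intro q hq
    by_contra hqF
    refine notMem_faulty_iff_forall_exists_lt_count.2 (fun N => ?_) hq
    obtain ⟨k, hk⟩ := hcount q hqF N
    exact ⟨(l k).length, by rwa [← count_map_range, ← hσ k]⟩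
  obtain ⟨hlive, -⟩ := hP s v hv σ ((Set.ncard_le_ncard hsub).trans hF)
  obtain ⟨w, j, hj⟩ := hlive p fun h => hp (hsub h)
  obtain ⟨k, hk⟩ := hlen j
  refine ⟨k, w, ?_⟩
  rw [hσ k, ← run_eq_exec]
  exact HasDecided.run_of_le hj hk.le

lemma solvesResilient_of_forall_decides_mem (htn : t < n)
    (h : ∀ (s : {s : Finset V // s ∈ T.input.faces}) (v : Fin n → V), (∀ p, v p ∈ s.1) →
      ∀ σ : ℕ → Fin n, (faulty σ).ncard ≤ t →
        (∀ p ∉ faulty σ, ∃ w, P.Decides v σ p w) ∧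
        ∃ τ ∈ (T.carrier s).faces, ∀ p w, P.Decides v σ p w → w ∈ τ) :
    P.SolvesResilient t T := by
  classical
  intro s v hv σ hσ
  obtain ⟨hlive, τ, hτ, hdec⟩ := h s v hv σ hσ
  -- Some process is correct and decides, so the decided values form a nonempty subset of `τ`.
  refine ⟨hlive, {w ∈ τ | ∃ p, P.Decides v σ p w}, ?_, ?_⟩
  · obtain ⟨p, hp⟩ : ∃ p, p ∉ faulty σ := by
      by_contra! hall
      rw [Set.eq_univ_of_forall hall, Set.ncard_univ, Nat.card_fin] at hσ
      lia
    obtain ⟨w, hw⟩ := hlive p hp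
    exact ((T.carrier s).isRelLowerSet_faces hτ).2 (Finset.filter_subset _ _)
      ⟨w, Finset.mem_filter.2 ⟨hdec p w hw, p, hw⟩⟩
  · ext w
    simp only [Finset.coe_filter, Set.mem_ofPred_eq, and_iff_right_iff_imp]
    exact fun ⟨p, hp⟩ => hdec p w hp

/-! ### Steps on the three memories -/

section WeakSet

variable {n : ℕ} {V W K X : Type} {P : Protocol (weakSetMemory n K X) V W} {c : P.Config}
  {p : Fin n} {k : K}

lemma step_of_action_eq_add [DecidableEq K] {x : X}
    (h : P.action p (c.locals p) = .inl (.add k x)) :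
    P.step p c = ⟨Function.update c.locals p (P.next p (c.locals p) .ack),
      Function.update c.mem k (insert x (c.mem k))⟩ := by
  rw [P.step_of_action_eq_inl h]
  simp only [weakSetMemory]
  congr!

lemma step_of_action_eq_get (h : P.action p (c.locals p) = .inl (.get k)) :
    P.step p c = ⟨Function.update c.locals p (P.next p (c.locals p) (.values (c.mem k))), c.mem⟩ :=
  P.step_of_action_eq_inl h

end WeakSet

section Snapshot

variable {n : ℕ} {V W K X : Type} {x₀ : X} {P : Protocol (snapshotMemory n K X x₀) V W}
  {c : P.Config} {p : Fin n} {k : K}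

lemma step_of_action_eq_update [DecidableEq K] {x : X}
    (h : P.action p (c.locals p) = .inl (.update k x)) :
    P.step p c = ⟨Function.update c.locals p (P.next p (c.locals p) .ack),
      Function.update c.mem k (Function.update (c.mem k) p x)⟩ := by
  rw [P.step_of_action_eq_inl h]
  simp only [snapshotMemory]
  congr!

lemma step_of_action_eq_scan (h : P.action p (c.locals p) = .inl (.scan k)) :
    P.step p c = ⟨Function.update c.locals p (P.next p (c.locals p) (.view (c.mem k))), c.mem⟩ :=
  P.step_of_action_eq_inl h

end Snapshot

section Register

variable {n m : ℕ} {V W X : Type} {x₀ : X} {P : Protocol (registerMemory n m X x₀) V W}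
  {c : P.Config} {p : Fin n} {i : Fin m}

lemma step_of_action_eq_read (h : P.action p (c.locals p) = .inl (.read i)) :
    P.step p c = ⟨Function.update c.locals p (P.next p (c.locals p) (.value (c.mem i))), c.mem⟩ :=
  P.step_of_action_eq_inl h

lemma step_of_action_eq_write {x : X} (h : P.action p (c.locals p) = .inl (.write i x)) :
    P.step p c = ⟨Function.update c.locals p (P.next p (c.locals p) .ack),
      Function.update c.mem i x⟩ :=
  P.step_of_action_eq_inl h

end Register

end Protocol

/-! ### Forward simulations -/

/-- A forward simulation of the protocol `P` by the protocol `P'`. Each step of a process of `P'` is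
matched by finitely many steps of `P`, possibly by other processes; `lag p` counts the steps of `p`
in `P'` that have not yet been paid for by steps of `p` in `P`, at `rate` per step of `P`. -/
structure ForwardSimulation {n : ℕ} {M M' : Memory n} {V W : Type} (P' : Protocol M' V W)
    (P : Protocol M V W) where
  Rel : P'.Config → P.Config → (Fin n → ℕ) → Prop
  rate : ℕ
  initial : ∀ v, ∃ lag, Rel (P'.initial v) (P.initial v) lag
  step : ∀ {c a lag}, Rel c a lag → ∀ p, ∃ l lag', Rel (P'.step p c) (P.exec a l) lag' ∧
    ∀ q, lag q + (if p = q then 1 else 0) ≤ lag' q + rate * l.count q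
  lag_le : ∀ {c a lag}, Rel c a lag → ∀ p, lag p ≤ rate
  hasDecided : ∀ {c a lag}, Rel c a lag → ∀ {p w}, P'.HasDecided c p w → P.HasDecided a p w
  hasDecided_step : ∀ {c a lag}, Rel c a lag → ∀ {p w}, P.HasDecided a p w →
    P'.HasDecided (P'.step p c) p w

namespace ForwardSimulation

variable {n : ℕ} {M M' : Memory n} {V W : Type} {P' : Protocol M' V W} {P : Protocol M V W}

lemma exists_matching_schedule (S : ForwardSimulation P' P) (v : Fin n → V) (σ : ℕ → Fin n) :
    ∃ l : ℕ → List (Fin n), (∀ k, l k <+: l (k + 1)) ∧ ∀ k, ∃ lag,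
      S.Rel (P'.run v σ k) (P.exec (P.initial v) (l k)) lag ∧
      ∀ q, Nat.count (σ · = q) k ≤ lag q + S.rate * (l k).count q := by
  let Matches (k : ℕ) (l : List (Fin n)) : Prop := ∃ lag,
    S.Rel (P'.run v σ k) (P.exec (P.initial v) l) lag ∧
    ∀ q, Nat.count (σ · = q) k ≤ lag q + S.rate * l.count q
  have hzero : Matches 0 [] := (S.initial v).imp fun lag h => ⟨h, by simp⟩
  have hsucc (k : ℕ) (l : {l // Matches k l}) :
      ∃ l' : {l' // Matches (k + 1) l'}, l.1 <+: l'.1 := by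
    obtain ⟨l, lag, hR, hcount⟩ := l
    obtain ⟨m, lag', hR', hlag⟩ := S.step hR (σ k)
    refine ⟨⟨l ++ m, lag', by rwa [Protocol.exec_append], fun q => ?_⟩, List.prefix_append l m⟩
    rw [Nat.count_succ, List.count_append, Nat.mul_add]
    have := hcount q
    have := hlag q
    lia
  choose f hf using hsucc
  let g (k : ℕ) : {l // Matches k l} := Nat.rec ⟨[], hzero⟩ f k
  exact ⟨fun k => (g k).1, fun k => hf k (g k), fun k => (g k).2⟩

theorem solvesResilient (S : ForwardSimulation P' P) {t : ℕ} {T : ColorlessTask V W}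
    (hP : P.SolvesResilient t T) (htn : t < n) : P'.SolvesResilient t T := by
  refine Protocol.solvesResilient_of_forall_decides_mem htn fun s v hv σ hσ => ?_
  obtain ⟨l, hl, hR⟩ := S.exists_matching_schedule v σ
  choose lag hR hlag using hR
  have hcount : ∀ p ∉ faulty σ, ∀ N, ∃ k, N < (l k).count p := by
    intro p hp N
    obtain ⟨k, hk⟩ := notMem_faulty_iff_forall_exists_lt_count.1 hp (S.rate * (N + 1))
    refine ⟨k, lt_of_not_ge fun hN => hk.not_ge ?_⟩
    calc Nat.count (σ · = p) k ≤ lag k p + S.rate * (l k).count p := hlag k p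
      _ ≤ S.rate + S.rate * N := add_le_add (S.lag_le (hR k) p) (Nat.mul_le_mul_left _ hN)
      _ = S.rate * (N + 1) := by ring
  refine ⟨fun p hp => ?_, ?_⟩
  · obtain ⟨k, w, hw⟩ := hP.exists_hasDecided_of_isPrefix s v hv hl hσ hcount hp
    obtain ⟨j, hkj, rfl⟩ := exists_step_ge_of_notMem_faulty hp k
    have hschedule := Nat.rel_of_forall_rel_succ_of_le (· <+: ·) hl hkj
    exact ⟨w, j + 1, S.hasDecided_step (hR j) (hw.exec_of_isPrefix hschedule)⟩
  · obtain ⟨τ, hτ, hdec⟩ := hP.exists_face_of_isPrefix (by lia) s v hv hl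
    exact ⟨τ, hτ, fun p w ⟨k, hk⟩ => hdec k p w (S.hasDecided (hR k) hk)⟩

end ForwardSimulation

/-! ### Weak sets from snapshots -/

section WeakSetFromSnapshot

variable {n t : ℕ} {V W K X : Type}

/-- Implementation of weak sets from snapshots: each process keeps the values it has added to the
`k`-th weak set in its own component of the `k`-th snapshot object, and in its local state. -/
def snapshotOfWeakSet (P : Protocol (weakSetMemory n K X) V W) [DecidableEq K] :
    Protocol (snapshotMemory n K (Set X) ∅) V W where
  Local := P.Local × (K → Set X)
  start := fun p v => (P.start p v, fun _ => ∅)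
  action := fun p s =>
    match P.action p s.1 with
    | .inl (.add k x) => .inl (.update k (insert x (s.2 k)))
    | .inl (.get k) => .inl (.scan k)
    | .inr w => .inr w
  next := fun p s r =>
    match P.action p s.1, r with
    | .inl (.add k x), _ => (P.next p s.1 .ack, Function.update s.2 k (insert x (s.2 k)))
    | .inl (.get _), .view a => (P.next p s.1 (.values (⋃ q, a q)), s.2)
    | _, _ => s

variable {P : Protocol (weakSetMemory n K X) V W}

/-- The simulation relation between `snapshotOfWeakSet P` and `P`. -/
structure WeakSetRel [DecidableEq K] (c : (snapshotOfWeakSet P).Config) (a : P.Config) : Prop where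
  locals_eq : ∀ p, (c.locals p).1 = a.locals p
  own_eq : ∀ p k, (c.locals p).2 k = c.mem k p
  mem_eq : ∀ k, a.mem k = ⋃ p, c.mem k p

variable [DecidableEq K]

lemma snapshotOfWeakSet_action_eq_inr (p : Fin n) (s : P.Local × (K → Set X)) (w : W) :
    (snapshotOfWeakSet P).action p s = .inr w ↔ P.action p s.1 = .inr w := by
  rcases hact : P.action p s.1 with (⟨k, x⟩ | k) | w' <;> simp [snapshotOfWeakSet, hact]

lemma iUnion_update_insert (f : Fin n → Set X) (p : Fin n) (x : X) :
    ⋃ q, Function.update f p (insert x (f p)) q = insert x (⋃ q, f q) := by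
  ext y
  simp only [Set.mem_iUnion, Set.mem_insert_iff, Function.update_apply]
  constructor
  · rintro ⟨q, hq⟩
    split_ifs at hq with hqp
    · exact hq.imp_right fun h => ⟨p, h⟩
    · exact .inr ⟨q, hq⟩
  · rintro (rfl | ⟨q, hq⟩)
    · exact ⟨p, by simp⟩
    · exact ⟨q, by split_ifs with hqp <;> simp_all⟩

namespace WeakSetRel

variable {c : (snapshotOfWeakSet P).Config} {a : P.Config}

lemma step_add (h : WeakSetRel c a) {p : Fin n} {k : K} {x : X}
    (hact : P.action p (a.locals p) = .inl (.add k x)) :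
    WeakSetRel ((snapshotOfWeakSet P).step p c) (P.step p a) := by
  have hact' : (snapshotOfWeakSet P).action p (c.locals p) =
      .inl (.update k (insert x ((c.locals p).2 k))) := by
    simp [snapshotOfWeakSet, h.locals_eq, hact]
  rw [Protocol.step_of_action_eq_update hact', Protocol.step_of_action_eq_add hact]
  refine ⟨fun q => ?_, fun q i => ?_, fun i => ?_⟩
  · rcases eq_or_ne q p with rfl | hq
    · simp [snapshotOfWeakSet, h.locals_eq, hact]
    · simpa [hq] using h.locals_eq q
  · rcases eq_or_ne q p with rfl | hq <;> rcases eq_or_ne i k with rfl | hi <;>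
      simp [*, snapshotMemory, snapshotOfWeakSet, h.locals_eq, h.own_eq]
  · rcases eq_or_ne i k with rfl | hi
    · simp [weakSetMemory, snapshotMemory, h.own_eq, h.mem_eq, iUnion_update_insert]
    · simp [weakSetMemory, snapshotMemory, hi, h.mem_eq]

lemma step_get (h : WeakSetRel c a) {p : Fin n} {k : K}
    (hact : P.action p (a.locals p) = .inl (.get k)) :
    WeakSetRel ((snapshotOfWeakSet P).step p c) (P.step p a) := by
  have hact' : (snapshotOfWeakSet P).action p (c.locals p) = .inl (.scan k) := by
    simp [snapshotOfWeakSet, h.locals_eq, hact]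
  rw [Protocol.step_of_action_eq_scan hact', Protocol.step_of_action_eq_get hact]
  refine ⟨fun q => ?_, fun q i => ?_, h.mem_eq⟩
  · rcases eq_or_ne q p with rfl | hq
    · simp [snapshotOfWeakSet, h.locals_eq, hact, h.mem_eq]
    · simpa [hq] using h.locals_eq q
  · rcases eq_or_ne q p with rfl | hq
    · simp [snapshotOfWeakSet, h.locals_eq, hact, h.own_eq]
    · simpa [hq] using h.own_eq q i

lemma hasDecided_iff (h : WeakSetRel c a) {p : Fin n} {w : W} :
    (snapshotOfWeakSet P).HasDecided c p w ↔ P.HasDecided a p w :=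
  (snapshotOfWeakSet_action_eq_inr p _ w).trans (by rw [h.locals_eq, Protocol.HasDecided])

lemma step (h : WeakSetRel c a) (p : Fin n) :
    WeakSetRel ((snapshotOfWeakSet P).step p c) (P.step p a) := by
  rcases hact : P.action p (a.locals p) with (⟨k, x⟩ | k) | w
  · exact h.step_add hact
  · exact h.step_get hact
  · rwa [Protocol.HasDecided.step_self (h.hasDecided_iff.2 hact),
      Protocol.HasDecided.step_self (P := P) hact]

end WeakSetRel

variable (P) in
/-- The step-by-step simulation of `P` by `snapshotOfWeakSet P`. -/
def weakSetSimulation : ForwardSimulation (snapshotOfWeakSet P) P where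
  Rel c a lag := WeakSetRel c a ∧ lag = 0
  rate := 1
  initial v := ⟨0, ⟨fun _ => rfl, fun _ _ => rfl, fun _ => Set.iUnion_empty.symm⟩, rfl⟩
  step := by
    rintro c a _ ⟨h, rfl⟩ p
    exact ⟨[p], 0, ⟨h.step p, rfl⟩, fun q => by simp [List.count_singleton]⟩
  lag_le := by simp
  hasDecided h := h.1.hasDecided_iff.1
  hasDecided_step h _ _ hw := (h.1.hasDecided_iff.2 hw).step _

theorem AnonymousWeakSetSolvable.snapshotSolvable {T : ColorlessTask V W} (htn : t < n)
    (h : AnonymousWeakSetSolvable n t T) : SnapshotSolvable n t T := by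
  classical
  obtain ⟨K, X, C, hC⟩ := h
  exact ⟨K, Set X, ∅, snapshotOfWeakSet C.toProtocol, (weakSetSimulation _).solvesResilient hC htn⟩

end WeakSetFromSnapshot

/-! ### Registers from snapshots -/

section Stamps

variable {n : ℕ} {X : Type}

/-- The stamp of the value in the `q`-th component of `a`: its timestamp, with ties broken by the
identity of the writer. -/
def stamp (a : Fin n → ℕ × X) (q : Fin n) : ℕ ×ₗ Fin n := toLex ((a q).1, q)

lemma stamp_lt_iff {a : Fin n → ℕ × X} {q : Fin n} {ts : ℕ} :
    stamp a q < toLex (ts, q) ↔ (a q).1 < ts := by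
  simp [stamp, Prod.Lex.toLex_lt_toLex]

lemma stamp_update_self (a : Fin n → ℕ × X) (p : Fin n) (y : ℕ × X) :
    stamp (Function.update a p y) p = toLex (y.1, p) := by
  simp [stamp]

lemma stamp_update_of_ne {q p : Fin n} (h : q ≠ p) (a : Fin n → ℕ × X) (y : ℕ × X) :
    stamp (Function.update a p y) q = stamp a q := by
  simp [stamp, h]

variable [NeZero n]

/-- The component of `a` with the largest stamp. -/
noncomputable def newest (a : Fin n → ℕ × X) : Fin n := (Finite.exists_max (stamp a)).choose

variable {a : Fin n → ℕ × X} {p q : Fin n} {y : ℕ × X}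

lemma stamp_le_stamp_newest (a : Fin n → ℕ × X) (q : Fin n) : stamp a q ≤ stamp a (newest a) :=
  (Finite.exists_max (stamp a)).choose_spec q

lemma newest_eq_of_forall_stamp_le (h : ∀ q, stamp a q ≤ stamp a p) : newest a = p :=
  congrArg (fun z => (ofLex z).2) ((h (newest a)).antisymm (stamp_le_stamp_newest a p))

lemma newest_update_of_lt (h : stamp a (newest a) < toLex (y.1, p)) :
    newest (Function.update a p y) = p := by
  refine newest_eq_of_forall_stamp_le fun q => ?_
  rcases eq_or_ne q p with rfl | hq
  · rfl
  · rw [stamp_update_of_ne hq, stamp_update_self]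
    exact (stamp_le_stamp_newest a q).trans h.le

lemma ne_newest_of_lt (hp : (a p).1 < y.1) (h : toLex (y.1, p) < stamp a (newest a)) :
    newest a ≠ p := by
  intro heq
  rw [heq] at h
  exact h.asymm (stamp_lt_iff.2 hp)

lemma newest_update_of_gt (hp : (a p).1 < y.1) (h : toLex (y.1, p) < stamp a (newest a)) :
    newest (Function.update a p y) = newest a := by
  refine newest_eq_of_forall_stamp_le fun q => ?_
  rw [stamp_update_of_ne (ne_newest_of_lt hp h)]
  rcases eq_or_ne q p with rfl | hq
  · rw [stamp_update_self]
    exact h.le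
  · rw [stamp_update_of_ne hq]
    exact stamp_le_stamp_newest a q

end Stamps

section RegisterFromSnapshot

variable {n m t : ℕ} {V W X : Type} {x₀ : X}

lemma exec_writes {P : Protocol (registerMemory n m X x₀) V W} {i : Fin m} {l : List (Fin n)} :
    ∀ {a : P.Config}, l.Nodup →
      (∀ q ∈ l, ∃ x, P.action q (a.locals q) = .inl (.write i x)) →
      (∀ q, (P.exec a l).locals q =
        if q ∈ l then P.next q (a.locals q) .ack else a.locals q) ∧
      ∀ j ≠ i, (P.exec a l).mem j = a.mem j := by
  induction l with
  | nil => simp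
  | cons p l ih =>
    intro a hl h
    obtain ⟨hpl, hl⟩ := List.nodup_cons.1 hl
    obtain ⟨x, hx⟩ := h p List.mem_cons_self
    have locals_of_ne : ∀ q ≠ p, (P.step p a).locals q = a.locals q := fun q hq =>
      P.step_locals_of_ne hq a
    obtain ⟨hlocals, hmem⟩ := ih (a := P.step p a) hl fun q hq => by
      rw [locals_of_ne q (ne_of_mem_of_not_mem hq hpl)]
      exact h q (List.mem_cons_of_mem p hq)
    refine ⟨fun q => ?_, fun j hj => ?_⟩
    · rw [Protocol.exec_cons, hlocals]
      rcases eq_or_ne q p with rfl | hq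
      · rw [Protocol.step_of_action_eq_write hx]
        simp [hpl]
      · simp [hq, locals_of_ne q hq]
    · rw [Protocol.exec_cons, hmem j hj, Protocol.step_of_action_eq_write hx]
      simp [registerMemory, hj]

variable [NeZero n] (P : Protocol (registerMemory n m X x₀) V W)

/-- Implementation of multi-writer registers from snapshots: a write first scans to choose a larger
timestamp, which is kept in the local state until the value is written to the writer's own
component; a read returns the newest value. -/
noncomputable def snapshotOfRegister : Protocol (snapshotMemory n (Fin m) (ℕ × X) (0, x₀)) V W where
  Local := P.Local × Option ℕ
  start := fun p v => (P.start p v, none)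
  action := fun p s =>
    match P.action p s.1, s.2 with
    | .inl (.read i), _ => .inl (.scan i)
    | .inl (.write i _), none => .inl (.scan i)
    | .inl (.write i x), some ts => .inl (.update i (ts, x))
    | .inr w, _ => .inr w
  next := fun p s r =>
    match P.action p s.1, s.2, r with
    | .inl (.read _), _, .view a => (P.next p s.1 (.value (a (newest a)).2), none)
    | .inl (.write _ _), none, .view a => (s.1, some ((a (newest a)).1 + 1))
    | .inl (.write _ _), some _, _ => (P.next p s.1 .ack, none)
    | _, _, _ => s

/-- How the local state of process `q` in `snapshotOfRegister P` corresponds to its local state in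
`P`, and its lag, when the snapshot objects hold `mem`. A pending write whose stamp has been
exceeded by that of another write is `overtaken`: it has already been executed in `P`, just before
the write that exceeded it. -/
inductive RegisterLocalRel (mem : Fin m → Fin n → ℕ × X) (q : Fin n) :
    P.Local × Option ℕ → P.Local → ℕ → Prop
  | idle (s : P.Local) : RegisterLocalRel mem q (s, none) s 1
  | pending {s : P.Local} {i : Fin m} {x : X} {ts : ℕ} (hact : P.action q s = .inl (.write i x))
      (hts : stamp (mem i) (newest (mem i)) < toLex (ts, q)) :
      RegisterLocalRel mem q (s, some ts) s 2
  | overtaken {s : P.Local} {i : Fin m} {x : X} {ts : ℕ} (hact : P.action q s = .inl (.write i x))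
      (hown : (mem i q).1 < ts) (hts : toLex (ts, q) < stamp (mem i) (newest (mem i))) :
      RegisterLocalRel mem q (s, some ts) (P.next q s .ack) 0

/-- The simulation relation between `snapshotOfRegister P` and `P`. -/
structure RegisterRel (c : (snapshotOfRegister P).Config) (a : P.Config) (lag : Fin n → ℕ) :
    Prop where
  mem_eq : ∀ i, a.mem i = (c.mem i (newest (c.mem i))).2
  locals : ∀ q, RegisterLocalRel P c.mem q (c.locals q) (a.locals q) (lag q)

variable {P}

namespace RegisterLocalRel

variable {mem : Fin m → Fin n → ℕ × X} {p q : Fin n} {i : Fin m} {y : ℕ × X}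
  {s' : P.Local × Option ℕ} {s : P.Local} {d : ℕ}

lemma lag_le (h : RegisterLocalRel P mem q s' s d) : d ≤ 2 := by
  cases h <;> simp

lemma update_of_stamp_newest_eq (h : RegisterLocalRel P mem q s' s d) (hq : q ≠ p)
    (hy : stamp (Function.update (mem i) p y) (newest (Function.update (mem i) p y)) =
      stamp (mem i) (newest (mem i))) :
    RegisterLocalRel P (Function.update mem i (Function.update (mem i) p y)) q s' s d := by
  cases h with
  | idle => exact .idle _
  | @pending _ j _ _ hact hts =>
    refine .pending hact ?_
    rcases eq_or_ne j i with rfl | hj <;> simp [*]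
  | @overtaken _ j _ _ hact hown hts =>
    refine .overtaken hact ?_ ?_ <;> rcases eq_or_ne j i with rfl | hj <;> simp [*]

lemma update_of_lt (h : RegisterLocalRel P mem q s' s d) (hq : q ≠ p)
    (hy : stamp (mem i) (newest (mem i)) < toLex (y.1, p)) :
    RegisterLocalRel P (Function.update mem i (Function.update (mem i) p y)) q s' s d ∨
      RegisterLocalRel P (Function.update mem i (Function.update (mem i) p y)) q s'
        (P.next q s .ack) 0 ∧ d = 2 ∧ ∃ x, P.action q s = .inl (.write i x) := by
  have hnewest := newest_update_of_lt hy
  cases h with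
  | idle => exact .inl (.idle _)
  | @pending _ j _ ts hact hts =>
    rcases eq_or_ne j i with rfl | hj
    · rcases lt_or_gt_of_ne (a := toLex (ts, q)) (b := toLex (y.1, p)) (by simp [hq])
        with hlt | hgt
      · refine .inr ⟨.overtaken hact ?_ ?_, rfl, _, hact⟩
        · simpa [hq] using stamp_lt_iff.1 ((stamp_le_stamp_newest _ q).trans_lt hts)
        · simpa [hnewest, stamp_update_self] using hlt
      · exact .inl (.pending hact (by simpa [hnewest, stamp_update_self] using hgt))
    · exact .inl (.pending hact (by simpa [hj] using hts))
  | @overtaken _ j _ _ hact hown hts =>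
    refine .inl (.overtaken hact ?_ ?_) <;> rcases eq_or_ne j i with rfl | hj
    · simpa [hq] using hown
    · simpa [hj] using hown
    · simpa [hnewest, stamp_update_self] using hts.trans hy
    · simpa [hj] using hts

end RegisterLocalRel

namespace RegisterRel

variable {c : (snapshotOfRegister P).Config} {a : P.Config} {lag : Fin n → ℕ} {p : Fin n}

lemma hasDecided (h : RegisterRel P c a lag) {w : W}
    (hw : (snapshotOfRegister P).HasDecided c p w) : P.HasDecided a p w := by
  have hp := h.locals p
  unfold Protocol.HasDecided at hw ⊢
  generalize c.locals p = s', a.locals p = s, lag p = d at hp hw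
  cases hp with
  | idle =>
    rcases hact : P.action p s with (i | ⟨i, x⟩) | w' <;> simp_all [snapshotOfRegister]
  | pending hact => simp [snapshotOfRegister, hact] at hw
  | overtaken hact => simp [snapshotOfRegister, hact] at hw

lemma step_read (h : RegisterRel P c a lag) {i : Fin m} (hc : c.locals p = (a.locals p, none))
    (hact : P.action p (a.locals p) = .inl (.read i)) :
    RegisterRel P ((snapshotOfRegister P).step p c) (P.step p a) (Function.update lag p 1) := by
  have hact' : (snapshotOfRegister P).action p (c.locals p) = .inl (.scan i) := by
    simp [snapshotOfRegister, hc, hact]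
  rw [Protocol.step_of_action_eq_scan hact', Protocol.step_of_action_eq_read hact]
  refine ⟨h.mem_eq, fun q => ?_⟩
  rcases eq_or_ne q p with rfl | hq
  · simpa [snapshotOfRegister, hc, hact, h.mem_eq] using .idle _
  · simpa [hq] using h.locals q

lemma step_choose_stamp (h : RegisterRel P c a lag) {i : Fin m} {x : X}
    (hc : c.locals p = (a.locals p, none))
    (hact : P.action p (a.locals p) = .inl (.write i x)) :
    RegisterRel P ((snapshotOfRegister P).step p c) a (Function.update lag p 2) := by
  have hact' : (snapshotOfRegister P).action p (c.locals p) = .inl (.scan i) := by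
    simp [snapshotOfRegister, hc, hact]
  rw [Protocol.step_of_action_eq_scan hact']
  refine ⟨h.mem_eq, fun q => ?_⟩
  rcases eq_or_ne q p with rfl | hq
  · simp only [Function.update_self, snapshotOfRegister, hc, hact]
    exact .pending hact (by simp [stamp, Prod.Lex.toLex_lt_toLex])
  · simpa [hq] using h.locals q

lemma step_overtaken (h : RegisterRel P c a lag) {i : Fin m} {x : X} {s : P.Local} {ts : ℕ}
    (hc : c.locals p = (s, some ts)) (ha : a.locals p = P.next p s .ack)
    (hact : P.action p s = .inl (.write i x)) (hown : (c.mem i p).1 < ts)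
    (hts : toLex (ts, p) < stamp (c.mem i) (newest (c.mem i))) :
    RegisterRel P ((snapshotOfRegister P).step p c) a (Function.update lag p 1) := by
  have hact' : (snapshotOfRegister P).action p (c.locals p) = .inl (.update i (ts, x)) := by
    simp [snapshotOfRegister, hc, hact]
  have hnewest := newest_update_of_gt (y := (ts, x)) hown hts
  have hne := ne_newest_of_lt (y := (ts, x)) hown hts
  rw [Protocol.step_of_action_eq_update hact']
  refine ⟨fun j => ?_, fun q => ?_⟩
  · rcases eq_or_ne j i with rfl | hj
    · simp [snapshotMemory, hnewest, hne, h.mem_eq]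
    · simp [snapshotMemory, hj, h.mem_eq]
  · rcases eq_or_ne q p with rfl | hq
    · simpa [snapshotOfRegister, hc, hact, ha] using .idle _
    · simpa [hq] using (h.locals q).update_of_stamp_newest_eq hq
        (by rw [hnewest, stamp_update_of_ne hne])

lemma step_pending (h : RegisterRel P c a lag) {i : Fin m} {x : X} {ts : ℕ}
    (hc : c.locals p = (a.locals p, some ts)) (hact : P.action p (a.locals p) = .inl (.write i x))
    (hts : stamp (c.mem i) (newest (c.mem i)) < toLex (ts, p)) :
    ∃ l : List (Fin n), l.Nodup ∧ p ∉ l ∧ (∀ q ∈ l, lag q = 2) ∧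
      RegisterRel P ((snapshotOfRegister P).step p c) (P.exec a (l ++ [p]))
        (fun q => if q = p then 1 else if q ∈ l then 0 else lag q) := by
  classical
  have hact' : (snapshotOfRegister P).action p (c.locals p) = .inl (.update i (ts, x)) := by
    simp [snapshotOfRegister, hc, hact]
  let mem' := Function.update c.mem i (Function.update (c.mem i) p (ts, x))
  have hlocals (q : Fin n) (hq : q ≠ p) := (h.locals q).update_of_lt hq (y := (ts, x)) hts
  let l : List (Fin n) := Finset.univ.toList.filter fun q =>
    q ≠ p ∧ ¬ RegisterLocalRel P mem' q (c.locals q) (a.locals q) (lag q)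
  have hpl : p ∉ l := by simp [l]
  have overtakes (q : Fin n) (hq : q ∈ l) :
      RegisterLocalRel P mem' q (c.locals q) (P.next q (a.locals q) .ack) 0 ∧ lag q = 2 ∧
        ∃ y, P.action q (a.locals q) = .inl (.write i y) := by
    obtain ⟨-, hq⟩ := List.mem_filter.1 hq
    obtain ⟨hqp, hrel⟩ := of_decide_eq_true hq
    exact (hlocals q hqp).resolve_left hrel
  have hl : l.Nodup := Finset.univ.nodup_toList.filter _
  obtain ⟨locals_exec, mem_exec⟩ := exec_writes hl fun q hq => (overtakes q hq).2.2
  have hact_exec : P.action p ((P.exec a l).locals p) = .inl (.write i x) := by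
    rwa [locals_exec, if_neg hpl]
  refine ⟨l, hl, hpl, fun q hq => (overtakes q hq).2.1, ?_⟩
  rw [Protocol.exec_append, Protocol.exec_cons, Protocol.exec_nil,
    Protocol.step_of_action_eq_update hact', Protocol.step_of_action_eq_write hact_exec]
  refine ⟨fun j => ?_, fun q => ?_⟩
  · rcases eq_or_ne j i with rfl | hj
    · simp [registerMemory, snapshotMemory, newest_update_of_lt (y := (ts, x)) hts]
    · simpa [registerMemory, snapshotMemory, hj] using (mem_exec j hj).trans (h.mem_eq j)
  · rcases eq_or_ne q p with rfl | hq
    · simpa [snapshotOfRegister, hc, hact, locals_exec, hpl] using .idle _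
    · by_cases hql : q ∈ l
      · simpa [hq, hql, locals_exec] using (overtakes q hql).1
      · have hrel : RegisterLocalRel P mem' q (c.locals q) (a.locals q) (lag q) := by
          simpa [l, hq] using hql
        simpa [hq, hql, locals_exec] using hrel

lemma hasDecided_step (h : RegisterRel P c a lag) {w : W} (hw : P.HasDecided a p w) :
    (snapshotOfRegister P).HasDecided ((snapshotOfRegister P).step p c) p w := by
  have hp := h.locals p
  generalize hc : c.locals p = s', ha : a.locals p = s, lag p = d at hp
  rw [Protocol.HasDecided, ha] at hw
  cases hp with
  | idle =>
    refine Protocol.HasDecided.step ?_ p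
    simp [Protocol.HasDecided, snapshotOfRegister, hc, hw]
  | pending hact => simp [hact] at hw
  | @overtaken s i x ts hact =>
    have hact' : (snapshotOfRegister P).action p (c.locals p) = .inl (.update i (ts, x)) := by
      simp [snapshotOfRegister, hc, hact]
    rw [Protocol.step_of_action_eq_update hact']
    simp [Protocol.HasDecided, snapshotOfRegister, hc, hact, hw]

lemma step (h : RegisterRel P c a lag) (p : Fin n) :
    ∃ l lag', RegisterRel P ((snapshotOfRegister P).step p c) (P.exec a l) lag' ∧
      ∀ q, lag q + (if p = q then 1 else 0) ≤ lag' q + 2 * l.count q := by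
  have hp := h.locals p
  generalize hc : c.locals p = s', ha : a.locals p = s, hd : lag p = d at hp
  cases hp with
  | idle =>
    rcases hact : P.action p s with (i | ⟨i, x⟩) | w <;> subst s
    · refine ⟨[p], _, h.step_read hc hact, fun q => ?_⟩
      rcases eq_or_ne q p with rfl | hq <;> simp [*, Ne.symm]
    · refine ⟨[], _, h.step_choose_stamp hc hact, fun q => ?_⟩
      rcases eq_or_ne q p with rfl | hq <;> simp [*, Ne.symm]
    · have hw : (snapshotOfRegister P).HasDecided c p w := by
        simp [Protocol.HasDecided, snapshotOfRegister, hc, hact]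
      refine ⟨[p], lag, ?_, fun q => ?_⟩
      · rwa [hw.step_self, Protocol.exec_cons, Protocol.exec_nil,
          Protocol.HasDecided.step_self (P := P) hact]
      · rcases eq_or_ne q p with rfl | hq <;> simp [*, Ne.symm]
  | pending hact hts =>
    subst s
    obtain ⟨l, hl, hpl, hlag, hrel⟩ := h.step_pending hc hact hts
    refine ⟨l ++ [p], _, hrel, fun q => ?_⟩
    rcases eq_or_ne q p with rfl | hq
    · simp only [hd, List.count_append, List.count_singleton_self, if_true]
      lia
    · by_cases hql : q ∈ l
      · simp [hq, hq.symm, hql, hlag q hql, List.count_eq_one_of_mem hl hql]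
      · simp [hq, hq.symm, hql]
  | overtaken hact hown hts =>
    refine ⟨[], _, h.step_overtaken hc ha hact hown hts, fun q => ?_⟩
    rcases eq_or_ne q p with rfl | hq <;> simp [*, Ne.symm]

end RegisterRel

variable (P) in
/-- The simulation of `P` by `snapshotOfRegister P`, in which an overtaken write is matched by a
step of `P` before it takes place. -/
noncomputable def registerSimulation : ForwardSimulation (snapshotOfRegister P) P where
  Rel := RegisterRel P
  rate := 2
  initial _ := ⟨1, fun _ => rfl, fun _ => .idle _⟩
  step := RegisterRel.step
  lag_le h q := (h.locals q).lag_le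
  hasDecided h _ _ := h.hasDecided
  hasDecided_step h _ _ := h.hasDecided_step

end RegisterFromSnapshot

theorem AnonymousRegisterSolvable.snapshotSolvable {n t m : ℕ} {V W : Type}
    {T : ColorlessTask V W} (htn : t < n) (h : AnonymousRegisterSolvable n t m T) :
    SnapshotSolvable n t T := by
  obtain ⟨X, x₀, C, hC⟩ := h
  have : NeZero n := ⟨by lia⟩
  exact ⟨Fin m, ℕ × X, (0, x₀), snapshotOfRegister C.toProtocol,
    (registerSimulation _).solvesResilient hC htn⟩

/-! ### Codes driven by views of a growing set -/

/-- What a process does on obtaining a view of the set of all published items. -/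
inductive SetAct (X W : Type) : Type
  | wait
  | advance (x : X)
  | decide (w : W)

/-- The code of an anonymous process that publishes its current item in a growing set and obtains
views of this set until it can replace its item by a new one, or decide. -/
structure SetCode (V W X : Type) where
  start : V → X
  act : X → Finset X → SetAct X W

/-- An execution of a `SetCode` in which only the processes outside `F` are known to be live. Views
are totally ordered, contain the item of the process that obtains them, and consist of items that
processes have had before. A process publishes its item at an unspecified time, and processes may
starve while new items keep appearing. -/
structure SetRun {n : ℕ} {V W X : Type} (C : SetCode V W X) (v : Fin n → V) (F : Set (Fin n)) where
  item : ℕ → Fin n → X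
  views : Set (Finset X)
  Decides : Fin n → W → Prop
  item_zero : ∀ p, item 0 p = C.start (v p)
  chain : ∀ S ∈ views, ∀ S' ∈ views, S ⊆ S' ∨ S' ⊆ S
  reached : ∀ S ∈ views, ∀ x ∈ S, ∃ k q, item k q = x
  item_succ : ∀ k p, item (k + 1) p = item k p ∨
    ∃ S ∈ views, item k p ∈ S ∧ (∀ x ∈ S, ∃ k' ≤ k, ∃ q, item k' q = x) ∧
      C.act (item k p) S = .advance (item (k + 1) p)
  decides : ∀ p w, Decides p w → ∃ k, ∃ S ∈ views, C.act (item k p) S = .decide w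
  live : ∀ K, (∀ k ≥ K, item k = item K) → (∃ p ∉ F, ∀ w, ¬ Decides p w) →
    ∃ S ∈ views, (∀ S' ∈ views, S' ⊆ S) ∧
      ∀ p ∉ F, (∀ w, ¬ Decides p w) → item K p ∈ S ∧ C.act (item K p) S = .wait

namespace SetCode

/-- All runs of `C` with at most `t` crashes solve `T`. -/
def Solves {V W X : Type} (C : SetCode V W X) (n t : ℕ) (T : ColorlessTask V W) : Prop :=
  ∀ (s : {s : Finset V // s ∈ T.input.faces}) (v : Fin n → V), (∀ p, v p ∈ s.1) →
    ∀ F : Set (Fin n), F.ncard ≤ t → ∀ R : SetRun C v F,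
      (∀ p ∉ F, ∃ w, R.Decides p w) ∧
      ∃ τ ∈ (T.carrier s).faces, ∀ p w, R.Decides p w → w ∈ τ

end SetCode

section Stabilization

lemma finite_setOf_exists_eq_of_eventually_const {ι X : Type*} [Finite ι] {f : ℕ → ι → X} {K : ℕ}
    (hK : ∀ k ≥ K, f k = f K) : {x | ∃ k q, f k q = x}.Finite := by
  refine (Set.finite_range fun a : Fin (K + 1) × ι => f a.1 a.2).subset ?_
  rintro x ⟨k, q, rfl⟩
  rcases le_total k K with hk | hk
  · exact ⟨(⟨k, by lia⟩, q), rfl⟩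
  · exact ⟨(⟨K, by lia⟩, q), (congrFun (hK k hk) q).symm⟩

lemma exists_forall_ge_eq_of_finite_range {α : Type*} [PartialOrder α] {f : ℕ → α}
    (hf : Monotone f) (h : (Set.range f).Finite) : ∃ K, ∀ k ≥ K, f k = f K := by
  obtain ⟨_, ⟨K, rfl⟩, hmax⟩ := h.exists_maximal (Set.range_nonempty f)
  exact ⟨K, fun k hk => (hmax ⟨k, rfl⟩ (hf hk)).antisymm (hf hk)⟩

end Stabilization

/-! ### Set codes on a weak set -/

section OnWeakSet

variable {n t : ℕ} {V W X : Type}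

/-- The local state of a process executing a set code on a weak set: the process holds an item,
which it is about to add, or has added and is looking for, unless it has decided. -/
inductive WeakSetLocal (X W : Type) : Type
  | adding (x : X)
  | getting (x : X)
  | done (x : X) (w : W)

/-- The current item of a process, the last one if it has decided. -/
def WeakSetLocal.item : WeakSetLocal X W → X
  | .adding x => x
  | .getting x => x
  | .done x _ => x

open Classical in
/-- The finset of elements of a set, empty if the set is infinite. -/
noncomputable def finsetOf (S : Set X) : Finset X :=
  if h : S.Finite then h.toFinset else ∅

lemma mem_finsetOf {S : Set X} (h : S.Finite) {x : X} : x ∈ finsetOf S ↔ x ∈ S := by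
  simp [finsetOf, h]

lemma finsetOf_subset_finsetOf {S S' : Set X} (h : S'.Finite) (hS : S ⊆ S') :
    finsetOf S ⊆ finsetOf S' := fun x hx => by
  rw [mem_finsetOf (h.subset hS)] at hx
  exact (mem_finsetOf h).2 (hS hx)

namespace SetCode

/-- The state of a process with item `x` after a view `S`. -/
def afterGet (C : SetCode V W X) (x : X) (S : Finset X) : WeakSetLocal X W :=
  match C.act x S with
  | .wait => .getting x
  | .advance y => .adding y
  | .decide w => .done x w

/-- Execution of a set code on a single weak set. -/
noncomputable def onWeakSet (C : SetCode V W X) (n : ℕ) :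
    AnonymousCode (weakSetMemory n Unit X) V W where
  Local := WeakSetLocal X W
  start := fun v => .adding (C.start v)
  action := fun s =>
    match s with
    | .adding x => .inl (.add () x)
    | .getting _ => .inl (.get ())
    | .done _ w => .inr w
  next := fun s r =>
    match s, r with
    | .adding x, _ => .getting x
    | .getting x, .values S => C.afterGet x (finsetOf S)
    | s, _ => s

variable (C : SetCode V W X) (v : Fin n → V) (σ : ℕ → Fin n)

/-- The local state of process `p` at time `k` in the execution of `C` on a weak set. -/
noncomputable def weakSetLocal (k : ℕ) (p : Fin n) : WeakSetLocal X W :=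
  ((C.onWeakSet n).toProtocol.run v σ k).locals p

/-- The contents of the weak set at time `k` in the execution of `C`. -/
noncomputable def weakSetAt (k : ℕ) : Set X :=
  ((C.onWeakSet n).toProtocol.run v σ k).mem ()

lemma weakSetAt_zero : C.weakSetAt v σ 0 = ∅ := rfl

variable {C v σ} {k : ℕ} {p : Fin n} {x : X} {w : W}

lemma onWeakSet_hasDecided_iff :
    (C.onWeakSet n).toProtocol.HasDecided ((C.onWeakSet n).toProtocol.run v σ k) p w ↔
      ∃ x, C.weakSetLocal v σ k p = .done x w := by
  change (C.onWeakSet n).action (C.weakSetLocal v σ k p) = _ ↔ _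
  rcases C.weakSetLocal v σ k p with x | x | ⟨x, w'⟩ <;> simp [onWeakSet]

lemma weakSetLocal_succ_of_ne (hp : p ≠ σ k) :
    C.weakSetLocal v σ (k + 1) p = C.weakSetLocal v σ k p :=
  (C.onWeakSet n).toProtocol.step_locals_of_ne hp _

lemma weakSet_succ_of_adding (h : C.weakSetLocal v σ k (σ k) = .adding x) :
    C.weakSetLocal v σ (k + 1) (σ k) = .getting x ∧
      C.weakSetAt v σ (k + 1) = insert x (C.weakSetAt v σ k) := by
  have hact : (C.onWeakSet n).action (C.weakSetLocal v σ k (σ k)) = .inl (.add () x) := by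
    rw [h]; rfl
  have hstep := Protocol.step_of_action_eq_add (P := (C.onWeakSet n).toProtocol) hact
  constructor
  · refine (congrArg (·.locals (σ k)) hstep).trans <| (Function.update_self ..).trans ?_
    change (C.onWeakSet n).next (C.weakSetLocal v σ k (σ k)) _ = _
    rw [h]; rfl
  · refine (congrArg (·.mem ()) hstep).trans ?_
    exact Function.update_self () _ ((C.onWeakSet n).toProtocol.run v σ k).mem

lemma weakSet_succ_of_getting (h : C.weakSetLocal v σ k (σ k) = .getting x) :
    C.weakSetLocal v σ (k + 1) (σ k) = C.afterGet x (finsetOf (C.weakSetAt v σ k)) ∧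
      C.weakSetAt v σ (k + 1) = C.weakSetAt v σ k := by
  have hact : (C.onWeakSet n).action (C.weakSetLocal v σ k (σ k)) = .inl (.get ()) := by
    rw [h]; rfl
  have hstep := Protocol.step_of_action_eq_get (P := (C.onWeakSet n).toProtocol) hact
  constructor
  · refine (congrArg (·.locals (σ k)) hstep).trans <| (Function.update_self ..).trans ?_
    change (C.onWeakSet n).next (C.weakSetLocal v σ k (σ k)) _ = _
    rw [h]; rfl
  · exact congrArg (·.mem ()) hstep

lemma weakSet_succ_of_done (h : C.weakSetLocal v σ k (σ k) = .done x w) :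
    C.weakSetLocal v σ (k + 1) (σ k) = .done x w ∧
      C.weakSetAt v σ (k + 1) = C.weakSetAt v σ k := by
  have hstep := (onWeakSet_hasDecided_iff.2 ⟨x, h⟩).step_self
  exact ⟨(congrArg (·.locals (σ k)) hstep).trans h, congrArg (·.mem ()) hstep⟩

lemma weakSetAt_succ_cases : C.weakSetAt v σ (k + 1) = C.weakSetAt v σ k ∨
    C.weakSetAt v σ (k + 1) = insert (C.weakSetLocal v σ k (σ k)).item (C.weakSetAt v σ k) := by
  rcases h : C.weakSetLocal v σ k (σ k) with x | x | ⟨x, w⟩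
  · exact .inr (weakSet_succ_of_adding h).2
  · exact .inl (weakSet_succ_of_getting h).2
  · exact .inl (weakSet_succ_of_done h).2

lemma weakSetAt_mono : Monotone (C.weakSetAt v σ) := by
  refine monotone_nat_of_le_succ fun k => ?_
  rcases weakSetAt_succ_cases (C := C) (v := v) (σ := σ) (k := k) with h | h <;> rw [h]
  exact Set.subset_insert _ _

lemma finite_weakSetAt : (C.weakSetAt v σ k).Finite := by
  induction k with
  | zero => simp [weakSetAt_zero]
  | succ k ih =>
    rcases weakSetAt_succ_cases (C := C) (v := v) (σ := σ) (k := k) with h | h <;> rw [h]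
    exacts [ih, ih.insert _]

lemma exists_item_eq_of_mem_weakSetAt (hx : x ∈ C.weakSetAt v σ k) :
    ∃ k' ≤ k, ∃ q, (C.weakSetLocal v σ k' q).item = x := by
  induction k with
  | zero => simp [weakSetAt_zero] at hx
  | succ k ih =>
    rcases weakSetAt_succ_cases (C := C) (v := v) (σ := σ) (k := k) with h | h <;> rw [h] at hx
    · exact (ih hx).imp fun _ => And.imp_left Nat.le_succ_of_le
    · rcases hx with rfl | hx
      · exact ⟨k, k.le_succ, σ k, rfl⟩
      · exact (ih hx).imp fun _ => And.imp_left Nat.le_succ_of_le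

lemma afterGet_eq_getting_iff {S : Finset X} {y : X} :
    C.afterGet x S = .getting y ↔ C.act x S = .wait ∧ x = y := by
  unfold afterGet
  split <;> simp_all

lemma afterGet_eq_done_iff {S : Finset X} {y : X} :
    C.afterGet x S = .done y w ↔ C.act x S = .decide w ∧ x = y := by
  unfold afterGet
  split <;> simp_all [and_comm]

lemma item_afterGet (S : Finset X) :
    (C.afterGet x S).item = x ∨ C.act x S = .advance (C.afterGet x S).item := by
  unfold afterGet
  split <;> simp_all [WeakSetLocal.item]

lemma mem_weakSetAt_of_getting (hx : C.weakSetLocal v σ k p = .getting x) :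
    x ∈ C.weakSetAt v σ k := by
  induction k generalizing x with
  | zero => cases hx
  | succ k ih =>
    rcases ne_or_eq p (σ k) with hp | rfl
    · rw [weakSetLocal_succ_of_ne hp] at hx
      exact weakSetAt_mono k.le_succ (ih hx)
    rcases h : C.weakSetLocal v σ k (σ k) with y | y | ⟨y, w⟩
    · obtain ⟨hloc, hmem⟩ := weakSet_succ_of_adding h
      rw [hloc] at hx
      cases hx
      simp [hmem]
    · obtain ⟨hloc, hmem⟩ := weakSet_succ_of_getting h
      rw [hloc, afterGet_eq_getting_iff] at hx
      rw [hmem]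
      exact ih (h.trans (congrArg _ hx.2))
    · simp [(weakSet_succ_of_done h).1] at hx

lemma exists_act_eq_decide_of_done (hx : C.weakSetLocal v σ k p = .done x w) :
    ∃ j, C.act (C.weakSetLocal v σ j p).item (finsetOf (C.weakSetAt v σ j)) = .decide w := by
  induction k with
  | zero => cases hx
  | succ k ih =>
    rcases ne_or_eq p (σ k) with hp | rfl
    · exact ih ((weakSetLocal_succ_of_ne hp).symm.trans hx)
    rcases h : C.weakSetLocal v σ k (σ k) with y | y | ⟨y, w'⟩
    · simp [(weakSet_succ_of_adding h).1] at hx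
    · rw [(weakSet_succ_of_getting h).1, afterGet_eq_done_iff] at hx
      exact ⟨k, by rw [h]; exact hx.1⟩
    · exact ih (h.trans ((weakSet_succ_of_done h).1.symm.trans hx))

lemma item_weakSetLocal_succ :
    (C.weakSetLocal v σ (k + 1) p).item = (C.weakSetLocal v σ k p).item ∨
      C.weakSetLocal v σ k p = .getting (C.weakSetLocal v σ k p).item ∧
      C.act (C.weakSetLocal v σ k p).item (finsetOf (C.weakSetAt v σ k)) =
        .advance (C.weakSetLocal v σ (k + 1) p).item := by
  rcases ne_or_eq p (σ k) with hp | rfl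
  · rw [weakSetLocal_succ_of_ne hp]
    exact .inl rfl
  rcases h : C.weakSetLocal v σ k (σ k) with y | y | ⟨y, w⟩
  · exact .inl (by rw [(weakSet_succ_of_adding h).1]; rfl)
  · rw [(weakSet_succ_of_getting h).1]
    exact (item_afterGet _).imp_right fun hact => ⟨rfl, hact⟩
  · exact .inl (by rw [(weakSet_succ_of_done h).1])

section Stalled

variable {K : ℕ} (hne : ∀ x S, C.act x S ≠ .advance x)
  (hitem : ∀ k ≥ K, (C.weakSetLocal v σ k p).item = x)
  (hundecided : ∀ k w, C.weakSetLocal v σ k p ≠ .done x w)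

include hitem hundecided

lemma exists_getting_of_item_const (hp : p ∉ faulty σ) :
    ∃ k ≥ K, C.weakSetLocal v σ k p = .getting x := by
  obtain ⟨k, hk, rfl⟩ := exists_step_ge_of_notMem_faulty hp K
  have hitem' := hitem k hk
  rcases h : C.weakSetLocal v σ k (σ k) with y | y | ⟨y, w⟩ <;> rw [h] at hitem' <;> cases hitem'
  · exact ⟨k + 1, Nat.le_succ_of_le hk, (weakSet_succ_of_adding h).1⟩
  · exact ⟨k, hk, h⟩
  · exact absurd h (hundecided _ _)

include hne

lemma act_eq_wait_of_item_const (hk : K ≤ k) (hkp : σ k = p)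
    (h : C.weakSetLocal v σ k p = .getting x) :
    C.act x (finsetOf (C.weakSetAt v σ k)) = .wait := by
  subst hkp
  have hsucc := (weakSet_succ_of_getting h).1
  have hitem' := hitem (k + 1) (Nat.le_succ_of_le hk)
  rw [hsucc] at hitem'
  rcases hact : C.act x (finsetOf (C.weakSetAt v σ k)) with _ | y | w
  · rfl
  · obtain rfl : y = x := by simpa only [afterGet, hact, WeakSetLocal.item] using hitem'
    exact absurd hact (hne _ _)
  · exact absurd (hsucc.trans (afterGet_eq_done_iff.2 ⟨hact, rfl⟩)) (hundecided _ _)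

lemma getting_of_item_const (hk : K ≤ k) (h : C.weakSetLocal v σ k p = .getting x) :
    ∀ j ≥ k, C.weakSetLocal v σ j p = .getting x := by
  intro j hj
  induction hj with
  | refl => exact h
  | @step j hj ih =>
    rcases ne_or_eq p (σ j) with hp | rfl
    · exact (weakSetLocal_succ_of_ne hp).trans ih
    · exact (weakSet_succ_of_getting ih).1.trans <| afterGet_eq_getting_iff.2
        ⟨act_eq_wait_of_item_const hne hitem hundecided (hk.trans hj) rfl ih, rfl⟩

end Stalled

/-- The execution of a set code on a weak set as an abstract run. -/
noncomputable def weakSetRun (C : SetCode V W X) (v : Fin n → V) (σ : ℕ → Fin n)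
    (hne : ∀ x S, C.act x S ≠ .advance x) : SetRun C v (faulty σ) where
  item k p := (C.weakSetLocal v σ k p).item
  views := Set.range fun k => finsetOf (C.weakSetAt v σ k)
  Decides p w := ∃ k x, C.weakSetLocal v σ k p = .done x w
  item_zero _ := rfl
  chain := by
    rintro _ ⟨j, rfl⟩ _ ⟨k, rfl⟩
    exact (le_total j k).imp (fun h => finsetOf_subset_finsetOf finite_weakSetAt (weakSetAt_mono h))
      fun h => finsetOf_subset_finsetOf finite_weakSetAt (weakSetAt_mono h)
  reached := by
    rintro _ ⟨k, rfl⟩ x hx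
    obtain ⟨k', -, hq⟩ := exists_item_eq_of_mem_weakSetAt ((mem_finsetOf finite_weakSetAt).1 hx)
    exact ⟨k', hq⟩
  item_succ k p := item_weakSetLocal_succ.imp_right fun ⟨hget, hact⟩ =>
    ⟨_, ⟨k, rfl⟩, (mem_finsetOf finite_weakSetAt).2 (mem_weakSetAt_of_getting hget),
      fun _ hx => exists_item_eq_of_mem_weakSetAt ((mem_finsetOf finite_weakSetAt).1 hx), hact⟩
  decides := by
    rintro p w ⟨k, x, hx⟩
    obtain ⟨j, hj⟩ := exists_act_eq_decide_of_done hx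
    exact ⟨j, _, ⟨j, rfl⟩, hj⟩
  live := by
    intro K hK _
    have finite_range : (Set.range (C.weakSetAt v σ)).Finite := by
      refine (finite_setOf_exists_eq_of_eventually_const hK).finite_subsets.subset ?_
      rintro _ ⟨k, rfl⟩ x hx
      exact (exists_item_eq_of_mem_weakSetAt hx).imp fun _ => And.right
    obtain ⟨K', hK'⟩ := exists_forall_ge_eq_of_finite_range weakSetAt_mono finite_range
    refine ⟨_, ⟨K', rfl⟩, ?_, fun p hp hd => ?_⟩
    · rintro _ ⟨k, rfl⟩
      refine finsetOf_subset_finsetOf finite_weakSetAt ?_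
      rw [← hK' _ (le_max_left K' k)]
      exact weakSetAt_mono (le_max_right _ _)
    · have hitem : ∀ k ≥ K, (C.weakSetLocal v σ k p).item = (C.weakSetLocal v σ K p).item :=
        fun k hk => congrFun (hK k hk) p
      have hundecided : ∀ k w, C.weakSetLocal v σ k p ≠ .done (C.weakSetLocal v σ K p).item w :=
        fun k w h => hd w ⟨k, _, h⟩
      obtain ⟨k, hk, hget⟩ := exists_getting_of_item_const hitem hundecided hp
      obtain ⟨j, hj, hjp⟩ := exists_step_ge_of_notMem_faulty hp (max k K')
      have hget' := getting_of_item_const hne hitem hundecided hk hget j (by lia)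
      simp only [← hK' j (by lia)]
      exact ⟨(mem_finsetOf finite_weakSetAt).2 (mem_weakSetAt_of_getting hget'),
        act_eq_wait_of_item_const hne hitem hundecided (by lia) hjp hget'⟩

theorem Solves.anonymousWeakSetSolvable {T : ColorlessTask V W} (hC : C.Solves n t T)
    (hne : ∀ x S, C.act x S ≠ .advance x) (htn : t < n) : AnonymousWeakSetSolvable n t T := by
  refine ⟨Unit, X, C.onWeakSet n, ?_⟩
  refine Protocol.solvesResilient_of_forall_decides_mem htn fun s v hv σ hσ => ?_
  obtain ⟨live, τ, hτ, hmem⟩ := hC s v hv _ hσ (C.weakSetRun v σ hne)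
  refine ⟨fun p hp => ?_, τ, hτ, fun p w ⟨k, hk⟩ => hmem p w ⟨k, onWeakSet_hasDecided_iff.1 hk⟩⟩
  obtain ⟨w, k, hk⟩ := live p hp
  exact ⟨w, k, onWeakSet_hasDecided_iff.2 hk⟩

end SetCode

end OnWeakSet

/-! ### Set codes on registers -/

section OnRegisters

variable {n t : ℕ} {V W X : Type}

/-- What a process executing a set code on registers does next: the `j`-th read of a round, a write
to register `i`, or nothing as it has decided. -/
inductive RegisterPhase (n : ℕ) (W : Type) : Type
  | reading (j : ℕ)
  | writing (i : Fin n)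
  | done (w : W)

/-- The local state of a process executing a set code on registers: its item, the items it knows,
the number of its writes, the values read in the current round and its phase. -/
structure RegisterLocal (n : ℕ) (X W : Type) where
  item : X
  known : Finset X
  ctr : ℕ
  buf : ℕ → Finset X × ℕ
  phase : RegisterPhase n W

/-- The number of reads in a round: the registers are read in `n * n + 1` successive passes, one
more than there are pairs of a process and a register. -/
def roundLength (n : ℕ) : ℕ := n * (n * n + 1)

lemma roundLength_pos [NeZero n] : 0 < roundLength n :=
  Nat.mul_pos n.pos_of_neZero (Nat.succ_pos _)

lemma le_roundLength : n ≤ roundLength n :=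
  Nat.le_mul_of_pos_right n (Nat.succ_pos _)

namespace RegisterLocal

/-- All passes of the round have found the same values, which carry exactly the known items. -/
def IsUniform (s : RegisterLocal n X W) : Prop :=
  ∀ j < roundLength n, s.buf j = s.buf (j % n) ∧ (s.buf j).1 = s.known

open Classical in
/-- The state after the `j`-th read of a round, which has returned `x`. -/
noncomputable def record (s : RegisterLocal n X W) (j : ℕ) (x : Finset X × ℕ) :
    RegisterLocal n X W :=
  { s with known := s.known ∪ x.1, buf := Function.update s.buf j x, phase := .reading (j + 1) }

/-- The state after a write. -/
def afterWrite (s : RegisterLocal n X W) : RegisterLocal n X W :=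
  { s with ctr := s.ctr + 1, phase := .reading 0 }

end RegisterLocal

namespace SetCode

variable [NeZero n]

open Classical in
/-- The state after a round of reads. In a uniform round the known items are a view; otherwise the
known items are to be written to some register that was found to hold another set. -/
noncomputable def endRound (C : SetCode V W X) (s : RegisterLocal n X W) : RegisterLocal n X W :=
  if s.IsUniform then
    match C.act s.item s.known with
    | .wait => { s with phase := .reading 0 }
    | .advance y => { s with item := y, known := insert y s.known, phase := .reading 0 }
    | .decide w => { s with phase := .done w }
  else if h : ∃ j < roundLength n, (s.buf j).1 ≠ s.known then
    { s with phase := .writing (Fin.ofNat n h.choose) }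
  else { s with phase := .reading 0 }

/-- The state after the `j`-th read of a round, with the end of the round if this was its last. -/
noncomputable def afterRead (C : SetCode V W X) (s : RegisterLocal n X W) (j : ℕ)
    (x : Finset X × ℕ) : RegisterLocal n X W :=
  if j + 1 < roundLength n then s.record j x else C.endRound (s.record j x)

variable (n) in
/-- Execution of a set code on `n` registers. Every register holds a set of items together with the
number of earlier writes of its writer, which makes the values written by a process distinct. -/
noncomputable def onRegisters (C : SetCode V W X) :
    AnonymousCode (registerMemory n n (Finset X × ℕ) (∅, 0)) V W where
  Local := RegisterLocal n X W
  start := fun v => ⟨C.start v, {C.start v}, 0, fun _ => (∅, 0), .reading 0⟩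
  action := fun s =>
    match s.phase with
    | .reading j => .inl (.read (Fin.ofNat n j))
    | .writing i => .inl (.write i (s.known, s.ctr))
    | .done w => .inr w
  next := fun s r =>
    match s.phase, r with
    | .reading j, .value x => C.afterRead s j x
    | .writing _, _ => s.afterWrite
    | _, _ => s

section EndRound

variable (C : SetCode V W X) (s : RegisterLocal n X W)

lemma subset_known_endRound : s.known ⊆ (C.endRound s).known := by
  unfold endRound
  split_ifs
  · split <;> simp
  all_goals exact subset_rfl

lemma ctr_endRound : (C.endRound s).ctr = s.ctr := by
  unfold endRound
  split_ifs
  · split <;> rfl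
  all_goals rfl

lemma buf_endRound : (C.endRound s).buf = s.buf := by
  unfold endRound
  split_ifs
  · split <;> rfl
  all_goals rfl

lemma mem_known_endRound {x : X} (hx : x ∈ (C.endRound s).known) :
    x ∈ s.known ∨ x = (C.endRound s).item := by
  classical
  unfold endRound at hx ⊢
  split_ifs at hx ⊢
  · split at hx
    · exact .inl hx
    · exact (Finset.mem_insert.1 hx).symm
    · exact .inl hx
  all_goals exact .inl hx

lemma item_endRound : (C.endRound s).item = s.item ∨
    s.IsUniform ∧ C.act s.item s.known = .advance (C.endRound s).item ∧
      (C.endRound s).item ∈ (C.endRound s).known := by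
  classical
  unfold endRound
  split_ifs with hs
  · split
    · exact .inl rfl
    · next hact => exact .inr ⟨hs, hact, Finset.mem_insert_self _ _⟩
    · exact .inl rfl
  all_goals exact .inl rfl

variable {C s}

lemma eq_zero_of_phase_endRound_eq_reading {j : ℕ} (h : (C.endRound s).phase = .reading j) :
    j = 0 := by
  unfold endRound at h
  split_ifs at h
  · split at h <;> cases h <;> rfl
  all_goals cases h; rfl

lemma exists_buf_ne_of_phase_endRound_eq_writing {i : Fin n}
    (h : (C.endRound s).phase = .writing i) :
    (C.endRound s).known = s.known ∧
      ∃ j < roundLength n, Fin.ofNat n j = i ∧ (s.buf j).1 ≠ s.known := by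
  unfold endRound at h ⊢
  split_ifs at h ⊢ with _ hne
  · split at h <;> cases h
  · cases h
    exact ⟨rfl, hne.choose, hne.choose_spec.1, rfl, hne.choose_spec.2⟩

lemma isUniform_of_phase_endRound_eq_done {w : W} (h : (C.endRound s).phase = .done w) :
    s.IsUniform ∧ C.act s.item s.known = .decide w := by
  unfold endRound at h
  split_ifs at h with hs
  split at h <;> cases h
  next hact => exact ⟨hs, hact⟩

end EndRound

section AfterRead

variable (C : SetCode V W X) (s : RegisterLocal n X W) (j : ℕ) (x : Finset X × ℕ)

lemma subset_known_afterRead : s.known ⊆ (C.afterRead s j x).known := by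
  classical
  refine Finset.subset_union_left.trans (?_ : (s.record j x).known ⊆ _)
  unfold afterRead
  split_ifs
  exacts [subset_rfl, subset_known_endRound C _]

lemma ctr_afterRead : (C.afterRead s j x).ctr = s.ctr := by
  unfold afterRead
  split_ifs
  exacts [rfl, ctr_endRound C _]

lemma mem_known_afterRead {y : X} (hy : y ∈ (C.afterRead s j x).known) :
    y ∈ s.known ∨ y ∈ x.1 ∨ y = (C.afterRead s j x).item := by
  have mem_record : ∀ {y}, y ∈ (s.record j x).known → y ∈ s.known ∨ y ∈ x.1 := by
    simp [RegisterLocal.record]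
  unfold afterRead at hy ⊢
  split_ifs at hy ⊢
  · exact (mem_record hy).imp_right .inl
  · rcases mem_known_endRound C _ hy with hy | hy
    · exact (mem_record hy).imp_right .inl
    · exact .inr (.inr hy)

lemma item_afterRead : (C.afterRead s j x).item = s.item ∨
    roundLength n ≤ j + 1 ∧ (s.record j x).IsUniform ∧
      C.act s.item (s.record j x).known = .advance (C.afterRead s j x).item ∧
      (C.afterRead s j x).item ∈ (C.afterRead s j x).known := by
  unfold afterRead
  split_ifs with hj
  · exact .inl rfl
  · exact (item_endRound C (s.record j x)).imp_right fun h => ⟨not_lt.1 hj, h⟩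

end AfterRead

section Execution

variable (C : SetCode V W X) (v : Fin n → V) (σ : ℕ → Fin n)

/-- The local state of process `p` at time `k` in the execution of `C` on registers. -/
noncomputable def registerLocal (k : ℕ) (p : Fin n) : RegisterLocal n X W :=
  ((C.onRegisters n).toProtocol.run v σ k).locals p

/-- The contents of the registers at time `k` in the execution of `C`. -/
noncomputable def registersAt (k : ℕ) : Fin n → Finset X × ℕ :=
  ((C.onRegisters n).toProtocol.run v σ k).mem

/-- The step at time `u` is a write to register `i`. -/
def WritesAt (u : ℕ) (i : Fin n) : Prop :=
  (C.registerLocal v σ u (σ u)).phase = .writing i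

/-- The value written by the step at time `u`, if it is a write. -/
noncomputable def written (u : ℕ) : Finset X × ℕ :=
  ((C.registerLocal v σ u (σ u)).known, (C.registerLocal v σ u (σ u)).ctr)

variable {C v σ} {k : ℕ} {p : Fin n}

lemma onRegisters_hasDecided_iff {w : W} :
    (C.onRegisters n).toProtocol.HasDecided ((C.onRegisters n).toProtocol.run v σ k) p w ↔
      (C.registerLocal v σ k p).phase = .done w := by
  change (C.onRegisters n).action (C.registerLocal v σ k p) = _ ↔ _
  rcases h : (C.registerLocal v σ k p).phase with j | i | w' <;> simp [onRegisters, h]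

lemma registerLocal_succ_of_ne (hp : p ≠ σ k) :
    C.registerLocal v σ (k + 1) p = C.registerLocal v σ k p :=
  (C.onRegisters n).toProtocol.step_locals_of_ne hp _

lemma succ_of_phase_eq_reading {j : ℕ}
    (h : (C.registerLocal v σ k (σ k)).phase = .reading j) :
    C.registerLocal v σ (k + 1) (σ k) = C.afterRead (C.registerLocal v σ k (σ k)) j
        (C.registersAt v σ k (Fin.ofNat n j)) ∧
      C.registersAt v σ (k + 1) = C.registersAt v σ k := by
  have hact : (C.onRegisters n).action (C.registerLocal v σ k (σ k)) =
      .inl (.read (Fin.ofNat n j)) := by simp only [onRegisters, h]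
  have hstep := Protocol.step_of_action_eq_read (P := (C.onRegisters n).toProtocol) hact
  refine ⟨(congrArg (·.locals (σ k)) hstep).trans <| (Function.update_self ..).trans ?_,
    congrArg (·.mem) hstep⟩
  change (C.onRegisters n).next (C.registerLocal v σ k (σ k)) _ = _
  simp only [onRegisters, h]
  rfl

lemma succ_of_writesAt {i : Fin n} (h : C.WritesAt v σ k i) :
    C.registerLocal v σ (k + 1) (σ k) = (C.registerLocal v σ k (σ k)).afterWrite ∧
      C.registersAt v σ (k + 1) =
        Function.update (C.registersAt v σ k) i (C.written v σ k) := by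
  unfold WritesAt at h
  have hact : (C.onRegisters n).action (C.registerLocal v σ k (σ k)) =
      .inl (.write i (C.written v σ k)) := by
    simp only [onRegisters, h, written]
  have hstep := Protocol.step_of_action_eq_write (P := (C.onRegisters n).toProtocol) hact
  refine ⟨(congrArg (·.locals (σ k)) hstep).trans <| (Function.update_self ..).trans ?_,
    congrArg (·.mem) hstep⟩
  change (C.onRegisters n).next (C.registerLocal v σ k (σ k)) _ = _
  simp only [onRegisters, h]

lemma succ_of_phase_eq_done {w : W} (h : (C.registerLocal v σ k (σ k)).phase = .done w) :
    C.registerLocal v σ (k + 1) (σ k) = C.registerLocal v σ k (σ k) ∧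
      C.registersAt v σ (k + 1) = C.registersAt v σ k := by
  have hstep := (onRegisters_hasDecided_iff.2 h).step_self
  exact ⟨congrArg (·.locals (σ k)) hstep, congrArg (·.mem) hstep⟩

lemma registerLocal_succ_cases (k : ℕ) (p : Fin n) :
    C.registerLocal v σ (k + 1) p = C.registerLocal v σ k p ∨
    C.registerLocal v σ (k + 1) p = (C.registerLocal v σ k p).afterWrite ∨
    ∃ j, (C.registerLocal v σ k p).phase = .reading j ∧ C.registerLocal v σ (k + 1) p =
      C.afterRead (C.registerLocal v σ k p) j (C.registersAt v σ k (Fin.ofNat n j)) := by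
  rcases ne_or_eq p (σ k) with hp | rfl
  · exact .inl (registerLocal_succ_of_ne hp)
  rcases h : (C.registerLocal v σ k (σ k)).phase with j | i | w
  · exact .inr (.inr ⟨j, rfl, (succ_of_phase_eq_reading h).1⟩)
  · exact .inr (.inl (succ_of_writesAt h).1)
  · exact .inl (succ_of_phase_eq_done h).1

lemma registersAt_succ_cases (k : ℕ) (i : Fin n) :
    C.WritesAt v σ k i ∧ C.registersAt v σ (k + 1) i = C.written v σ k ∨
      C.registersAt v σ (k + 1) i = C.registersAt v σ k i := by
  rcases h : (C.registerLocal v σ k (σ k)).phase with j | i' | w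
  · exact .inr (congrFun (succ_of_phase_eq_reading h).2 i)
  · rw [(succ_of_writesAt h).2]
    rcases eq_or_ne i i' with rfl | hi
    · exact .inl ⟨h, Function.update_self ..⟩
    · exact .inr (Function.update_of_ne hi ..)
  · exact .inr (congrFun (succ_of_phase_eq_done h).2 i)

lemma exists_writesAt_of_registersAt {Q : Finset X × ℕ → Prop} {u : ℕ} {i : Fin n} (huk : u ≤ k)
    (hu : ¬ Q (C.registersAt v σ u i)) (hk : Q (C.registersAt v σ k i)) :
    ∃ u', u ≤ u' ∧ u' < k ∧ C.WritesAt v σ u' i ∧ Q (C.written v σ u') := by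
  induction huk with
  | refl => exact absurd hk hu
  | @step k huk ih =>
    by_cases hQ : Q (C.registersAt v σ k i)
    · obtain ⟨u', huu', huk', hw⟩ := ih hQ
      exact ⟨u', huu', huk'.trans k.lt_succ_self, hw⟩
    · rcases registersAt_succ_cases k i with ⟨hw, heq⟩ | heq <;> rw [heq] at hk
      · exact ⟨k, huk, k.lt_succ_self, hw, hk⟩
      · exact absurd hk hQ

lemma monotone_known (p : Fin n) : Monotone fun k => (C.registerLocal v σ k p).known := by
  refine monotone_nat_of_le_succ fun k => ?_
  rcases registerLocal_succ_cases k p with heq | heq | ⟨j, -, heq⟩ <;> rw [heq]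
  exacts [subset_rfl, subset_known_afterRead C _ _ _]

lemma monotone_ctr (p : Fin n) : Monotone fun k => (C.registerLocal v σ k p).ctr := by
  refine monotone_nat_of_le_succ fun k => ?_
  rcases registerLocal_succ_cases k p with heq | heq | ⟨j, -, heq⟩ <;> rw [heq]
  exacts [Nat.le_succ _, (ctr_afterRead C _ _ _).ge]

lemma written_ne {u u' : ℕ} {i : Fin n} (hu : C.WritesAt v σ u i) (hlt : u < u')
    (hσ : σ u = σ u') : C.written v σ u ≠ C.written v σ u' := by
  intro heq
  have hctr := monotone_ctr (C := C) (v := v) (σ := σ) (σ u) (Nat.succ_le_of_lt hlt)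
  have heq' : (C.registerLocal v σ u (σ u)).ctr = (C.registerLocal v σ u' (σ u)).ctr := by
    simpa only [written, hσ] using congrArg Prod.snd heq
  simp only [Nat.succ_eq_add_one, (succ_of_writesAt hu).1, RegisterLocal.afterWrite] at hctr
  lia

lemma item_mem_known (k : ℕ) (p : Fin n) :
    (C.registerLocal v σ k p).item ∈ (C.registerLocal v σ k p).known := by
  induction k with
  | zero => exact Finset.mem_singleton_self _
  | succ k ih =>
    rcases registerLocal_succ_cases k p with heq | heq | ⟨j, -, heq⟩ <;> rw [heq]
    · exact ih
    · exact ih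
    · rcases item_afterRead C (C.registerLocal v σ k p) j (C.registersAt v σ k (Fin.ofNat n j))
        with hitem | ⟨-, -, -, hmem⟩
      · rw [hitem]
        exact subset_known_afterRead C _ _ _ ih
      · exact hmem

lemma exists_item_eq_of_mem_known_or_mem_registersAt (k : ℕ) :
    (∀ p, ∀ x ∈ (C.registerLocal v σ k p).known,
      ∃ k' ≤ k, ∃ q, (C.registerLocal v σ k' q).item = x) ∧
    ∀ i, ∀ x ∈ (C.registersAt v σ k i).1, ∃ k' ≤ k, ∃ q, (C.registerLocal v σ k' q).item = x := by
  induction k with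
  | zero =>
    refine ⟨fun p x hx => ⟨0, le_rfl, p, (Finset.mem_singleton.1 hx).symm⟩, fun i x hx => ?_⟩
    exact absurd hx (Finset.notMem_empty x)
  | succ k ih =>
    obtain ⟨known_of_ih, registers_of_ih⟩ :
        (∀ p, ∀ x ∈ (C.registerLocal v σ k p).known,
          ∃ k' ≤ k + 1, ∃ q, (C.registerLocal v σ k' q).item = x) ∧
        ∀ i, ∀ x ∈ (C.registersAt v σ k i).1,
          ∃ k' ≤ k + 1, ∃ q, (C.registerLocal v σ k' q).item = x :=
      ⟨fun p x hx => (ih.1 p x hx).imp fun _ => And.imp_left Nat.le_succ_of_le,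
        fun i x hx => (ih.2 i x hx).imp fun _ => And.imp_left Nat.le_succ_of_le⟩
    refine ⟨fun p x hx => ?_, fun i x hx => ?_⟩
    · rcases registerLocal_succ_cases k p with heq | heq | ⟨j, -, heq⟩ <;> rw [heq] at hx
      · exact known_of_ih p x hx
      · exact known_of_ih p x hx
      · rcases mem_known_afterRead C _ _ _ hx with hx | hx | rfl
        exacts [known_of_ih p x hx, registers_of_ih _ x hx, ⟨k + 1, le_rfl, p, by rw [heq]⟩]
    · rcases registersAt_succ_cases k i with ⟨-, heq⟩ | heq <;> rw [heq] at hx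
      exacts [known_of_ih _ x hx, registers_of_ih i x hx]

end Execution

end SetCode

end OnRegisters

/-! ### Rounds of reads -/

lemma mul_add_lt_roundLength {n c i : ℕ} (hc : c < n * n + 1) (hi : i < n) :
    c * n + i < roundLength n := by
  unfold roundLength
  nlinarith [Nat.mul_le_mul_right n hc]

section RoundRecord

variable {n : ℕ} [NeZero n] {X : Type} {reg : ℕ → Fin n → Finset X × ℕ} {u k m : ℕ}
  {b : ℕ → Finset X × ℕ} {A : Finset X}

/-- Successive reads, at times from `u` to `k`, of registers whose contents evolve as `reg` have
returned the values `b 0, …, b (m - 1)`, which carry items of `A` only. -/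
def RoundRecord (reg : ℕ → Fin n → Finset X × ℕ) (u k : ℕ) (b : ℕ → Finset X × ℕ) (A : Finset X)
    (m : ℕ) : Prop :=
  ∃ τ : ℕ → ℕ, StrictMonoOn τ (Set.Iio m) ∧
    ∀ j < m, u ≤ τ j ∧ τ j < k ∧ reg (τ j) (Fin.ofNat n j) = b j ∧ (b j).1 ⊆ A

namespace RoundRecord

lemma zero : RoundRecord reg u k b A 0 :=
  ⟨id, fun _ h => absurd h (Nat.not_lt_zero _), fun _ h => absurd h (Nat.not_lt_zero _)⟩

lemma succ_time (h : RoundRecord reg u k b A m) : RoundRecord reg u (k + 1) b A m := by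
  obtain ⟨τ, hτ, hread⟩ := h
  exact ⟨τ, hτ, fun j hj => (hread j hj).imp_right <| And.imp_left Nat.lt_succ_of_lt⟩

open Classical in
lemma succ_read (h : RoundRecord reg u k b A m) (huk : u ≤ k) :
    RoundRecord reg u (k + 1) (Function.update b m (reg k (Fin.ofNat n m)))
      (A ∪ (reg k (Fin.ofNat n m)).1) (m + 1) := by
  obtain ⟨τ, hτ, hread⟩ := h
  refine ⟨Function.update τ m k, fun i hi j hj hij => ?_, fun j hj => ?_⟩
  · rw [Function.update_of_ne (by simp at hj; lia)]
    rcases (Nat.lt_succ_iff.1 hj).lt_or_eq with hj | rfl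
    · rw [Function.update_of_ne hj.ne]
      exact hτ (hij.trans hj) hj hij
    · rw [Function.update_self]
      exact (hread i hij).2.1
  · rcases (Nat.lt_succ_iff.1 hj).lt_or_eq with hj | rfl
    · obtain ⟨hu, hk, hreg, hsub⟩ := hread j hj
      simp only [Function.update_of_ne hj.ne]
      exact ⟨hu, hk.trans k.lt_succ_self, hreg, hsub.trans Finset.subset_union_left⟩
    · rw [Function.update_self, Function.update_self]
      exact ⟨huk, k.lt_succ_self, rfl, Finset.subset_union_right⟩

lemma exists_read (h : RoundRecord reg u k b A m) (hm : n ≤ m) (i : Fin n) :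
    ∃ s, u ≤ s ∧ s < k ∧ (reg s i).1 ⊆ A := by
  obtain ⟨τ, -, hread⟩ := h
  obtain ⟨hu, hk, hreg, hsub⟩ := hread i (i.2.trans_le hm)
  rw [Fin.ofNat_val_eq_self] at hreg
  exact ⟨τ i, hu, hk, hreg ▸ hsub⟩

lemma exists_forall_pass (h : RoundRecord reg u k b A (roundLength n))
    (hb : ∀ j < roundLength n, b j = b (j % n)) :
    ∃ τ : ℕ → ℕ, StrictMonoOn τ (Set.Iio (roundLength n)) ∧
      ∀ c < n * n + 1, ∀ i : Fin n, τ (c * n + i) < k ∧ reg (τ (c * n + i)) i = b i := by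
  obtain ⟨τ, hτ, hread⟩ := h
  refine ⟨τ, hτ, fun c hc i => ?_⟩
  have hlt := mul_add_lt_roundLength hc i.2
  have hmod : (c * n + i) % n = i := Nat.mul_add_mod_of_lt i.2
  obtain ⟨-, hk, hreg, -⟩ := hread _ hlt
  rw [hb _ hlt, hmod, show Fin.ofNat n (c * n + i) = i from Fin.ext hmod] at hreg
  exact ⟨hk, hreg⟩

end RoundRecord

end RoundRecord

namespace SetCode

variable {n t : ℕ} [NeZero n] {V W X : Type} {C : SetCode V W X} {v : Fin n → V} {σ : ℕ → Fin n}
  {k : ℕ} {p : Fin n}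

lemma roundRecord_of_reading_zero {u : ℕ} (h : (C.registerLocal v σ u p).phase = .reading 0)
    (huk : u ≤ k) :
    (∀ j, (C.registerLocal v σ k p).phase = .reading j → j < roundLength n ∧
      RoundRecord (C.registersAt v σ) u k (C.registerLocal v σ k p).buf
        (C.registerLocal v σ k p).known j) ∧
    ∀ i, (C.registerLocal v σ k p).phase = .writing i →
      RoundRecord (C.registersAt v σ) u k (C.registerLocal v σ k p).buf
        (C.registerLocal v σ k p).known (roundLength n) ∧
      ∃ j < roundLength n, Fin.ofNat n j = i ∧
        ((C.registerLocal v σ k p).buf j).1 ≠ (C.registerLocal v σ k p).known := by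
  induction huk with
  | refl =>
    rw [h]
    refine ⟨fun j hj => ?_, nofun⟩
    cases hj
    exact ⟨roundLength_pos, .zero⟩
  | @step k huk ih =>
    rcases registerLocal_succ_cases k p with heq | heq | ⟨m, hm, heq⟩ <;> rw [heq]
    · exact ⟨fun j hj => (ih.1 j hj).imp_right .succ_time,
        fun i hi => (ih.2 i hi).imp_left .succ_time⟩
    · refine ⟨fun j hj => ?_, nofun⟩
      cases hj
      exact ⟨roundLength_pos, .zero⟩
    · obtain ⟨hm_lt, hrec⟩ := ih.1 m hm
      replace hrec := hrec.succ_read huk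
      unfold afterRead
      split_ifs with hm'
      · refine ⟨fun j hj => ?_, nofun⟩
        cases hj
        exact ⟨hm', hrec⟩
      · refine ⟨fun j hj => ?_, fun i hi => ?_⟩
        · obtain rfl := eq_zero_of_phase_endRound_eq_reading hj
          exact ⟨roundLength_pos, .zero⟩
        · obtain ⟨hknown, hne⟩ := exists_buf_ne_of_phase_endRound_eq_writing hi
          rw [show m + 1 = roundLength n by lia] at hrec
          rw [hknown, buf_endRound]
          exact ⟨hrec, hne⟩

lemma exists_read_between {u w : ℕ} {i j : Fin n} (hu : C.WritesAt v σ u i)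
    (hw : C.WritesAt v σ w j) (hσ : σ u = σ w) (huw : u < w) :
    (∀ i, ∃ s, u < s ∧ s < w ∧ (C.registersAt v σ s i).1 ⊆ (C.written v σ w).1) ∧
    ∃ s, u < s ∧ s < w ∧ (C.registersAt v σ s j).1 ⊂ (C.written v σ w).1 := by
  have hphase : (C.registerLocal v σ (u + 1) (σ w)).phase = .reading 0 := by
    rw [← hσ, (succ_of_writesAt hu).1]
    rfl
  obtain ⟨hrec, m, hm, rfl, hne⟩ := (roundRecord_of_reading_zero hphase huw).2 j hw
  refine ⟨hrec.exists_read le_roundLength, ?_⟩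
  obtain ⟨τ, -, hread⟩ := hrec
  obtain ⟨hus, hsw, hreg, hsub⟩ := hread m hm
  rw [← hreg] at hsub hne
  exact ⟨τ m, hus, hsw, hsub.ssubset_of_ne hne⟩

lemma exists_forall_registersAt_eq {b : ℕ → Finset X × ℕ} {A : Finset X}
    (h : RoundRecord (C.registersAt v σ) 0 k b A (roundLength n))
    (hb : ∀ j < roundLength n, b j = b (j % n)) :
    ∃ s < k, ∀ i : Fin n, C.registersAt v σ s i = b i := by
  by_contra! hne
  obtain ⟨τ, hτ, hread⟩ := h.exists_forall_pass hb
  -- Some register acquires its value during the pass `c`.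
  have write_in_pass (c : Fin (n * n + 1)) : ∃ u, ∃ i : Fin n, τ (c * n) ≤ u ∧
      u < τ (c * n + i) ∧ C.WritesAt v σ u i ∧ C.written v σ u = b i := by
    obtain ⟨i, hi⟩ := hne (τ (c * n)) (hread c c.2 0).1
    obtain ⟨u, hu⟩ := exists_writesAt_of_registersAt (Q := (· = b i))
      (hτ.monotoneOn (mul_add_lt_roundLength c.2 n.pos_of_neZero)
        (mul_add_lt_roundLength c.2 i.2) (Nat.le_add_right _ _)) hi (hread c c.2 i).2
    exact ⟨u, i, hu⟩
  choose u i hle hlt hwrites hwritten using write_in_pass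
  obtain ⟨c, c', hcc', heq⟩ := Fintype.exists_ne_map_eq_of_card_lt
    (fun c => (σ (u c), i c)) (by simp)
  wlog hlt_cc' : c < c' generalizing c c'
  · exact this c' c hcc'.symm heq.symm (lt_of_le_of_ne (not_lt.1 hlt_cc') hcc'.symm)
  have hpass : τ (c * n + i c) ≤ τ (c' * n) := by
    refine hτ.monotoneOn (mul_add_lt_roundLength c.2 (i c).2)
      (mul_add_lt_roundLength c'.2 n.pos_of_neZero) ?_
    have := Nat.mul_le_mul_right n (Nat.succ_le_of_lt hlt_cc')
    have := (i c).2
    lia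
  obtain ⟨hσ, hi⟩ := Prod.mk.inj heq
  refine written_ne (hwrites c) (((hlt c).trans_le hpass).trans_le (hle c')) hσ ?_
  rw [hwritten, hwritten, hi]

/-- A view is a set of items held by all registers at the same time. -/
def registerViews (C : SetCode V W X) (v : Fin n → V) (σ : ℕ → Fin n) : Set (Finset X) :=
  {S | ∃ k, ∀ i, (C.registersAt v σ k i).1 = S}

lemma known_record_mem_registerViews {j : ℕ}
    (hj : (C.registerLocal v σ k p).phase = .reading j) (hj' : roundLength n ≤ j + 1)
    (h : ((C.registerLocal v σ k p).record j
      (C.registersAt v σ k (Fin.ofNat n j))).IsUniform) :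
    ((C.registerLocal v σ k p).record j (C.registersAt v σ k (Fin.ofNat n j))).known ∈
      C.registerViews v σ := by
  obtain ⟨hlt, hrec⟩ := (roundRecord_of_reading_zero rfl k.zero_le).1 j hj
  replace hrec := hrec.succ_read k.zero_le
  rw [show j + 1 = roundLength n by lia] at hrec
  obtain ⟨s, -, hs⟩ := exists_forall_registersAt_eq hrec fun j hj => (h j hj).1
  refine ⟨s, fun i => ?_⟩
  rw [hs]
  exact (h i (i.2.trans_le le_roundLength)).2

/-! ### Views form a chain -/

/-- From time `k₀` on, a write to register `i` at time `u` that loses items of `A`. -/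
def Destroys (C : SetCode V W X) (v : Fin n → V) (σ : ℕ → Fin n) (k₀ : ℕ) (A : Finset X) (u : ℕ)
    (i : Fin n) : Prop :=
  k₀ ≤ u ∧ C.WritesAt v σ u i ∧ ¬ A ⊆ (C.written v σ u).1

section Chain

variable {A : Finset X} {k₀ : ℕ} (hA : ∀ i, (C.registersAt v σ k₀ i).1 = A)

include hA

lemma exists_destroys (hk : k₀ ≤ k) {i : Fin n} (hi : ¬ A ⊆ (C.registersAt v σ k i).1) :
    ∃ u < k, C.Destroys v σ k₀ A u i := by
  obtain ⟨u, hu, huk, hw, hne⟩ := exists_writesAt_of_registersAt (Q := fun x => ¬ A ⊆ x.1) hk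
    (by simp [hA]) hi
  exact ⟨u, huk, hu, hw, hne⟩

lemma exists_forall_not_destroys (hA' : A.Nonempty) :
    ∃ p, ∀ u i, C.Destroys v σ k₀ A u i → σ u ≠ p := by
  obtain ⟨u, -, hu, -, hw⟩ := exists_writesAt_of_registersAt (C := C) (v := v) (σ := σ)
    (Q := fun x => x.1 = A) k₀.zero_le (i := 0) hA'.ne_empty.symm (hA 0)
  refine ⟨σ u, fun u' i ⟨hu', _, hne⟩ hσ => hne ?_⟩
  rw [← hw, written, written, hσ]
  exact monotone_known _ (hu.le.trans hu')

lemma not_forall_exists_destroys (hA' : A.Nonempty) (hone : ∀ u < k, ∀ u' < k, ∀ i i',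
      C.Destroys v σ k₀ A u i → C.Destroys v σ k₀ A u' i' → σ u = σ u' → u = u') :
    ¬ ∀ i, ∃ u < k, C.Destroys v σ k₀ A u i := by
  intro hall
  obtain ⟨p, hp⟩ := exists_forall_not_destroys hA hA'
  choose f hf hdestroys using hall
  have hinj : Function.Injective fun i => σ (f i) := by
    intro i i' hσ
    have heq := hone _ (hf i) _ (hf i') _ _ (hdestroys i) (hdestroys i') hσ
    have hi := (hdestroys i).2.1
    rw [heq] at hi
    cases hi.symm.trans (hdestroys i').2.1
    rfl
  obtain ⟨i, hi⟩ := Finite.injective_iff_surjective.1 hinj p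
  exact hp _ _ (hdestroys i) hi

/-- Between two destroying writes, a process reads all registers and misses an item of `A` in each
of them, so the first process to do so would find all registers destroyed. -/
lemma eq_of_destroys (hA' : A.Nonempty) {u u' : ℕ} {i i' : Fin n}
    (hu : C.Destroys v σ k₀ A u i) (hu' : C.Destroys v σ k₀ A u' i') (hσ : σ u = σ u') :
    u = u' := by
  induction hk : max u u' using Nat.strong_induction_on generalizing u u' i i' with
  | _ k ih =>
    subst hk
    by_contra hne
    wlog hlt : u < u' generalizing u u' i i'
    · rw [max_comm] at ih
      exact this hu' hu hσ.symm ih (Ne.symm hne) (lt_of_le_of_ne (not_lt.1 hlt) (Ne.symm hne))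
    rw [max_eq_right hlt.le] at ih
    refine not_forall_exists_destroys (k := u') hA hA' (fun w hw w' hw' j j' hd hd' hσ' =>
      ih _ (max_lt hw hw') hd hd' hσ' rfl) fun j => ?_
    obtain ⟨s, hus, hsu', hsub⟩ := (exists_read_between hu.2.1 hu'.2.1 hσ hlt).1 j
    obtain ⟨w, hw, hd⟩ := exists_destroys hA (hu.1.trans hus.le) fun h => hu'.2.2 (h.trans hsub)
    exact ⟨w, hw.trans hsu', hd⟩

lemma subset_of_registersAt_eq {B : Finset X} (hk : k₀ ≤ k)
    (hB : ∀ i, (C.registersAt v σ k i).1 = B) : A ⊆ B := by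
  by_contra hAB
  have hA' : A.Nonempty := Finset.nonempty_iff_ne_empty.2 fun h => hAB (h ▸ B.empty_subset)
  exact not_forall_exists_destroys hA hA' (fun _ _ _ _ _ _ hd hd' => eq_of_destroys hA hA' hd hd')
    fun i => exists_destroys hA hk (by rwa [hB])

end Chain

end SetCode

namespace SetCode

variable {n : ℕ} [NeZero n] {V W X : Type} {C : SetCode V W X} {v : Fin n → V} {σ : ℕ → Fin n}
  {k : ℕ} {p : Fin n}

/-! ### Stalled executions on registers -/

open Filter in
lemma exists_frequently_writesAt_forall_card_le {A : Fin n → Finset X}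
    (hA : ∀ᶠ k in atTop, ∀ p, (C.registerLocal v σ k p).known = A p)
    (hwrites : ¬ ∀ᶠ u in atTop, ∀ i, ¬ C.WritesAt v σ u i) :
    ∃ p i, (∃ᶠ u in atTop, σ u = p ∧ C.WritesAt v σ u i) ∧
      ∀ᶠ u in atTop, ∀ j, C.WritesAt v σ u j → (A p).card ≤ (C.written v σ u).1.card := by
  let S : Set (Fin n × Fin n) := {a | ∃ᶠ u in atTop, σ u = a.1 ∧ C.WritesAt v σ u a.2}
  have hS : S.Nonempty := by
    by_contra! hS
    have hall : ∀ᶠ u in atTop, ∀ a : Fin n × Fin n, ¬ (σ u = a.1 ∧ C.WritesAt v σ u a.2) :=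
      eventually_all.2 fun a => not_frequently.1 fun ha => (hS ▸ ha : a ∈ (∅ : Set _))
    exact hwrites (hall.mono fun u hu i hi => hu (σ u, i) ⟨rfl, hi⟩)
  obtain ⟨⟨p, i⟩, hp, hmin⟩ := S.exists_min_image (fun a => (A a.1).card) S.toFinite hS
  have hmem : ∀ᶠ u in atTop, ∀ a : Fin n × Fin n, σ u = a.1 ∧ C.WritesAt v σ u a.2 → a ∈ S :=
    eventually_all.2 fun a => by
      by_cases ha : a ∈ S
      · exact .of_forall fun _ _ => ha
      · exact (not_frequently.1 ha).mono fun _ hu hu' => absurd hu' hu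
  refine ⟨p, i, hp, ?_⟩
  filter_upwards [hmem, hA] with u hu hAu j hj
  rw [written, hAu]
  exact hmin _ (hu (σ u, j) ⟨rfl, hj⟩)

open Filter in
lemma eventually_forall_not_writesAt {A : Fin n → Finset X}
    (hA : ∀ᶠ k in atTop, ∀ p, (C.registerLocal v σ k p).known = A p) :
    ∀ᶠ u in atTop, ∀ i, ¬ C.WritesAt v σ u i := by
  by_contra hwrites
  obtain ⟨p, i, hp, card_le⟩ := exists_frequently_writesAt_forall_card_le hA hwrites
  obtain ⟨K, hK⟩ := eventually_atTop.1 (card_le.and hA)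
  obtain ⟨u, hu, rfl, hwu⟩ := frequently_atTop.1 hp K
  obtain ⟨w, hw, hσ, hww⟩ := frequently_atTop.1 hp (u + 1)
  -- Between two writes to register `i`, process `σ u` finds fewer than `(A (σ u)).card` items in
  -- it, although no write stores so few.
  obtain ⟨s, hus, -, hs⟩ := (exists_read_between hwu hww hσ.symm hw).2
  have hlt : ¬ (A (σ u)).card ≤ (C.registersAt v σ s i).1.card := by
    rw [← hσ, ← (hK w (by lia)).2 (σ w), not_le]
    exact Finset.card_lt_card hs
  obtain ⟨u', hu', -, hw', hlt'⟩ := exists_writesAt_of_registersAt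
    (Q := fun x => ¬ (A (σ u)).card ≤ x.1.card) hus
    (by simpa only [(succ_of_writesAt hwu).2, Function.update_self, not_not] using
      (hK u hu).1 i hwu) hlt
  exact hlt' ((hK u' (by lia)).1 i hw')

lemma isUniform_of_phase_endRound_eq_reading {s : RegisterLocal n X W} {j : ℕ}
    (hne : ∀ x S, C.act x S ≠ .advance x) (hphase : (C.endRound s).phase = .reading j)
    (hitem : (C.endRound s).item = s.item) (hbuf : ∀ j < roundLength n, s.buf j = s.buf (j % n)) :
    s.IsUniform ∧ C.act s.item s.known = .wait := by
  unfold endRound at hphase hitem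
  split_ifs at hphase hitem with hs hexists
  · refine ⟨hs, ?_⟩
    rcases hact : C.act s.item s.known with _ | y | w <;> simp only [hact] at hphase hitem
    · rfl
    · exact absurd (hitem ▸ hact) (hne _ _)
    · cases hphase
  · push Not at hexists
    exact absurd (fun j hj => ⟨hbuf j hj, hexists j hj⟩) hs

lemma ite_lt_succ_update {α : Type*} (b f : ℕ → α) (i j : ℕ) :
    (if i < j + 1 then Function.update b j (f j) i else f i) = if i < j then b i else f i := by
  grind [Function.update_apply]

section Stalled

variable {K : ℕ} {x : X} {A : Finset X} {ρ : Fin n → Finset X × ℕ} (hp : p ∉ faulty σ)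
  (hundecided : ∀ k w, (C.registerLocal v σ k p).phase ≠ .done w)
  (hwrites : ∀ k ≥ K, ∀ i, ¬ C.WritesAt v σ k i) (hreg : ∀ k ≥ K, C.registersAt v σ k = ρ)
  (hitem : ∀ k ≥ K, (C.registerLocal v σ k p).item = x)
  (hknown : ∀ k ≥ K, (C.registerLocal v σ k p).known = A)

include hp hundecided hwrites hreg

lemma exists_registerLocal_eq_afterRead (hk : K ≤ k) :
    ∃ j < roundLength n, (C.registerLocal v σ k p).phase = .reading j ∧ ∃ k' ≥ k,
      C.registerLocal v σ k' p = C.afterRead (C.registerLocal v σ k p) j (ρ (Fin.ofNat n j)) := by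
  obtain ⟨k', hkk', rfl, heq⟩ :=
    Protocol.exists_step_ge_locals_eq (P := (C.onRegisters n).toProtocol) (v := v) hp k
  change C.registerLocal v σ k' (σ k') = C.registerLocal v σ k (σ k') at heq
  rcases hphase : (C.registerLocal v σ k (σ k')).phase with j | i | w
  · refine ⟨j, ((roundRecord_of_reading_zero rfl k.zero_le).1 j hphase).1, rfl, k' + 1,
      hkk'.trans k'.le_succ, ?_⟩
    rw [(succ_of_phase_eq_reading (heq ▸ hphase)).1, heq, hreg k' (hk.trans hkk')]
  · exact absurd ((congrArg RegisterLocal.phase heq).trans hphase) (hwrites k' (hk.trans hkk') i)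
  · exact absurd hphase (hundecided k w)

include hitem hknown

lemma exists_registerLocal_eq_endRound (hk : K ≤ k) {j : ℕ}
    (hj : (C.registerLocal v σ k p).phase = .reading j) :
    ∃ k' ≥ k, ∃ s, C.registerLocal v σ k' p = C.endRound s ∧ s.item = x ∧ s.known = A ∧
      ∀ i < roundLength n,
        s.buf i = if i < j then (C.registerLocal v σ k p).buf i else ρ (Fin.ofNat n i) := by
  classical
  induction hd : roundLength n - j generalizing k j with
  | zero =>
    have := ((roundRecord_of_reading_zero rfl k.zero_le).1 j hj).1
    lia
  | succ d ih =>
    obtain ⟨j', -, hj', k', hkk', heq⟩ :=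
      exists_registerLocal_eq_afterRead hp hundecided hwrites hreg hk
    obtain rfl : j = j' := by
      rw [hj'] at hj
      cases hj
      rfl
    unfold afterRead at heq
    split_ifs at heq with hlast
    · obtain ⟨k'', hk'', s, hs, hsx, hsA, hbuf⟩ :=
        ih (hk.trans hkk') (j := j + 1) (by rw [heq]; rfl) (by lia)
      refine ⟨k'', hkk'.trans hk'', s, hs, hsx, hsA, fun i hi => ?_⟩
      rw [hbuf i hi, heq]
      exact ite_lt_succ_update _ (fun i => ρ (Fin.ofNat n i)) i j
    · refine ⟨k', hkk', _, heq, hitem k hk, subset_antisymm ?_ ?_, fun i hi => ?_⟩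
      · rw [← hknown k' (hk.trans hkk'), heq]
        exact subset_known_endRound C _
      · rw [← hknown k hk]
        exact Finset.subset_union_left
      · rw [← ite_lt_succ_update _ (fun i => ρ (Fin.ofNat n i)), if_pos (by lia)]
        rfl

lemma act_eq_wait_of_stalled (hne : ∀ x S, C.act x S ≠ .advance x) :
    C.act x A = .wait ∧ ∀ i, (ρ i).1 = A := by
  have phase_eq {k : ℕ} (hk : K ≤ k) : ∃ j, (C.registerLocal v σ k p).phase = .reading j :=
    (exists_registerLocal_eq_afterRead hp hundecided hwrites hreg hk).imp fun _ h => h.2.1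
  obtain ⟨j, hj⟩ := phase_eq le_rfl
  obtain ⟨k₁, hk₁, s₁, hs₁, -⟩ := exists_registerLocal_eq_endRound hp hundecided hwrites hreg
    hitem hknown le_rfl hj
  obtain ⟨j₁, hj₁⟩ := phase_eq hk₁
  obtain rfl := eq_zero_of_phase_endRound_eq_reading (hs₁ ▸ hj₁)
  obtain ⟨k₂, hk₂, s, hs, rfl, rfl, hbuf⟩ := exists_registerLocal_eq_endRound hp hundecided
    hwrites hreg hitem hknown hk₁ hj₁
  simp only [Nat.not_lt_zero, if_false] at hbuf
  obtain ⟨j₂, hj₂⟩ := phase_eq (hk₁.trans hk₂)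
  obtain ⟨huniform, hact⟩ := isUniform_of_phase_endRound_eq_reading hne (hs ▸ hj₂)
    (hs ▸ hitem k₂ (hk₁.trans hk₂)) fun j hj => by
      rw [hbuf j hj, hbuf (j % n) ((Nat.mod_le _ _).trans_lt hj)]
      congr 1
      exact Fin.ext (Nat.mod_mod _ _).symm
  refine ⟨hact, fun i => ?_⟩
  have hi := i.2.trans_le le_roundLength
  rw [← (huniform i hi).2, hbuf i hi, Fin.ofNat_val_eq_self]

end Stalled

/-! ### Set codes on registers solve tasks -/

lemma exists_mem_registerViews_of_phase_eq_done {w : W}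
    (h : (C.registerLocal v σ k p).phase = .done w) :
    ∃ j, ∃ S ∈ C.registerViews v σ, C.act (C.registerLocal v σ j p).item S = .decide w := by
  induction k with
  | zero => cases h
  | succ k ih =>
    rcases registerLocal_succ_cases k p with heq | heq | ⟨j, hj, heq⟩ <;> rw [heq] at h
    · exact ih h
    · cases h
    · unfold afterRead at h
      split_ifs at h with hlast
      · cases h
      · obtain ⟨huniform, hact⟩ := isUniform_of_phase_endRound_eq_done h
        exact ⟨k, _, known_record_mem_registerViews hj (not_lt.1 hlast) huniform, hact⟩

lemma item_registerLocal_succ (k : ℕ) (p : Fin n) :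
    (C.registerLocal v σ (k + 1) p).item = (C.registerLocal v σ k p).item ∨
    ∃ S ∈ C.registerViews v σ, (C.registerLocal v σ k p).item ∈ S ∧
      (∀ x ∈ S, ∃ k' ≤ k, ∃ q, (C.registerLocal v σ k' q).item = x) ∧
      C.act (C.registerLocal v σ k p).item S =
        .advance (C.registerLocal v σ (k + 1) p).item := by
  rcases registerLocal_succ_cases k p with heq | heq | ⟨j, hj, heq⟩ <;> rw [heq]
  · exact .inl rfl
  · exact .inl rfl
  · classical
    refine (item_afterRead C _ j _).imp_right fun ⟨hlast, huniform, hact, _⟩ =>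
      ⟨_, known_record_mem_registerViews hj hlast huniform,
        Finset.mem_union_left _ (item_mem_known k p), fun x hx => ?_, hact⟩
    obtain ⟨known_items, register_items⟩ :=
      exists_item_eq_of_mem_known_or_mem_registersAt (C := C) (v := v) (σ := σ) k
    exact (Finset.mem_union.1 hx).elim (known_items p x) (register_items _ x)

open Filter in
lemma eventually_known_eq {K : ℕ}
    (hK : ∀ k ≥ K,
      (fun p => (C.registerLocal v σ k p).item) = fun p => (C.registerLocal v σ K p).item) :
    ∃ A : Fin n → Finset X, ∀ᶠ k in atTop, ∀ p, (C.registerLocal v σ k p).known = A p := by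
  have hfin := finite_setOf_exists_eq_of_eventually_const hK
  have hconst (p : Fin n) : ∃ K', ∀ k ≥ K',
      (C.registerLocal v σ k p).known = (C.registerLocal v σ K' p).known := by
    refine exists_forall_ge_eq_of_finite_range (monotone_known p) ?_
    refine (Finset.finite_toSet hfin.toFinset.powerset).subset ?_
    rintro _ ⟨k, rfl⟩
    refine Finset.mem_powerset.2 fun x hx => hfin.mem_toFinset.2 ?_
    exact ((exists_item_eq_of_mem_known_or_mem_registersAt k).1 p x hx).imp fun _ => And.right
  choose K' hK' using hconst
  exact ⟨_, eventually_all.2 fun p => eventually_atTop.2 ⟨K' p, hK' p⟩⟩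

lemma registersAt_eq_of_forall_not_writesAt {K : ℕ} (hw : ∀ u ≥ K, ∀ i, ¬ C.WritesAt v σ u i) :
    ∀ k ≥ K, C.registersAt v σ k = C.registersAt v σ K := by
  intro k hk
  induction hk with
  | refl => rfl
  | @step k hk ih =>
    rw [← ih]
    exact funext fun i => (registersAt_succ_cases k i).resolve_left fun h => hw k hk i h.1

open Filter in
/-- The execution of a set code on registers as an abstract run. -/
noncomputable def registerRun (C : SetCode V W X) (v : Fin n → V) (σ : ℕ → Fin n)
    (hne : ∀ x S, C.act x S ≠ .advance x) : SetRun C v (faulty σ) where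
  item k p := (C.registerLocal v σ k p).item
  views := C.registerViews v σ
  Decides p w := ∃ k, (C.registerLocal v σ k p).phase = .done w
  item_zero _ := rfl
  chain := by
    rintro S ⟨k, hS⟩ S' ⟨k', hS'⟩
    exact (le_total k k').imp (fun hle => subset_of_registersAt_eq hS hle hS')
      fun hle => subset_of_registersAt_eq hS' hle hS
  reached := by
    rintro S ⟨k, hS⟩ x hx
    obtain ⟨k', -, hq⟩ :=
      (exists_item_eq_of_mem_known_or_mem_registersAt k).2 0 x ((hS 0).symm ▸ hx)
    exact ⟨k', hq⟩
  item_succ := item_registerLocal_succ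
  decides p w h := h.elim fun _ => exists_mem_registerViews_of_phase_eq_done
  live := by
    rintro K hK ⟨p₀, hp₀, hd₀⟩
    obtain ⟨A, hA⟩ := eventually_known_eq hK
    obtain ⟨K', hK'⟩ := eventually_atTop.1
      ((hA.and (eventually_forall_not_writesAt hA)).and (eventually_ge_atTop K))
    have hreg := registersAt_eq_of_forall_not_writesAt fun k hk => (hK' k hk).1.2
    have stalled {p : Fin n} (hp : p ∉ faulty σ)
        (hd : ∀ w, ¬ ∃ k, (C.registerLocal v σ k p).phase = .done w) :
        C.act (C.registerLocal v σ K p).item (A p) = .wait ∧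
          ∀ i, (C.registersAt v σ K' i).1 = A p :=
      act_eq_wait_of_stalled hp (fun k w h => hd w ⟨k, h⟩) (fun k hk => (hK' k hk).1.2) hreg
        (fun k hk => congrFun (hK k (hK' k hk).2) p) (fun k hk => (hK' k hk).1.1 p) hne
    have hviews := (stalled hp₀ hd₀).2
    refine ⟨A p₀, ⟨K', hviews⟩, ?_, fun p hp hd => ?_⟩
    · rintro S ⟨k, hS⟩
      refine subset_of_registersAt_eq hS (le_max_left k K') fun i => ?_
      rw [hreg _ (le_max_right _ _), hviews]
    · obtain ⟨hact, hp_views⟩ := stalled hp hd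
      rw [show A p₀ = A p from (hviews 0).symm.trans (hp_views 0)]
      refine ⟨?_, hact⟩
      rw [← congrFun (hK K' (hK' K' le_rfl).2) p, ← (hK' K' le_rfl).1.1 p]
      exact item_mem_known K' p

end SetCode

theorem SetCode.Solves.anonymousRegisterSolvable {n t : ℕ} {V W X : Type} {C : SetCode V W X}
    {T : ColorlessTask V W} (hC : C.Solves n t T) (hne : ∀ x S, C.act x S ≠ .advance x)
    (htn : t < n) : AnonymousRegisterSolvable n t n T := by
  have : NeZero n := ⟨by lia⟩
  refine ⟨Finset X × ℕ, (∅, 0), C.onRegisters n, ?_⟩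
  refine Protocol.solvesResilient_of_forall_decides_mem htn fun s v hv σ hσ => ?_
  obtain ⟨live, τ, hτ, hmem⟩ := hC s v hv _ hσ (C.registerRun v σ hne)
  refine ⟨fun p hp => ?_, τ, hτ, fun p w ⟨k, hk⟩ => hmem p w ⟨k, onRegisters_hasDecided_iff.1 hk⟩⟩
  obtain ⟨w, k, hk⟩ := live p hp
  exact ⟨w, k, onRegisters_hasDecided_iff.2 hk⟩

/-! ### Executions replayed from sequences of local states -/

open Classical in
/-- The list of the indices that satisfy `r`, in increasing order. -/
noncomputable def indicesWith {n : ℕ} (r : Fin n → Prop) : List (Fin n) :=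
  (List.finRange n).filter fun p => r p

section IndicesWith

variable {n : ℕ} {r : Fin n → Prop} {p : Fin n}

lemma mem_indicesWith : p ∈ indicesWith r ↔ r p := by
  simp [indicesWith]

lemma nodup_indicesWith (r : Fin n → Prop) : (indicesWith r).Nodup :=
  (List.nodup_finRange n).filter _

open Classical in
lemma count_indicesWith (r : Fin n → Prop) (p : Fin n) :
    (indicesWith r).count p = if r p then 1 else 0 := by
  split_ifs with h
  · exact List.count_eq_one_of_mem (nodup_indicesWith r) (mem_indicesWith.2 h)
  · exact List.count_eq_zero_of_not_mem (mt mem_indicesWith.1 h)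

end IndicesWith

namespace Protocol

section AfterOp

variable {n : ℕ} {M : Memory n} {V W : Type} (P : Protocol M V W)

/-- The local state that process `p` enters when it executes `op` in the local state `s` and the
memory is `m`. -/
def afterOp (p : Fin n) (s : P.Local) (op : M.Op) (m : M.State) : P.Local :=
  P.next p s (M.apply p op m).2

end AfterOp

variable {n : ℕ} {V W K Y : Type} {y₀ : Y} {P : Protocol (snapshotMemory n K Y y₀) V W}
  {loc loc' : Fin n → P.Local} {mem mem' : K → Fin n → Y} {l : List (Fin n)}

lemma exec_scans (hl : l.Nodup)
    (hmem : ∀ p ∈ l, ∃ k, P.action p (loc p) = .inl (.scan k) ∧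
      loc' p = P.afterOp p (loc p) (.scan k) mem)
    (hnotMem : ∀ p ∉ l, loc' p = loc p) :
    P.exec ⟨loc, mem⟩ l = ⟨loc', mem⟩ := by
  induction l generalizing loc with
  | nil =>
    obtain rfl : loc' = loc := funext fun p => hnotMem p List.not_mem_nil
    rfl
  | cons a l ih =>
    obtain ⟨ha, hl⟩ := List.nodup_cons.1 hl
    obtain ⟨k, hk, hloc⟩ := hmem a List.mem_cons_self
    have hstep : P.step a ⟨loc, mem⟩ =
        ⟨Function.update loc a (P.afterOp a (loc a) (.scan k) mem), mem⟩ :=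
      step_of_action_eq_scan hk
    rw [exec_cons, hstep]
    refine ih hl (fun p hp => ?_) fun p hp => ?_
    · rw [Function.update_of_ne (ne_of_mem_of_not_mem hp ha)]
      exact hmem p (List.mem_cons_of_mem _ hp)
    · rcases eq_or_ne p a with rfl | hpa
      · rw [Function.update_self, hloc]
      · rw [Function.update_of_ne hpa]
        exact hnotMem p (by simp [hpa, hp])

open Classical in
lemma exec_updates (hl : l.Nodup)
    (hmem : ∀ p ∈ l, ∃ k y, P.action p (loc p) = .inl (.update k y) ∧
      loc' p = P.afterOp p (loc p) (.update k y) mem ∧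
      ∀ j, mem' j p = if k = j then y else mem j p)
    (hnotMem : ∀ p ∉ l, loc' p = loc p ∧ ∀ j, mem' j p = mem j p) :
    P.exec ⟨loc, mem⟩ l = ⟨loc', mem'⟩ := by
  induction l generalizing loc mem with
  | nil =>
    obtain rfl : loc' = loc := funext fun p => (hnotMem p List.not_mem_nil).1
    obtain rfl : mem' = mem := funext₂ fun j p => (hnotMem p List.not_mem_nil).2 j
    rfl
  | cons a l ih =>
    obtain ⟨ha, hl⟩ := List.nodup_cons.1 hl
    obtain ⟨k, y, hk, hloc, hcol⟩ := hmem a List.mem_cons_self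
    have hstep : P.step a ⟨loc, mem⟩ =
        ⟨Function.update loc a (P.afterOp a (loc a) (.update k y) mem),
          Function.update mem k (Function.update (mem k) a y)⟩ :=
      step_of_action_eq_update hk
    have hupdate (j : K) (p : Fin n) : Function.update mem k (Function.update (mem k) a y) j p =
        if p = a then if k = j then y else mem j p else mem j p := by
      rcases eq_or_ne k j with rfl | hj <;> rcases eq_or_ne p a with rfl | hp <;>
        simp [*, Ne.symm]
    rw [exec_cons, hstep]
    refine ih hl (fun p hp => ?_) fun p hp => ?_
    · have hpa : p ≠ a := ne_of_mem_of_not_mem hp ha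
      simp only [Function.update_of_ne hpa, hupdate, if_neg hpa]
      exact hmem p (List.mem_cons_of_mem _ hp)
    · simp only [hupdate]
      rcases eq_or_ne p a with rfl | hpa
      · simpa only [Function.update_self, if_true] using ⟨hloc, hcol⟩
      · simp only [Function.update_of_ne hpa, if_neg hpa]
        exact hnotMem p (by simp [hpa, hp])

variable (P)

open Classical in
/-- The value of component `q` of object `k` after `q` has executed the operations pending in its
local states `g 0, …, g (i - 1)`. -/
noncomputable def written (q : Fin n) (g : ℕ → P.Local) (k : K) : ℕ → Y
  | 0 => y₀
  | i + 1 =>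
    match P.action q (g i) with
    | .inl (.update k' y) => if k' = k then y else written q g k i
    | _ => written q g k i

lemma written_congr {q : Fin n} {g g' : ℕ → P.Local} {k : K} {m : ℕ} (h : ∀ i < m, g i = g' i) :
    P.written q g k m = P.written q g' k m := by
  induction m with
  | zero => rfl
  | succ m ih => simp only [written, h m (by lia), ih fun i hi => h i (by lia)]

/-- The memory when, for every `q`, exactly the local states `f q 0, …, f q (c q - 1)` of `q` are
known: the operation pending in the last of them has not been executed. -/
noncomputable def knownMemory (f : Fin n → ℕ → P.Local) (c : Fin n → ℕ) : K → Fin n → Y :=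
  fun k q => P.written q (f q) k (c q - 1)

/-- A sequence of local states for every process that is consistent with some execution. At time
`k` exactly the first `cnt k p` local states `f p 0, f p 1, …` of `p` are known. The operation that
`p` executes in state `f p i` takes effect at the time `time p i`, when `f p i` is the last known
state of `p`. -/
structure Replay (v : Fin n → V) (f : Fin n → ℕ → P.Local) (cnt : ℕ → Fin n → ℕ)
    (time : Fin n → ℕ → ℕ) : Prop where
  start : ∀ p, f p 0 = P.start p (v p)
  zero : ∀ p, cnt 0 p = 0
  mono : ∀ k p, cnt k p ≤ cnt (k + 1) p
  succ_le : ∀ k p, cnt (k + 1) p ≤ cnt k p + 1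
  next : ∀ p i k, i + 2 ≤ cnt k p → ∃ op, P.action p (f p i) = .inl op ∧
    cnt (time p i) p = i + 1 ∧
    f p (i + 1) = P.afterOp p (f p i) op (P.knownMemory f (cnt (time p i)))

namespace Replay

variable {P} {v : Fin n → V} {f : Fin n → ℕ → P.Local} {cnt : ℕ → Fin n → ℕ}
  {time : Fin n → ℕ → ℕ}

lemma cnt_le (R : P.Replay v f cnt time) {j k : ℕ} (h : j ≤ k) (p : Fin n) :
    cnt j p ≤ cnt k p :=
  monotone_nat_of_le_succ (fun k => R.mono k p) h

/-- The last known state of `p` at time `k` is one in which `p` performs a scan that takes effect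
before time `m`. -/
def Scanned (_ : P.Replay v f cnt time) (k m : ℕ) (p : Fin n) : Prop :=
  ∃ i o, cnt k p = i + 1 ∧ (∃ k', i + 2 ≤ cnt k' p) ∧
    P.action p (f p i) = .inl (.scan o) ∧ time p i < m

/-- At time `k + 1` it becomes known that `p` has left a state in which it performs an update. -/
def Updated (_ : P.Replay v f cnt time) (k : ℕ) (p : Fin n) : Prop :=
  ∃ i o y, cnt k p = i + 1 ∧ cnt (k + 1) p = i + 2 ∧ P.action p (f p i) = .inl (.update o y)

variable (R : P.Replay v f cnt time)

open Classical in
/-- The number of steps that `p` has taken at time `k`. Scans are executed when they take effect,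
updates only when their completion becomes known. -/
noncomputable def steps (k : ℕ) (p : Fin n) : ℕ :=
  if R.Scanned k k p then cnt k p else cnt k p - 1

lemma steps_eq_or_exists_scan (k : ℕ) (p : Fin n) :
    R.steps k p = cnt k p - 1 ∨
      ∃ i o, cnt k p = i + 1 ∧ P.action p (f p i) = .inl (.scan o) := by
  rw [steps]
  split_ifs with h
  · obtain ⟨i, o, hi, -, ho, -⟩ := h
    exact .inr ⟨i, o, hi, ho⟩
  · exact .inl rfl

variable {R}

lemma Scanned.cnt_pos {k m : ℕ} {p : Fin n} (h : R.Scanned k m p) : 1 ≤ cnt k p := by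
  obtain ⟨i, o, hi, -⟩ := h
  lia

lemma Scanned.mono {k m m' : ℕ} {p : Fin n} (h : R.Scanned k m p) (hm : m ≤ m') :
    R.Scanned k m' p := by
  obtain ⟨i, o, hi, hleft, ho, ht⟩ := h
  exact ⟨i, o, hi, hleft, ho, by lia⟩

lemma Updated.not_scanned {k m : ℕ} {p : Fin n} (h : R.Updated k p) : ¬ R.Scanned k m p := by
  obtain ⟨i, o, y, hi, -, ho⟩ := h
  rintro ⟨i', o', hi', -, ho', -⟩
  obtain rfl : i = i' := by lia
  cases ho.symm.trans ho'

variable (R)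

lemma not_scanned_of_cnt_lt {k : ℕ} {p : Fin n} (h : cnt k p < cnt (k + 1) p) :
    ¬ R.Scanned (k + 1) (k + 1) p := by
  rintro ⟨i, o, hi, ⟨k', hk'⟩, -, ht⟩
  obtain ⟨-, -, hcnt, -⟩ := R.next p i k' hk'
  have := R.cnt_le (Nat.lt_succ_iff.1 ht) p
  lia

lemma scanned_or_updated_of_cnt_lt {k : ℕ} {p : Fin n} (h : cnt k p < cnt (k + 1) p)
    (hpos : 1 ≤ cnt k p) : R.Scanned k (k + 1) p ∨ R.Updated k p := by
  have hsucc := R.succ_le k p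
  obtain ⟨i, hi⟩ : ∃ i, cnt k p = i + 1 := ⟨cnt k p - 1, by lia⟩
  obtain ⟨op, hop, hcnt, -⟩ := R.next p i (k + 1) (by lia)
  cases op with
  | update o y => exact .inr ⟨i, o, y, hi, by lia, hop⟩
  | scan o =>
    refine .inl ⟨i, o, hi, ⟨k + 1, by lia⟩, hop, ?_⟩
    by_contra! hlt
    have := R.cnt_le hlt p
    lia

open Classical in
lemma steps_succ (k : ℕ) (p : Fin n) :
    R.steps (k + 1) p = if R.Scanned k (k + 1) p ∨ R.Updated k p then cnt k p else cnt k p - 1 := by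
  rcases (R.mono k p).lt_or_eq with h | h
  · have hsucc : cnt (k + 1) p = cnt k p + 1 := (R.succ_le k p).antisymm h
    rw [steps, if_neg (R.not_scanned_of_cnt_lt h), hsucc, Nat.add_sub_cancel]
    split_ifs with hk
    · rfl
    · by_contra hpos
      exact hk (R.scanned_or_updated_of_cnt_lt h (by lia))
  · have hu : ¬ R.Updated k p := by
      rintro ⟨i, o, y, hi, hi', -⟩
      lia
    have hs : R.Scanned (k + 1) (k + 1) p ↔ R.Scanned k (k + 1) p := by
      simp only [Scanned, h]
    simp only [steps, hs, hu, or_false, h]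

/-- The configuration at time `k`. -/
noncomputable def config (k : ℕ) : P.Config :=
  ⟨fun p => f p (R.steps k p), P.knownMemory f (cnt k)⟩

/-- The steps between times `k` and `k + 1`: first the scans that take effect at time `k`, which
must see the memory at time `k`, then the updates that become known at time `k + 1`. -/
noncomputable def segment (k : ℕ) : List (Fin n) :=
  indicesWith (fun p => R.Scanned k (k + 1) p ∧ ¬ R.Scanned k k p) ++ indicesWith (R.Updated k)

lemma count_segment (k : ℕ) (p : Fin n) :
    R.steps k p + (R.segment k).count p = R.steps (k + 1) p := by
  classical
  rw [segment, List.count_append, count_indicesWith, count_indicesWith, steps_succ, steps]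
  by_cases hu : R.Updated k p
  · have hpos : 1 ≤ cnt k p := by
      obtain ⟨i, o, y, hi, -⟩ := hu
      lia
    simp only [hu.not_scanned, hu, if_false, if_true, false_and, or_true]
    lia
  · by_cases hs : R.Scanned k k p
    · simp [hs, hu, hs.mono (Nat.le_succ k)]
    · by_cases hs' : R.Scanned k (k + 1) p
      · have := hs'.cnt_pos
        simp only [hs, hs', hu, if_true, if_false, not_false_eq_true, and_self, or_false]
        lia
      · simp [hs, hs', hu]

lemma knownMemory_succ_of_not_updated {k : ℕ} {p : Fin n} (h : ¬ R.Updated k p) (j : K) :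
    P.knownMemory f (cnt (k + 1)) j p = P.knownMemory f (cnt k) j p := by
  simp only [knownMemory]
  have hsucc := R.succ_le k p
  rcases (R.mono k p).lt_or_eq with hlt | heq
  · rcases hk : cnt k p with _ | i
    · rw [show cnt (k + 1) p - 1 = 0 - 1 by lia]
    · rw [show cnt (k + 1) p - 1 = i + 1 by lia, Nat.add_sub_cancel, written]
      obtain ⟨op, hop, -⟩ := R.next p i (k + 1) (by lia)
      cases op with
      | update o y => exact absurd ⟨i, o, y, hk, by lia, hop⟩ h
      | scan o => rw [hop]
  · rw [heq]

open Classical in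
/-- The configuration between the scans and the updates of `segment k`. -/
noncomputable def scannedConfig (k : ℕ) : P.Config :=
  ⟨fun p => f p (if R.Scanned k (k + 1) p then cnt k p else cnt k p - 1), P.knownMemory f (cnt k)⟩

lemma exec_scans_config (k : ℕ) :
    P.exec (R.config k) (indicesWith fun p => R.Scanned k (k + 1) p ∧ ¬ R.Scanned k k p) =
      R.scannedConfig k := by
  classical
  refine exec_scans (nodup_indicesWith _) (fun p hp => ?_) fun p hp => ?_
  · obtain ⟨hs, hn⟩ := mem_indicesWith.1 hp
    simp only [steps, if_pos hs, if_neg hn]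
    obtain ⟨i, o, hi, ⟨k', hk'⟩, ho, ht⟩ := hs
    have htk : time p i = k := by
      by_contra hne
      exact hn ⟨i, o, hi, ⟨k', hk'⟩, ho, by lia⟩
    obtain ⟨op, hop, -, hf⟩ := R.next p i k' hk'
    cases ho.symm.trans hop
    rw [hi, Nat.add_sub_cancel]
    exact ⟨o, ho, by rw [hf, htk]⟩
  · have hs : R.Scanned k (k + 1) p ↔ R.Scanned k k p :=
      ⟨by simpa [mem_indicesWith] using hp, fun h => h.mono (Nat.le_succ k)⟩
    simp only [steps, hs]

lemma exec_updates_scannedConfig (k : ℕ) :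
    P.exec (R.scannedConfig k) (indicesWith (R.Updated k)) = R.config (k + 1) := by
  classical
  refine exec_updates (nodup_indicesWith _) (fun p hp => ?_) fun p hp => ?_
  · have hu : R.Updated k p := mem_indicesWith.1 hp
    simp only [if_neg hu.not_scanned, steps_succ, if_pos (Or.inr hu)]
    obtain ⟨i, o, y, hi, hi', ho⟩ := hu
    obtain ⟨op, hop, -, hf⟩ := R.next p i (k + 1) (by lia)
    cases ho.symm.trans hop
    rw [hi, Nat.add_sub_cancel]
    refine ⟨o, y, ho, hf, fun j => ?_⟩
    simp [knownMemory, hi, hi', written, ho]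
  · have hu : ¬ R.Updated k p := mt mem_indicesWith.2 hp
    refine ⟨?_, R.knownMemory_succ_of_not_updated hu⟩
    simp only [steps_succ, hu, or_false]

lemma exec_segment (k : ℕ) : P.exec (R.config k) (R.segment k) = R.config (k + 1) := by
  rw [segment, exec_append, exec_scans_config, exec_updates_scannedConfig]

/-- The schedule up to time `k`. -/
noncomputable def schedule : ℕ → List (Fin n)
  | 0 => []
  | k + 1 => schedule k ++ R.segment k

lemma schedule_isPrefix (k : ℕ) : R.schedule k <+: R.schedule (k + 1) :=
  List.prefix_append _ _

lemma steps_zero (p : Fin n) : R.steps 0 p = 0 := by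
  have hs : ¬ R.Scanned 0 0 p := fun ⟨_, _, _, _, _, ht⟩ => Nat.not_lt_zero _ ht
  rw [steps, if_neg hs, R.zero]

lemma count_schedule (k : ℕ) (p : Fin n) : (R.schedule k).count p = R.steps k p := by
  induction k with
  | zero => simp [schedule, steps_zero]
  | succ k ih => rw [schedule, List.count_append, ih, count_segment]

lemma config_zero : R.config 0 = P.initial v := by
  have hmem : P.knownMemory f (cnt 0) = fun _ _ => y₀ := by
    funext k p
    simp only [knownMemory, R.zero, Nat.zero_sub, written]
  simp only [config, steps_zero, R.start, hmem]
  rfl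

lemma exec_schedule (k : ℕ) : P.exec (P.initial v) (R.schedule k) = R.config k := by
  induction k with
  | zero => exact R.config_zero.symm
  | succ k ih => rw [schedule, exec_append, ih, exec_segment]

lemma hasDecided_exec_schedule {k : ℕ} {p : Fin n} {w : W} :
    P.HasDecided (P.exec (P.initial v) (R.schedule k)) p w ↔
      P.action p (f p (R.steps k p)) = .inr w := by
  rw [exec_schedule]
  rfl

end Replay

end Protocol

/-! ### Agreement on the local states of simulated processes -/

/-- An event in the history of a simulating process. `start v` is its input, `enter p c l d`
proposes `d` as local state number `c` of the simulated process `p` at level `l`, `post m d`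
announces `d` with weight `m` at the level entered before, and `commit` and `adopt` end a level. -/
inductive Record (n : ℕ) (V L : Type) : Type
  | start (v : V)
  | enter (p : Fin n) (c l : ℕ) (d : L)
  | post (m : ℕ) (d : L)
  | commit
  | adopt

/-- A history of a simulating process, latest event first. -/
abbrev History (n : ℕ) (V L : Type) := List (Record n V L)

namespace History

open Record

section Agreement

variable {n : ℕ} {V L : Type} (S S' : Finset (History n V L)) (p : Fin n) (c l : ℕ) (d : L)

/-- `d` is proposed as state `c` of `p` at level `l`. -/
def Proposed : Prop := ∃ g, enter p c l d :: g ∈ S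

/-- A history that entered level `l` with the proposal `d` for state `c` of `p` has committed. -/
def Committed : Prop := ∃ m e g, commit :: post m e :: enter p c l d :: g ∈ S

/-- `d` is agreed to be state `c` of `p`. -/
def Decided : Prop := ∃ l, Committed S p c l d

/-- Every history that entered level `l` for state `c` of `p` has posted. -/
def Closed : Prop :=
  ∀ e g, enter p c l e :: g ∈ S → ∃ m d, post m d :: enter p c l e :: g ∈ S

/-- `d` is posted at level `l` for state `c` of `p`, with the least weight. -/
def Posted : Prop :=
  ∃ m e g, post m d :: enter p c l e :: g ∈ S ∧
    ∀ m' d' e' g', post m' d' :: enter p c l e' :: g' ∈ S → m ≤ m'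

open Classical in
/-- The entries to level `l` for state `c` of `p`; their number is the weight of a post. -/
noncomputable def entries : Finset (History n V L) :=
  S.filter fun x => ∃ d g, x = enter p c l d :: g

/-- Some proposal for state `c` of `p` at level `l`, which depends on the entries only. -/
noncomputable def pick [Nonempty L] : L := Classical.epsilon (Proposed S p c l)

/-- The state number `c` of `p` that is agreed on, if any. -/
noncomputable def agreed [Nonempty L] (S : Finset (History n V L)) (p : Fin n) (c : ℕ) : L :=
  Classical.epsilon (Decided S p c)

/-- The number of states of `p` that are agreed on. -/
noncomputable def count : ℕ := sInf {c | ∀ d, ¬ Decided S p c d}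

/-- The first level without entries for the next state of `p`. -/
noncomputable def level : ℕ := sInf {l | ∀ d, ¬ Proposed S p (count S p) l d}

/-- The next level for `p` may be entered: the one before it, if any, is closed. -/
def Available : Prop := ∀ l, level S p = l + 1 → Closed S p (count S p) l

/-- At least `n - t` simulated processes are available. -/
def Ready (t : ℕ) : Prop := n ≤ {p | Available S p}.ncard + t

/-- `p` is available and has the least number of agreed states among the available processes. -/
def Target : Prop := Available S p ∧ ∀ q, Available S q → count S p ≤ count S q

/-- A process with the history `g` is between two levels. -/
def Idle (g : History n V L) : Prop :=
  (∀ p c l e g', g ≠ enter p c l e :: g') ∧ ∀ m d p c l e g', g ≠ post m d :: enter p c l e :: g'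

variable {S S' p c l d}

lemma Proposed.mono (h : Proposed S p c l d) (hS : S ⊆ S') : Proposed S' p c l d :=
  h.imp fun _ hg => hS hg

lemma Decided.mono (h : Decided S p c d) (hS : S ⊆ S') : Decided S' p c d := by
  obtain ⟨l, m, e, g, hg⟩ := h
  exact ⟨l, m, e, g, hS hg⟩

lemma mem_entries {x : History n V L} :
    x ∈ entries S p c l ↔ x ∈ S ∧ ∃ d g, x = enter p c l d :: g := by
  simp [entries]

lemma entries_mono (hS : S ⊆ S') : entries S p c l ⊆ entries S' p c l :=
  fun _ hx => mem_entries.2 ((mem_entries.1 hx).imp_left (@hS _))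

lemma proposed_iff_mem_entries :
    Proposed S p c l d ↔ ∃ g, enter p c l d :: g ∈ entries S p c l := by
  simp [Proposed, mem_entries]

lemma proposed_pick [Nonempty L] (h : Proposed S p c l d) : Proposed S p c l (pick S p c l) :=
  Classical.epsilon_spec ⟨d, h⟩

lemma pick_congr [Nonempty L] (h : entries S p c l = entries S' p c l) :
    pick S p c l = pick S' p c l := by
  rw [pick, pick]
  congr 1
  funext d
  rw [proposed_iff_mem_entries, h, ← proposed_iff_mem_entries]

lemma decided_agreed [Nonempty L] (h : Decided S p c d) : Decided S p c (agreed S p c) :=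
  Classical.epsilon_spec ⟨d, h⟩

lemma exists_nat_forall_mem_not {α : Type*} (A : Finset α) {r : ℕ → α → Prop}
    (hr : ∀ i j x, r i x → r j x → i = j) : ∃ i, ∀ x ∈ A, ¬ r i x := by
  by_contra! h
  choose x hx hrx using h
  exact Set.infinite_of_injective_forall_mem (s := A)
    (fun i j (hij : x i = x j) => hr i j _ (hrx i) (hij ▸ hrx j)) hx A.finite_toSet

variable (S p d)

lemma not_decided_count : ¬ Decided S p (count S p) d := by
  obtain ⟨c, hc⟩ := exists_nat_forall_mem_not S
    (r := fun c x => ∃ l m e d g, x = commit :: post m e :: enter p c l d :: g) (by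
      rintro c c' x ⟨l, m, e, d, g, rfl⟩ ⟨l', m', e', d', g', h⟩
      simp only [List.cons.injEq, enter.injEq] at h
      exact h.2.2.1.2.1)
  refine Nat.sInf_mem (s := {c | ∀ d, ¬ Decided S p c d}) ⟨c, ?_⟩ d
  rintro d ⟨l, m, e, g, hg⟩
  exact hc _ hg ⟨l, m, e, d, g, rfl⟩

lemma not_proposed_level : ¬ Proposed S p (count S p) (level S p) d := by
  obtain ⟨l, hl⟩ := exists_nat_forall_mem_not S
    (r := fun l x => ∃ d g, x = enter p (count S p) l d :: g) (by
      rintro l l' x ⟨d, g, rfl⟩ ⟨d', g', h⟩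
      simp only [List.cons.injEq, enter.injEq] at h
      exact h.1.2.2.1)
  refine Nat.sInf_mem (s := {l | ∀ d, ¬ Proposed S p (count S p) l d}) ⟨l, ?_⟩ d
  rintro d ⟨g, hg⟩
  exact hl _ hg ⟨d, g, rfl⟩

variable {S p d}

lemma exists_decided_of_lt_count (h : c < count S p) : ∃ d, Decided S p c d := by
  simpa using Nat.notMem_of_lt_sInf h

lemma exists_proposed_of_lt_level (h : l < level S p) : ∃ d, Proposed S p (count S p) l d := by
  simpa using Nat.notMem_of_lt_sInf h

lemma count_mono (h : S ⊆ S') (p : Fin n) : count S p ≤ count S' p := by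
  by_contra! hlt
  obtain ⟨d, hd⟩ := exists_decided_of_lt_count hlt
  exact not_decided_count S' p d (hd.mono h)

@[simp] lemma count_empty (p : Fin n) : count (∅ : Finset (History n V L)) p = 0 := by
  by_contra h
  obtain ⟨d, l, m, e, g, hg⟩ := exists_decided_of_lt_count (Nat.pos_of_ne_zero h)
  exact Finset.notMem_empty _ hg

lemma Closed.exists_posted (hc : Closed S p c l) (h : Proposed S p c l d) :
    ∃ e, Posted S p c l e := by
  obtain ⟨g, hg⟩ := h
  obtain ⟨m, e, he⟩ := hc d g hg
  have hne : {m | ∃ d e g, post m d :: enter p c l e :: g ∈ S}.Nonempty := ⟨m, e, d, g, he⟩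
  obtain ⟨d', e', g', h'⟩ := Nat.sInf_mem hne
  exact ⟨d', _, e', g', h', fun m' d'' e'' g'' h'' => Nat.sInf_le ⟨d'', e'', g'', h''⟩⟩

lemma ncard_add_ncard_compl_eq (A : Set (Fin n)) : A.ncard + Aᶜ.ncard = n := by
  rw [Set.ncard_add_ncard_compl, Nat.card_fin]

lemma Ready.exists_available {t : ℕ} (h : Ready S t) {A : Set (Fin n)} (hA : t < A.ncard) :
    ∃ p ∈ A, Available S p := by
  by_contra! hdisj
  have hsub : A ⊆ {p | Available S p}ᶜ := hdisj
  have := Set.ncard_le_ncard hsub (Set.toFinite _)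
  have := ncard_add_ncard_compl_eq {p | Available S p}
  rw [Ready] at h
  lia

lemma Ready.exists_target {t : ℕ} (h : Ready S t) (htn : t < n) : ∃ p, Target S p := by
  obtain ⟨q, -, hq⟩ := h.exists_available (A := Set.univ) (by rwa [Set.ncard_univ, Nat.card_fin])
  obtain ⟨p, hp, hmin⟩ :=
    Set.exists_min_image {p | Available S p} (count S) (Set.toFinite _) ⟨q, hq⟩
  exact ⟨p, hp, hmin⟩

end Agreement

/-! ### The simulation as a set code -/

section Code

variable {n : ℕ} {V W K Y : Type} {y₀ : Y} (P : Protocol (snapshotMemory n K Y y₀) V W)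
  (S : Finset (History n V P.Local))

/-- Some simulated process has decided `w`. -/
def Output (w : W) : Prop := ∃ p c d, Decided S p c d ∧ P.action p d = .inr w

variable {P S} in
lemma Output.mono {S' : Finset (History n V P.Local)} {w : W} (h : Output P S w) (hS : S ⊆ S') :
    Output P S' w := by
  obtain ⟨p, c, d, hd, hw⟩ := h
  exact ⟨p, c, d, hd.mono hS, hw⟩

variable [Nonempty V] [Nonempty P.Local] (t : ℕ)

/-- The state of `p` that follows its agreed states, computed as if every process had executed
exactly the operations that are known from the agreed states. -/
noncomputable def nextState (p : Fin n) : P.Local :=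
  match count S p with
  | 0 => P.start p (Classical.epsilon fun v => [start v] ∈ S)
  | c + 1 =>
    match P.action p (agreed S p c) with
    | .inl op => P.afterOp p (agreed S p c) op (P.knownMemory (agreed S) (count S))
    | .inr _ => agreed S p c

/-- The value with which a process enters the next level for `p`. -/
noncomputable def proposal (p : Fin n) : P.Local :=
  match level S p with
  | 0 => nextState P S p
  | l + 1 => Classical.epsilon (Posted S p (count S p) l)

/-- The possible next events of a process that has a given history and obtains the view `S`. -/
inductive Move : History n V P.Local → Record n V P.Local → Prop
  | enter {g p} (hg : Idle g) (hr : Ready S t) (hp : Target S p) :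
      Move g (.enter p (count S p) (level S p) (proposal P S p))
  | post {p c l e g} :
      Move (.enter p c l e :: g) (.post (entries S p c l).card (pick S p c l))
  | commit {m d p c l e g} (h : ∀ e', Proposed S p c l e' → e' = e) :
      Move (.post m d :: .enter p c l e :: g) .commit
  | adopt {m d p c l e g} (h : ∃ e', Proposed S p c l e' ∧ e' ≠ e) :
      Move (.post m d :: .enter p c l e :: g) .adopt

open Classical in
/-- The code of the simulating processes: decide as soon as some simulated process has decided, and
otherwise append an event to the history if possible. -/
noncomputable def simulation : SetCode V W (History n V P.Local) where
  start := fun v => [.start v]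
  act := fun g S =>
    if h : ∃ w, Output P S w then .decide h.choose
    else if h : ∃ r, Move P S t g r then .advance (h.choose :: g)
    else .wait

variable {P t S} {g : History n V P.Local}

namespace Move

variable {r : Record n V P.Local} {p : Fin n} {c l m : ℕ} {d e : P.Local}

lemma of_eq_enter (h : Move P S t g (.enter p c l d)) :
    Idle g ∧ Ready S t ∧ Target S p ∧ c = count S p ∧ l = level S p ∧ d = proposal P S p := by
  cases h with
  | enter hg hr hp => exact ⟨hg, hr, hp, rfl, rfl, rfl⟩

lemma exists_enter_of_idle (h : Move P S t g r) (hg : Idle g) : ∃ p c l d, r = .enter p c l d := by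
  cases h with
  | enter => exact ⟨_, _, _, _, rfl⟩
  | post => exact absurd rfl (hg.1 _ _ _ _ _)
  | commit => exact absurd rfl (hg.2 _ _ _ _ _ _ _)
  | adopt => exact absurd rfl (hg.2 _ _ _ _ _ _ _)

lemma eq_post_of_enter (h : Move P S t (.enter p c l e :: g) r) :
    r = .post (entries S p c l).card (pick S p c l) := by
  cases h with
  | enter hg => exact absurd rfl (hg.1 p c l e g)
  | post => rfl

lemma eq_commit_or_adopt_of_post (h : Move P S t (.post m d :: .enter p c l e :: g) r) :
    (r = .commit ∧ ∀ e', Proposed S p c l e' → e' = e) ∨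
      (r = .adopt ∧ ∃ e', Proposed S p c l e' ∧ e' ≠ e) := by
  cases h with
  | enter hg => exact absurd rfl (hg.2 m d p c l e g)
  | commit he => exact .inl ⟨rfl, he⟩
  | adopt he => exact .inr ⟨rfl, he⟩

end Move

lemma exists_move_of_act_eq_advance {x : History n V P.Local}
    (h : (simulation P t).act g S = .advance x) :
    (∀ w, ¬ Output P S w) ∧ ∃ r, x = r :: g ∧ Move P S t g r := by
  simp only [simulation] at h
  split_ifs at h with hout hmove
  cases h
  exact ⟨not_exists.1 hout, _, rfl, hmove.choose_spec⟩

lemma output_of_act_eq_decide {w : W} (h : (simulation P t).act g S = .decide w) :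
    Output P S w := by
  simp only [simulation] at h
  split_ifs at h with hout
  cases h
  exact hout.choose_spec

lemma idle_of_forall_not_move (h : ∀ r, ¬ Move P S t g r) : Idle g := by
  refine ⟨?_, ?_⟩
  · rintro p c l e g' rfl
    exact h _ .post
  · rintro m d p c l e g' rfl
    by_cases hu : ∀ e', Proposed S p c l e' → e' = e
    · exact h _ (.commit hu)
    · push Not at hu
      exact h _ (.adopt hu)

lemma of_act_eq_wait (htn : t < n) (h : (simulation P t).act g S = .wait) :
    (∀ w, ¬ Output P S w) ∧ Idle g ∧ ¬ Ready S t := by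
  simp only [simulation] at h
  split_ifs at h with hout hmove
  have hidle := idle_of_forall_not_move (not_exists.1 hmove)
  refine ⟨not_exists.1 hout, hidle, fun hready => ?_⟩
  obtain ⟨p, hp⟩ := hready.exists_target htn
  exact hmove ⟨_, .enter hidle hready hp⟩

end Code

/-! ### Runs of the simulation -/

section Runs

variable {n t : ℕ} {V W K Y : Type} {y₀ : Y} {P : Protocol (snapshotMemory n K Y y₀) V W}
  [Nonempty V] [Nonempty P.Local] {v : Fin n → V} {F : Set (Fin n)}
  {R : SetRun (simulation P t) v F}

variable (R) in
lemma item_suffix (q : Fin n) {k k' : ℕ} (h : k ≤ k') : R.item k q <:+ R.item k' q := by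
  induction h with
  | refl => exact List.suffix_rfl
  | @step m _ ih =>
    refine ih.trans ?_
    rcases R.item_succ m q with hidle | ⟨S, -, -, -, hact⟩
    · rw [hidle]
    · obtain ⟨-, r, hr, -⟩ := exists_move_of_act_eq_advance hact
      rw [show R.item m.succ q = r :: R.item m q from hr]
      exact List.suffix_cons _ _

variable (R) in
lemma item_ne_nil (k : ℕ) (q : Fin n) : R.item k q ≠ [] := by
  intro h
  have hsuffix := item_suffix R q (Nat.zero_le k)
  rw [h, R.item_zero] at hsuffix
  simp [simulation] at hsuffix

lemma ne_nil_of_mem {S : Finset (History n V P.Local)} (hS : S ∈ R.views)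
    {x : History n V P.Local} (hx : x ∈ S) : x ≠ [] := by
  obtain ⟨k, q, rfl⟩ := R.reached S hS x hx
  exact item_ne_nil R k q

lemma start_or_exists_move_of_item_eq {k : ℕ} {q : Fin n} {r : Record n V P.Local}
    {g : History n V P.Local} (h : R.item k q = r :: g) :
    (g = [] ∧ ∃ q, r = start (v q)) ∨
      ∃ S ∈ R.views, g ∈ S ∧ r :: g ∉ S ∧ (∀ w, ¬ Output P S w) ∧ Move P S t g r := by
  classical
  have hex : ∃ k q, R.item k q = r :: g := ⟨k, q, h⟩
  have hfirst : ∀ i < Nat.find hex, ¬ ∃ q, R.item i q = r :: g := fun i => Nat.find_min hex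
  obtain ⟨q, hq⟩ := Nat.find_spec hex
  rcases hk : Nat.find hex with _ | k
  · rw [hk, R.item_zero] at hq
    simp only [simulation, List.cons.injEq] at hq
    exact .inl ⟨hq.2.symm, q, hq.1.symm⟩
  · rw [hk] at hq hfirst
    rcases R.item_succ k q with hidle | ⟨S, hS, hg, hseen, hact⟩
    · exact absurd ⟨q, hidle ▸ hq⟩ (hfirst k (Nat.lt_succ_self k))
    · obtain ⟨hout, r', hr', hmove⟩ := exists_move_of_act_eq_advance hact
      rw [hq] at hr'
      obtain ⟨rfl, hg'⟩ := List.cons.inj hr'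
      rw [← hg'] at hg hmove
      refine .inr ⟨S, hS, hg, fun hx => ?_, hout, hmove⟩
      obtain ⟨i, hi, hq'⟩ := hseen _ hx
      exact hfirst i (Nat.lt_succ_of_le hi) hq'

variable {T T' : Finset (History n V P.Local)} {r : Record n V P.Local} {g : History n V P.Local}
  {p : Fin n} {c l l' m : ℕ} {d d' e : P.Local}

lemma start_or_exists_move (hT : T ∈ R.views) (h : r :: g ∈ T) :
    (g = [] ∧ ∃ q, r = start (v q)) ∨
      ∃ S ∈ R.views, S ⊆ T ∧ g ∈ S ∧ (∀ w, ¬ Output P S w) ∧ Move P S t g r := by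
  obtain ⟨k, q, hq⟩ := R.reached T hT _ h
  refine (start_or_exists_move_of_item_eq hq).imp_right ?_
  rintro ⟨S, hS, hg, hr, hout, hmove⟩
  exact ⟨S, hS, (R.chain S hS T hT).resolve_right fun hTS => hr (hTS h), hg, hout, hmove⟩

lemma exists_move (hT : T ∈ R.views) (h : r :: g ∈ T) (hg : g ≠ []) :
    ∃ S ∈ R.views, S ⊆ T ∧ g ∈ S ∧ (∀ w, ¬ Output P S w) ∧ Move P S t g r :=
  (start_or_exists_move hT h).resolve_left fun h' => hg h'.1

lemma mem_of_cons_mem (hT : T ∈ R.views) (h : r :: g ∈ T) (hg : g ≠ []) : g ∈ T := by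
  obtain ⟨S, -, hST, hgS, -⟩ := exists_move hT h hg
  exact hST hgS

lemma mem_of_suffix {x : History n V P.Local} (hT : T ∈ R.views) (hx : x ∈ T) (hgx : g <:+ x)
    (hg : g ≠ []) : g ∈ T := by
  obtain ⟨a, rfl⟩ := hgx
  induction a with
  | nil => exact hx
  | cons r a ih => exact ih (mem_of_cons_mem hT hx (by simp [hg]))

lemma exists_start_mem (hT : T ∈ R.views) (hg : g ∈ T) : ∃ q, [start (v q)] ∈ T := by
  induction g with
  | nil => exact absurd rfl (ne_nil_of_mem hT hg)
  | cons r g ih =>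
    rcases start_or_exists_move hT hg with ⟨rfl, q, rfl⟩ | ⟨S, -, hST, hgS, -⟩
    · exact ⟨q, hg⟩
    · exact ih (hST hgS)

lemma exists_eq_of_start_mem {u : V} (hT : T ∈ R.views) (hu : [start u] ∈ T) : ∃ q, u = v q := by
  rcases start_or_exists_move hT hu with ⟨-, q, hq⟩ | ⟨S, hS, -, hnil, -⟩
  · exact ⟨q, start.inj hq⟩
  · exact absurd rfl (ne_nil_of_mem hS hnil)

lemma exists_view_of_enter_mem (hT : T ∈ R.views) (h : enter p c l d :: g ∈ T) :
    ∃ S ∈ R.views, S ⊆ T ∧ g ∈ S ∧ (∀ w, ¬ Output P S w) ∧ Target S p ∧ c = count S p ∧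
      l = level S p ∧ d = proposal P S p := by
  rcases start_or_exists_move hT h with ⟨-, q, hq⟩ | ⟨S, hS, hST, hg, hout, hmove⟩
  · cases hq
  · exact ⟨S, hS, hST, hg, hout, hmove.of_eq_enter.2.2⟩

lemma exists_view_of_post_mem (hT : T ∈ R.views) (h : post m d :: enter p c l e :: g ∈ T) :
    ∃ S ∈ R.views, S ⊆ T ∧ enter p c l e :: g ∈ S ∧ m = (entries S p c l).card ∧
      d = pick S p c l := by
  obtain ⟨S, hS, hST, hg, -, hmove⟩ := exists_move hT h (List.cons_ne_nil _ _)
  cases hmove with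
  | post => exact ⟨S, hS, hST, hg, rfl, rfl⟩

lemma exists_eq_post_of_cons_enter_mem (hT : T ∈ R.views) (h : r :: enter p c l e :: g ∈ T) :
    ∃ m d, r = post m d := by
  obtain ⟨S, -, -, -, -, hmove⟩ := exists_move hT h (List.cons_ne_nil _ _)
  exact ⟨_, _, hmove.eq_post_of_enter⟩

lemma Committed.exists_view (hT : T ∈ R.views) (h : Committed T p c l d) :
    ∃ S ∈ R.views, S ⊆ T ∧ (∃ m e g, post m e :: enter p c l d :: g ∈ S) ∧
      ∀ e, Proposed S p c l e → e = d := by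
  obtain ⟨m, e, g, hg⟩ := h
  obtain ⟨S, hS, hST, hpost, -, hmove⟩ := exists_move hT hg (List.cons_ne_nil _ _)
  cases hmove with
  | commit hu => exact ⟨S, hS, hST, ⟨m, e, g, hpost⟩, hu⟩

lemma proposed_of_post_mem (hT : T ∈ R.views) (h : post m d :: enter p c l e :: g ∈ T) :
    Proposed T p c l d := by
  obtain ⟨S, -, hST, hg, -, rfl⟩ := exists_view_of_post_mem hT h
  exact (proposed_pick ⟨g, hg⟩).mono hST

lemma Posted.proposed (hT : T ∈ R.views) (h : Posted T p c l d) : Proposed T p c l d := by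
  obtain ⟨m, e, g, hg, -⟩ := h
  exact proposed_of_post_mem hT hg

lemma Committed.proposed (hT : T ∈ R.views) (h : Committed T p c l d) : Proposed T p c l d := by
  obtain ⟨S, hS, hST, ⟨m, e, g, hg⟩, -⟩ := h.exists_view hT
  exact ⟨g, hST (mem_of_cons_mem hS hg (List.cons_ne_nil _ _))⟩

lemma Proposed.exists_posted (hT : T ∈ R.views) (h : Proposed T p c (l + 1) d) :
    ∃ S ∈ R.views, S ⊆ T ∧ Posted S p c l d ∧ Closed S p c l := by
  obtain ⟨g, hg⟩ := h
  obtain ⟨S, hS, hST, -, -, ⟨hav, -⟩, rfl, hl, rfl⟩ := exists_view_of_enter_mem hT hg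
  have hclosed := hav l hl.symm
  obtain ⟨d, hd⟩ := exists_proposed_of_lt_level (S := S) (p := p) (l := l) (by lia)
  refine ⟨S, hS, hST, ?_, hclosed⟩
  rw [show proposal P S p = Classical.epsilon (Posted S p (count S p) l) by rw [proposal, ← hl]]
  exact Classical.epsilon_spec (hclosed.exists_posted hd)

lemma entries_subset_of_card_le (hT : T ∈ R.views) (hT' : T' ∈ R.views)
    (h : (entries T p c l).card ≤ (entries T' p c l).card) :
    entries T p c l ⊆ entries T' p c l := by
  rcases R.chain T hT T' hT' with h' | h'
  · exact entries_mono h'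
  · exact (Finset.eq_of_subset_of_card_le (entries_mono h') h).ge

lemma Committed.eq_of_proposed_succ (hT : T ∈ R.views) (hT' : T' ∈ R.views)
    (h : Committed T p c l d) (h' : Proposed T' p c (l + 1) e) : e = d := by
  obtain ⟨S, hS, -, ⟨m, e₀, g, hpost⟩, huniq⟩ := h.exists_view hT
  obtain ⟨S', hS', -, ⟨m', e', g', hpost', hmin⟩, -⟩ := h'.exists_posted hT'
  refine huniq e ?_
  rcases R.chain S' hS' S hS with hsub | hsub
  · exact (proposed_of_post_mem hS' hpost').mono hsub
  · -- The post of least weight saw no more entries than the one of the committing process.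
    obtain ⟨U, hU, hUS, -, rfl, -⟩ := exists_view_of_post_mem hS hpost
    obtain ⟨U', hU', -, hg', rfl, rfl⟩ := exists_view_of_post_mem hS' hpost'
    obtain ⟨a, ha⟩ := proposed_iff_mem_entries.1 (proposed_pick ⟨g', hg'⟩)
    have hentries := entries_subset_of_card_le hU' hU (hmin _ _ _ _ (hsub hpost))
    exact ⟨a, hUS (mem_entries.1 (hentries ha)).1⟩

lemma Committed.eq_of_proposed_of_lt (hT : T ∈ R.views) (hT' : T' ∈ R.views)
    (h : Committed T p c l d) (h' : Proposed T' p c l' e) (hl : l < l') : e = d := by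
  induction l', hl using Nat.le_induction generalizing T' e with
  | base => exact h.eq_of_proposed_succ hT hT' h'
  | succ l' _ ih =>
    obtain ⟨S, hS, -, hposted, -⟩ := h'.exists_posted hT'
    exact ih hS (hposted.proposed hS)

lemma Committed.eq_of_le (hT : T ∈ R.views) (hT' : T' ∈ R.views) (h : Committed T p c l d)
    (h' : Committed T' p c l' d') (hl : l ≤ l') : d = d' := by
  rcases hl.eq_or_lt with rfl | hl
  · obtain ⟨S, hS, -, ⟨m, e, g, hg⟩, hu⟩ := h.exists_view hT
    obtain ⟨S', hS', -, ⟨m', e', g', hg'⟩, hu'⟩ := h'.exists_view hT'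
    rcases R.chain S hS S' hS' with hsub | hsub
    · exact hu' d ⟨g, hsub (mem_of_cons_mem hS hg (List.cons_ne_nil _ _))⟩
    · exact (hu d' ⟨g', hsub (mem_of_cons_mem hS' hg' (List.cons_ne_nil _ _))⟩).symm
  · exact (h.eq_of_proposed_of_lt hT hT' (h'.proposed hT') hl).symm

lemma Decided.unique (hT : T ∈ R.views) (hT' : T' ∈ R.views) (h : Decided T p c d)
    (h' : Decided T' p c d') : d = d' := by
  obtain ⟨l, hl⟩ := h
  obtain ⟨l', hl'⟩ := h'
  rcases le_total l l' with hle | hle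
  · exact hl.eq_of_le hT hT' hl' hle
  · exact (hl'.eq_of_le hT' hT hl hle).symm

lemma Proposed.exists_eq_nextState (hT : T ∈ R.views) (h : Proposed T p c l d) :
    ∃ S ∈ R.views, S ⊆ T ∧ count S p = c ∧ (∀ w, ¬ Output P S w) ∧ d = nextState P S p ∧
      ∃ q, [start (v q)] ∈ S := by
  induction l generalizing T with
  | zero =>
    obtain ⟨g, hg⟩ := h
    obtain ⟨S, hS, hST, hgS, hout, -, rfl, hl, rfl⟩ := exists_view_of_enter_mem hT hg
    exact ⟨S, hS, hST, rfl, hout, by rw [proposal, ← hl], exists_start_mem hS hgS⟩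
  | succ l ih =>
    obtain ⟨T', hT', hsub, hposted, -⟩ := h.exists_posted hT
    obtain ⟨S, hS, hST', hS'⟩ := ih hT' (hposted.proposed hT')
    exact ⟨S, hS, hST'.trans hsub, hS'⟩

lemma Decided.exists_eq_nextState (hT : T ∈ R.views) (h : Decided T p c d) :
    ∃ S ∈ R.views, S ⊆ T ∧ count S p = c ∧ (∀ w, ¬ Output P S w) ∧ d = nextState P S p ∧
      ∃ q, [start (v q)] ∈ S := by
  obtain ⟨l, hl⟩ := h
  exact (hl.proposed hT).exists_eq_nextState hT

lemma Decided.lt_count (hT : T ∈ R.views) (h : Decided T p c d) : c < count T p := by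
  obtain ⟨S, -, hST, rfl, -⟩ := h.exists_eq_nextState hT
  refine (count_mono hST p).lt_of_ne fun heq => ?_
  rw [heq] at h
  exact not_decided_count T p d h

end Runs

end History

namespace SetRun

variable {n : ℕ} {V W X : Type} {C : SetCode V W X} {v : Fin n → V} {F : Set (Fin n)}
  (R : SetRun C v F)

open Classical in
/-- The largest view with at most `k` elements, or `∅` if there is none. -/
noncomputable def viewAt : ℕ → Finset X
  | 0 => ∅
  | k + 1 => if h : ∃ S ∈ R.views, S.card = k + 1 then h.choose else viewAt k

lemma viewAt_eq_empty_or_mem (k : ℕ) : R.viewAt k = ∅ ∨ R.viewAt k ∈ R.views := by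
  induction k with
  | zero => exact .inl rfl
  | succ k ih =>
    rw [viewAt]
    split_ifs with h
    · exact .inr h.choose_spec.1
    · exact ih

lemma card_viewAt_le (k : ℕ) : (R.viewAt k).card ≤ k := by
  induction k with
  | zero => simp [viewAt]
  | succ k ih =>
    rw [viewAt]
    split_ifs with h
    · exact h.choose_spec.2.le
    · exact Nat.le_succ_of_le ih

variable {R} {S : Finset X}

lemma subset_of_card_le {S' : Finset X} (hS : S ∈ R.views) (hS' : S' ∈ R.views)
    (h : S.card ≤ S'.card) : S ⊆ S' :=
  (R.chain S hS S' hS').elim id fun hsub => (Finset.eq_of_subset_of_card_le hsub h).ge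

lemma subset_viewAt {k : ℕ} (hS : S ∈ R.views) (h : S.card ≤ k) : S ⊆ R.viewAt k := by
  induction k with
  | zero => exact (Finset.card_eq_zero.1 (Nat.le_zero.1 h)).le
  | succ k ih =>
    rw [viewAt]
    split_ifs with h'
    · exact subset_of_card_le hS h'.choose_spec.1 (h.trans h'.choose_spec.2.ge)
    · exact ih (Nat.le_of_lt_succ (h.lt_of_ne fun heq => h' ⟨S, hS, heq⟩))

lemma viewAt_card (hS : S ∈ R.views) : R.viewAt S.card = S :=
  (Finset.eq_of_subset_of_card_le (subset_viewAt hS le_rfl) (R.card_viewAt_le _)).symm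

lemma viewAt_succ_subset {k : ℕ} (hS : S ∈ R.views) (h : ¬ S ⊆ R.viewAt k) :
    R.viewAt (k + 1) ⊆ S := by
  have hk : k < S.card := by
    by_contra! hle
    exact h (subset_viewAt hS hle)
  rcases R.viewAt_eq_empty_or_mem (k + 1) with h' | h'
  · exact h' ▸ Finset.empty_subset S
  · exact subset_of_card_le h' hS ((R.card_viewAt_le _).trans hk)

variable (R)

lemma viewAt_mono : Monotone R.viewAt := by
  intro j k hjk
  rcases R.viewAt_eq_empty_or_mem j with h | h
  · exact h ▸ Finset.empty_subset _
  · exact subset_viewAt h ((R.card_viewAt_le j).trans hjk)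

end SetRun

namespace History

open Record

/-! ### Replay of the agreed states -/

section AgreedReplay

variable {n t : ℕ} {V W K Y : Type} {y₀ : Y} {P : Protocol (snapshotMemory n K Y y₀) V W}
  [Nonempty V] [Nonempty P.Local] {v : Fin n → V} {F : Set (Fin n)}
  {R : SetRun (simulation P t) v F} {S : Finset (History n V P.Local)} {p : Fin n} {c : ℕ}
  {d : P.Local}

lemma viewAt_mem_of_lt_count {k : ℕ} (h : c < count (R.viewAt k) p) : R.viewAt k ∈ R.views := by
  refine (R.viewAt_eq_empty_or_mem k).resolve_left fun hempty => ?_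
  rw [hempty, count_empty] at h
  exact Nat.not_lt_zero c h

variable (R) in
lemma count_viewAt_succ_le (k : ℕ) (p : Fin n) :
    count (R.viewAt (k + 1)) p ≤ count (R.viewAt k) p + 1 := by
  by_contra! hlt
  obtain ⟨d, hd⟩ := exists_decided_of_lt_count hlt
  obtain ⟨S, hS, -, hc, -⟩ := hd.exists_eq_nextState (viewAt_mem_of_lt_count hlt)
  have hsub : R.viewAt (k + 1) ⊆ S := SetRun.viewAt_succ_subset hS fun hs => by
    have := count_mono hs p
    lia
  have := count_mono hsub p
  lia

variable (R) in
open Classical in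
/-- The agreed state number `c` of `p`; a default state if there is none. -/
noncomputable def state (p : Fin n) (c : ℕ) : P.Local :=
  if h : ∃ d, ∃ S ∈ R.views, Decided S p c d then h.choose else P.start p (v p)

lemma Decided.state_eq (hS : S ∈ R.views) (h : Decided S p c d) : state R p c = d := by
  have hex : ∃ d, ∃ S ∈ R.views, Decided S p c d := ⟨d, S, hS, h⟩
  rw [state, dif_pos hex]
  obtain ⟨S', hS', h'⟩ := hex.choose_spec
  exact h'.unique hS' hS h

lemma decided_state_of_lt_count (hS : S ∈ R.views) (h : c < count S p) :
    Decided S p c (state R p c) := by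
  obtain ⟨d, hd⟩ := exists_decided_of_lt_count h
  rwa [hd.state_eq hS]

lemma agreed_eq_state (hS : S ∈ R.views) (h : c < count S p) : agreed S p c = state R p c :=
  ((decided_agreed (decided_state_of_lt_count hS h)).state_eq hS).symm

variable (R) in
lemma exists_state_zero_eq_start (p : Fin n) : ∃ q, state R p 0 = P.start p (v q) := by
  by_cases h : ∃ d, ∃ S ∈ R.views, Decided S p 0 d
  · obtain ⟨d, S, hS, hd⟩ := h
    obtain ⟨S₀, hS₀, -, hc, -, rfl, q, hq⟩ := hd.exists_eq_nextState hS
    obtain ⟨q', hq'⟩ := exists_eq_of_start_mem hS₀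
      (Classical.epsilon_spec (p := fun v : V => [start v] ∈ S₀) ⟨v q, hq⟩)
    refine ⟨q', ?_⟩
    rw [hd.state_eq hS, nextState, hc]
    exact congrArg (P.start p) hq'
  · exact ⟨p, by rw [state, dif_neg h]⟩

lemma exists_action_of_decided_succ {i : ℕ} (hS : S ∈ R.views) (h : Decided S p (i + 1) d) :
    ∃ j op, P.action p (state R p i) = .inl op ∧ count (R.viewAt j) p = i + 1 ∧
      d = P.afterOp p (state R p i) op (P.knownMemory (state R) (count (R.viewAt j))) := by
  obtain ⟨S, hS, -, hc, hout, hd, -⟩ := h.exists_eq_nextState hS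
  have hlt : i < count S p := by lia
  have hmemory : P.knownMemory (agreed S) (count S) = P.knownMemory (state R) (count S) := by
    funext k q
    exact P.written_congr fun j hj => agreed_eq_state hS (by lia)
  rw [nextState, hc] at hd
  simp only [agreed_eq_state hS hlt, hmemory] at hd
  rcases hop : P.action p (state R p i) with op | w
  · refine ⟨S.card, op, rfl, ?_, ?_⟩ <;> rw [SetRun.viewAt_card hS]
    · exact hc
    · simpa only [hop] using hd
  · exact absurd ⟨p, i, _, decided_state_of_lt_count hS hlt, hop⟩ (hout w)

variable (R) in
lemma exists_time (p : Fin n) (i : ℕ) : ∃ j, ∀ k, i + 2 ≤ count (R.viewAt k) p →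
    ∃ op, P.action p (state R p i) = .inl op ∧ count (R.viewAt j) p = i + 1 ∧
      state R p (i + 1) = P.afterOp p (state R p i) op
        (P.knownMemory (state R) (count (R.viewAt j))) := by
  by_cases h : ∃ k, i + 2 ≤ count (R.viewAt k) p
  · obtain ⟨k, hk⟩ := h
    have hV := viewAt_mem_of_lt_count hk
    obtain ⟨j, hj⟩ := exists_action_of_decided_succ hV (decided_state_of_lt_count hV hk)
    exact ⟨j, fun _ _ => hj⟩
  · exact ⟨0, fun k hk => absurd ⟨k, hk⟩ h⟩

variable (R) in
lemma exists_replay : ∃ u time, (∀ p, ∃ q, u p = v q) ∧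
    P.Replay u (state R) (fun k => count (R.viewAt k)) time := by
  choose q hq using exists_state_zero_eq_start R
  choose time htime using exists_time R
  exact ⟨fun p => v (q p), time, fun p => ⟨q p, rfl⟩, hq, fun p => count_empty p,
    fun k p => count_mono (R.viewAt_mono (Nat.le_succ k)) p, count_viewAt_succ_le R, htime⟩

variable {u : Fin n → V} {time : Fin n → ℕ → ℕ} {w : W}

lemma Output.exists_hasDecided (Q : P.Replay u (state R) (fun k => count (R.viewAt k)) time)
    (hS : S ∈ R.views) (h : Output P S w) :
    ∃ p, P.HasDecided (P.exec (P.initial u) (Q.schedule S.card)) p w := by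
  obtain ⟨p, c, d, hd, hw⟩ := h
  rw [← hd.state_eq hS] at hw
  have hc : count (R.viewAt S.card) p = c + 1 := by
    have hlt := hd.lt_count hS
    by_contra hne
    rw [SetRun.viewAt_card hS] at hne
    obtain ⟨op, hop, -⟩ := Q.next p c S.card (by rw [SetRun.viewAt_card hS]; lia)
    cases hw.symm.trans hop
  refine ⟨p, Q.hasDecided_exec_schedule.2 ?_⟩
  rcases Q.steps_eq_or_exists_scan S.card p with h | ⟨i, o, hi, ho⟩
  · rwa [h, hc, Nat.add_sub_cancel]
  · obtain rfl : c = i := by lia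
    cases hw.symm.trans ho

lemma exists_face_forall_output_mem {T : ColorlessTask V W} (R : SetRun (simulation P t) v F)
    (hP : P.SolvesResilient t T) (hn : 0 < n) (s : {s : Finset V // s ∈ T.input.faces})
    (hv : ∀ p, v p ∈ s.1) :
    ∃ τ ∈ (T.carrier s).faces, ∀ S ∈ R.views, ∀ w, Output P S w → w ∈ τ := by
  obtain ⟨u, time, hu, Q⟩ := exists_replay R
  have hus : ∀ p, u p ∈ s.1 := fun p => by
    obtain ⟨q, hq⟩ := hu p
    exact hq ▸ hv q
  obtain ⟨τ, hτ, h⟩ := hP.exists_face_of_isPrefix hn s u hus Q.schedule_isPrefix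
  refine ⟨τ, hτ, fun S hS w hw => ?_⟩
  obtain ⟨p, hp⟩ := hw.exists_hasDecided Q hS
  exact h _ _ _ hp

end AgreedReplay

/-! ### Progress of the simulation -/

section Progress

variable {n t : ℕ} {V W K Y : Type} {y₀ : Y} {P : Protocol (snapshotMemory n K Y y₀) V W}
  [Nonempty V] [Nonempty P.Local] {v : Fin n → V} {F : Set (Fin n)}
  {R : SetRun (simulation P t) v F} {S S' : Finset (History n V P.Local)} {p p' q : Fin n}
  {c l : ℕ} {d d' e : P.Local} {g x : History n V P.Local}

/-- In the view `S`, process `q` has entered a level for `p` and not posted yet. -/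
def Blocks (R : SetRun (simulation P t) v F) (S : Finset (History n V P.Local)) (q p : Fin n) :
    Prop :=
  ∃ k c l e g, R.item k q = enter p c l e :: g ∧ enter p c l e :: g ∈ S ∧
    ∀ m d, post m d :: enter p c l e :: g ∉ S

lemma eq_or_exists_post_mem_of_suffix (hS : S ∈ R.views) (hx : x ∈ S)
    (h : enter p c l e :: g <:+ x) :
    x = enter p c l e :: g ∨ ∃ m d, post m d :: enter p c l e :: g ∈ S := by
  obtain ⟨a, rfl⟩ := h
  rcases List.eq_nil_or_concat a with rfl | ⟨a, r, rfl⟩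
  · exact .inl rfl
  · have hr : r :: enter p c l e :: g ∈ S :=
      mem_of_suffix hS hx ⟨a, by simp⟩ (List.cons_ne_nil _ _)
    obtain ⟨m, d, rfl⟩ := exists_eq_post_of_cons_enter_mem hS hr
    exact .inr ⟨m, d, hr⟩

lemma exists_blocks_of_not_available {K : ℕ} (hK : ∀ k ≥ K, R.item k = R.item K)
    (hS : S ∈ R.views) (hF : ∀ q ∉ F, R.item K q ∈ S ∧ Idle (R.item K q))
    (hp : ¬ Available S p) : ∃ q ∈ F, Blocks R S q p := by
  simp only [Available, Closed, not_forall] at hp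
  obtain ⟨l, -, e, g, hg, hpost⟩ := hp
  push Not at hpost
  obtain ⟨k, q, hq⟩ := R.reached S hS _ hg
  refine ⟨q, ?_, k, _, l, e, g, hq, hg, hpost⟩
  by_contra hqF
  obtain ⟨hmem, hidle⟩ := hF q hqF
  have hsuffix : enter p (count S p) l e :: g <:+ R.item K q := by
    rw [← hq, ← hK (max k K) (le_max_right k K)]
    exact item_suffix R q (le_max_left k K)
  rcases eq_or_exists_post_mem_of_suffix hS hmem hsuffix with heq | ⟨m, d, hmd⟩
  · exact hidle.1 _ _ _ _ _ heq
  · exact hpost m d hmd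

lemma Blocks.unique (hS : S ∈ R.views) (h : Blocks R S q p) (h' : Blocks R S q p') : p = p' := by
  obtain ⟨k, c, l, e, g, hq, hg, hpost⟩ := h
  obtain ⟨k', c', l', e', g', hq', hg', hpost'⟩ := h'
  wlog hk : k ≤ k' generalizing k c l e g k' c' l' e' g' p p'
  · exact (this k' c' l' e' g' hq' hg' hpost' k c l e g hq hg hpost (le_of_not_ge hk)).symm
  have hsuffix := item_suffix R q hk
  rw [hq, hq'] at hsuffix
  rcases eq_or_exists_post_mem_of_suffix hS hg' hsuffix with heq | ⟨m, d, hmd⟩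
  · simp only [List.cons.injEq, enter.injEq] at heq
    exact heq.1.1.symm
  · exact absurd hmd (hpost m d)

lemma ncard_not_available_le {K : ℕ} (hK : ∀ k ≥ K, R.item k = R.item K) (hS : S ∈ R.views)
    (hF : ∀ q ∉ F, R.item K q ∈ S ∧ Idle (R.item K q)) :
    {p | Available S p}ᶜ.ncard ≤ F.ncard := by
  have hblocks : ∀ p ∈ {p | Available S p}ᶜ, ∃ q ∈ F, Blocks R S q p := fun p hp =>
    exists_blocks_of_not_available hK hS hF hp
  choose! φ hφF hφ using hblocks
  refine Set.ncard_le_ncard_of_injOn φ hφF (fun a ha b hb hab => ?_) (Set.toFinite _)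
  have ha' := hφ a ha
  rw [hab] at ha'
  exact ha'.unique hS (hφ b hb)

lemma exists_decides_of_eventually_const (htn : t < n) (hF : F.ncard ≤ t) {K : ℕ}
    (hK : ∀ k ≥ K, R.item k = R.item K) {p : Fin n} (hp : p ∉ F) : ∃ w, R.Decides p w := by
  by_contra! hundecided
  obtain ⟨S, hS, hmax, hwait⟩ := R.live K hK ⟨p, hp, hundecided⟩
  obtain ⟨hout, -, hready⟩ := of_act_eq_wait htn (hwait p hp hundecided).2
  have hnone : ∀ q w, ¬ R.Decides q w := by
    intro q w h
    obtain ⟨k, S', hS', h'⟩ := R.decides q w h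
    exact hout w ((output_of_act_eq_decide h').mono (hmax S' hS'))
  have hblocked := ncard_not_available_le hK hS fun q hq =>
    ⟨(hwait q hq (hnone q)).1, (of_act_eq_wait htn (hwait q hq (hnone q)).2).2.1⟩
  have := ncard_add_ncard_compl_eq {p | Available S p}
  refine hready (show n ≤ {p | Available S p}.ncard + t by lia)

/-- Two histories part right after the same entry to level `l`. -/
def Diverges (R : SetRun (simulation P t) v F) (p : Fin n) (c l : ℕ) : Prop :=
  ∃ e g r r', r ≠ r' ∧ (∃ S ∈ R.views, r :: enter p c l e :: g ∈ S) ∧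
    ∃ S ∈ R.views, r' :: enter p c l e :: g ∈ S

lemma Closed.diverges (hS : S ∈ R.views) (hS' : S' ∈ R.views) (hc : Closed S p c l)
    (hd : Posted S p c l d) (hd' : Posted S' p c l d') (hsub : S ⊆ S') (hne : d ≠ d') :
    Diverges R p c l := by
  obtain ⟨m, e, g, hg, hmin⟩ := hd
  obtain ⟨m', e', g', hg', hmin'⟩ := hd'
  obtain ⟨U, hU, hUS, -, rfl, rfl⟩ := exists_view_of_post_mem hS hg
  obtain ⟨U', hU', -, hgU', rfl, rfl⟩ := exists_view_of_post_mem hS' hg'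
  have hle := hmin' _ _ _ _ (hsub hg)
  have hentries := entries_subset_of_card_le hU' hU hle
  have hlt : (entries U' p c l).card < (entries U p c l).card := by
    refine hle.lt_of_ne fun heq => hne ?_
    exact pick_congr (Finset.eq_of_subset_of_card_le hentries heq.ge).symm
  -- The history of the second post has also posted in `S`, with a larger weight.
  have hmem : enter p c l e' :: g' ∈ S :=
    hUS (mem_entries.1 (hentries (mem_entries.2 ⟨hgU', _, _, rfl⟩))).1
  obtain ⟨m₁, d₁, h₁⟩ := hc _ _ hmem
  refine ⟨e', g', _, _, fun heq => ?_, ⟨S, hS, h₁⟩, S', hS', hg'⟩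
  have := hmin _ _ _ _ h₁
  simp only [post.injEq] at heq
  lia

lemma Proposed.diverges (hS : S ∈ R.views) (hS' : S' ∈ R.views) (h : Proposed S p c (l + 1) d)
    (h' : Proposed S' p c (l + 1) d') (hne : d ≠ d') : Diverges R p c l := by
  obtain ⟨U, hU, -, hd, hc⟩ := h.exists_posted hS
  obtain ⟨U', hU', -, hd', hc'⟩ := h'.exists_posted hS'
  rcases R.chain U hU U' hU' with hsub | hsub
  · exact hc.diverges hU hU' hd hd' hsub hne
  · exact hc'.diverges hU' hU hd' hd hsub hne.symm

lemma eq_of_cons_suffix_of_cons_suffix {α : Type*} {A A' x y : List α} {r r' s s' : α}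
    (hr : r :: x <:+ A) (hr' : r' :: x <:+ A') (hrr' : r ≠ r')
    (hs : s :: y <:+ A) (hs' : s' :: y <:+ A') (hss' : s ≠ s') : x = y := by
  wlog hlen : x.length ≤ y.length generalizing x y r r' s s'
  · exact (this hs hs' hss' hr hr' hrr' (le_of_not_ge hlen)).symm
  rcases hlen.eq_or_lt with heq | hlt
  · exact (List.cons.inj
      ((List.suffix_of_suffix_length_le hr hs (by simp [heq])).eq_of_length (by simp [heq]))).2
  · have hry : r :: x <:+ y :=
      List.suffix_of_suffix_length_le hr ((List.suffix_cons s y).trans hs) hlt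
    have hry' : r' :: x <:+ y :=
      List.suffix_of_suffix_length_le hr' ((List.suffix_cons s' y).trans hs') hlt
    have heq := (List.suffix_of_suffix_length_le hry hry' (by simp)).eq_of_length (by simp)
    exact absurd (List.cons.inj heq).1 hrr'

variable (R) in
lemma finite_setOf_diverges (p : Fin n) (c : ℕ) : {l | Diverges R p c l}.Finite := by
  have hitems : ∀ l : {l | Diverges R p c l}, ∃ (q : Fin n × Fin n) (k k' : ℕ) (e : P.Local)
      (g : History n V P.Local) (r r' : Record n V P.Local), r ≠ r' ∧
        R.item k q.1 = r :: enter p c l e :: g ∧ R.item k' q.2 = r' :: enter p c l e :: g := by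
    rintro ⟨l, e, g, r, r', hne, ⟨S, hS, hr⟩, S', hS', hr'⟩
    obtain ⟨k, q, hq⟩ := R.reached S hS _ hr
    obtain ⟨k', q', hq'⟩ := R.reached S' hS' _ hr'
    exact ⟨(q, q'), k, k', e, g, r, r', hne, hq, hq'⟩
  choose q k k' e g r r' hne hq hq' using hitems
  refine Set.finite_coe_iff.1 (Finite.of_injective q fun a b hab => ?_)
  have hb := hq b
  have hb' := hq' b
  rw [← hab] at hb hb'
  have heq : enter p c a (e a) :: g a = enter p c b (e b) :: g b :=
    eq_of_cons_suffix_of_cons_suffix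
      (hq a ▸ item_suffix R (q a).1 (le_max_left (k a) (k b)))
      (hq' a ▸ item_suffix R (q a).2 (le_max_left (k' a) (k' b))) (hne a)
      (hb ▸ item_suffix R (q a).1 (le_max_right (k a) (k b)))
      (hb' ▸ item_suffix R (q a).2 (le_max_right (k' a) (k' b))) (hne b)
  simp only [List.cons.injEq, enter.injEq] at heq
  exact Subtype.ext heq.1.2.2.1

end Progress

/-! ### Termination of the simulation -/

section Termination

variable {n t : ℕ} {V W K Y : Type} {y₀ : Y} {P : Protocol (snapshotMemory n K Y y₀) V W}
  [Nonempty V] [Nonempty P.Local] {v : Fin n → V} {F : Set (Fin n)}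
  {R : SetRun (simulation P t) v F}

lemma exists_item_eq_of_suffix {k : ℕ} {q : Fin n} {g : History n V P.Local}
    (h : g <:+ R.item k q) (hg : g ≠ []) : ∃ k', R.item k' q = g := by
  induction k with
  | zero =>
    refine ⟨0, (h.eq_of_length_le ?_).symm⟩
    rw [R.item_zero]
    exact List.length_pos_of_ne_nil hg
  | succ k ih =>
    rcases R.item_succ k q with hidle | ⟨S, -, -, -, hact⟩
    · exact ih (hidle ▸ h)
    · obtain ⟨-, r, hr, -⟩ := exists_move_of_act_eq_advance hact
      rw [hr, List.suffix_cons_iff] at h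
      rcases h with heq | hsuffix
      · exact ⟨k + 1, hr.trans heq.symm⟩
      · exact ih hsuffix

lemma exists_unbounded (h : ∀ K, ∃ k ≥ K, R.item k ≠ R.item K) :
    ∃ q, ∀ N, ∃ k, N < (R.item k q).length := by
  by_contra! hbdd
  have hconst : ∀ q, ∃ K, ∀ k ≥ K, (R.item k q).length = (R.item K q).length := by
    intro q
    obtain ⟨N, hN⟩ := hbdd q
    exact exists_forall_ge_eq_of_finite_range
      (fun k k' hk => (item_suffix R q hk).length_le)
      ((Set.finite_Iic N).subset (Set.range_subset_iff.2 hN))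
  choose K hK using hconst
  have hle : ∀ q, K q ≤ Finset.univ.sup K := fun q => Finset.le_sup (Finset.mem_univ q)
  obtain ⟨k, hk, hne⟩ := h (Finset.univ.sup K)
  refine hne (funext fun q => ((item_suffix R q hk).eq_of_length ?_).symm)
  rw [hK q _ (hle q), hK q k ((hle q).trans hk)]

/-- The history `h` of a process that takes infinitely many steps, with the records `r` that it
appends and the views `S` that it obtains. -/
structure Trace (R : SetRun (simulation P t) v F) (h : ℕ → History n V P.Local)
    (r : ℕ → Record n V P.Local) (S : ℕ → Finset (History n V P.Local)) : Prop where
  succ : ∀ j, h (j + 1) = r j :: h j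
  view : ∀ j, S j ∈ R.views
  mem : ∀ j, h j ∈ S j
  notMem : ∀ j, h (j + 1) ∉ S j
  no_output : ∀ j w, ¬ Output P (S j) w
  move : ∀ j, Move P (S j) t (h j) (r j)

lemma exists_trace {q : Fin n} (hq : ∀ N, ∃ k, N < (R.item k q).length) :
    ∃ h r S, Trace R h r S := by
  have hlength : ∀ j, ∃ k, (R.item k q).length = j + 1 := by
    intro j
    obtain ⟨k, hk⟩ := hq j
    have hdrop : ((R.item k q).drop ((R.item k q).length - (j + 1))).length = j + 1 := by
      rw [List.length_drop]
      lia
    obtain ⟨k', hk'⟩ := exists_item_eq_of_suffix (List.drop_suffix _ _)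
      (List.ne_nil_of_length_eq_add_one hdrop)
    exact ⟨k', hk' ▸ hdrop⟩
  choose k hk using hlength
  have hcons : ∀ j, ∃ r, R.item (k (j + 1)) q = r :: R.item (k j) q := by
    intro j
    obtain ⟨a, ha⟩ := List.suffix_of_suffix_length_le
      (item_suffix R q (le_max_left (k j) (k (j + 1))))
      (item_suffix R q (le_max_right (k j) (k (j + 1)))) (by simp [hk])
    have hlen := congrArg List.length ha
    rw [List.length_append, hk, hk] at hlen
    obtain ⟨r, rfl⟩ := List.length_eq_one_iff.1 (show a.length = 1 by lia)
    exact ⟨r, ha.symm⟩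
  choose r hr using hcons
  have hmove := fun j => (start_or_exists_move_of_item_eq (hr j)).resolve_left fun h =>
    item_ne_nil R _ _ h.1
  choose S hS hmem hnotMem hout hmove using hmove
  exact ⟨fun j => R.item (k j) q, r, S, hr, hS, hmem, fun j => hr j ▸ hnotMem j, hout, hmove⟩

namespace Trace

variable {h : ℕ → History n V P.Local} {r : ℕ → Record n V P.Local}
  {S : ℕ → Finset (History n V P.Local)} {p : Fin n} {c l l' i j : ℕ} {d d' : P.Local}

lemma view_mono (Q : Trace R h r S) : Monotone S := by
  refine monotone_nat_of_le_succ fun j => ?_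
  exact (R.chain _ (Q.view j) _ (Q.view (j + 1))).resolve_right fun hsub =>
    Q.notMem j (hsub (Q.mem (j + 1)))

lemma mem_of_le (Q : Trace R h r S) (hij : i ≤ j) : h i ∈ S j :=
  Q.view_mono hij (Q.mem i)

lemma injective (Q : Trace R h r S) : Function.Injective h := by
  have hmono : StrictMono fun j => (h j).length :=
    strictMono_nat_of_lt_succ fun j => by simp [Q.succ j]
  exact fun i j hij => hmono.injective (congrArg List.length hij)

lemma not_output (Q : Trace R h r S) {U : Finset (History n V P.Local)} (hU : U ∈ R.views) (w : W) :
    ¬ Output P U w := by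
  intro hw
  have hmem : ∀ j, h j ∈ U := fun j =>
    (R.chain U hU (S j) (Q.view j)).resolve_left
      (fun hsub => Q.no_output j w (hw.mono hsub)) (Q.mem j)
  exact Set.infinite_of_injective_forall_mem (s := (U : Set (History n V P.Local))) Q.injective
    hmem U.finite_toSet

lemma exists_idle (Q : Trace R h r S) (j : ℕ) : ∃ i ≥ j, Idle (h i) := by
  have hpost : ∀ i m d p c l e g, h i = post m d :: enter p c l e :: g → Idle (h (i + 1)) := by
    intro i m d p c l e g hi
    have hmove := Q.move i
    rw [hi] at hmove
    rw [Q.succ, Idle]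
    rcases hmove.eq_commit_or_adopt_of_post with ⟨hr, -⟩ | ⟨hr, -⟩ <;> simp [hr]
  by_cases hj : Idle (h j)
  · exact ⟨j, le_rfl, hj⟩
  · rw [Idle, not_and_or] at hj
    push Not at hj
    rcases hj with ⟨p, c, l, e, g, hg⟩ | ⟨m, d, p, c, l, e, g, hg⟩
    · have hmove := Q.move j
      rw [hg] at hmove
      have hsucc := Q.succ j
      rw [hmove.eq_post_of_enter, hg] at hsucc
      exact ⟨j + 2, by lia, hpost _ _ _ _ _ _ _ _ hsucc⟩
    · exact ⟨j + 1, by lia, hpost _ _ _ _ _ _ _ _ hg⟩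

lemma committed_or_exists_proposed (Q : Trace R h r S) (hr : r j = enter p c l d) :
    (∀ i ≥ j + 3, Committed (S i) p c l d) ∨ ∃ e ≠ d, Proposed (S (j + 2)) p c l e := by
  have hpost := Q.move (j + 1)
  rw [Q.succ, hr] at hpost
  have hmove := Q.move (j + 2)
  rw [Q.succ, Q.succ, hpost.eq_post_of_enter, hr] at hmove
  rcases hmove.eq_commit_or_adopt_of_post with ⟨hcommit, -⟩ | ⟨-, e, he, hne⟩
  · refine .inl fun i hi => ?_
    have hmem := Q.mem_of_le hi
    rw [Q.succ, Q.succ, Q.succ, hcommit, hpost.eq_post_of_enter, hr] at hmem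
    exact ⟨_, _, h j, hmem⟩
  · exact .inr ⟨e, hne, he⟩

lemma proposed_of_lt (Q : Trace R h r S) (hr : r i = enter p c l d) (hij : i < j) :
    Proposed (S j) p c l d := by
  have hmem := Q.mem_of_le (Nat.succ_le_of_lt hij)
  rw [Nat.succ_eq_add_one, Q.succ, hr] at hmem
  exact ⟨_, hmem⟩

lemma of_eq_enter (Q : Trace R h r S) (hr : r j = enter p c l d) :
    Ready (S j) t ∧ Target (S j) p ∧ c = count (S j) p ∧ l = level (S j) p := by
  have hmove := Q.move j
  rw [hr] at hmove
  obtain ⟨-, hready, htarget, hc, hl, -⟩ := hmove.of_eq_enter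
  exact ⟨hready, htarget, hc, hl⟩

lemma level_ne_of_lt (Q : Trace R h r S) (hr : r i = enter p c l d) (hr' : r j = enter p c l' d')
    (hij : i < j) : l ≠ l' := by
  rintro rfl
  obtain ⟨-, -, rfl, rfl⟩ := Q.of_eq_enter hr'
  exact not_proposed_level _ _ _ (Q.proposed_of_lt hr hij)

lemma finite_setOf_enter (Q : Trace R h r S) (p : Fin n) (c : ℕ) :
    {j | ∃ l d, r j = enter p c l d}.Finite := by
  by_contra hinf
  refine hinf (Set.Finite.of_injOn (f := fun j => level (S j) p)
    (t := insert 0 (Nat.succ '' {l | Diverges R p c l})) ?_ ?_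
    (((finite_setOf_diverges R p c).image _).insert 0))
  · rintro j ⟨l, d, hr⟩
    obtain ⟨-, -, -, hl⟩ := Q.of_eq_enter hr
    rcases Q.committed_or_exists_proposed hr with hcommit | ⟨e, hne, he⟩
    · obtain ⟨i, ⟨l', d', hr'⟩, hi⟩ := Set.Infinite.exists_gt hinf (j + 2)
      obtain ⟨-, -, rfl, -⟩ := Q.of_eq_enter hr'
      exact absurd ⟨l, hcommit i hi⟩ (not_decided_count _ _ _)
    · simp only [← hl]
      rcases l with _ | l
      · exact Set.mem_insert _ _
      · exact Set.mem_insert_of_mem _ ⟨l, he.diverges (Q.view _) (Q.view _)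
          (Q.proposed_of_lt hr (Nat.lt_succ_self j)) hne, rfl⟩
  · rintro i ⟨l, d, hr⟩ j ⟨l', d', hr'⟩ heq
    have hl : l = l' :=
      (Q.of_eq_enter hr).2.2.2.trans (heq.trans (Q.of_eq_enter hr').2.2.2.symm)
    rcases lt_trichotomy i j with hlt | rfl | hlt
    · exact absurd hl (Q.level_ne_of_lt hr hr' hlt)
    · rfl
    · exact absurd hl.symm (Q.level_ne_of_lt hr' hr hlt)

end Trace

/-- The simulated process `p` executes only finitely many steps. -/
def Stalled (R : SetRun (simulation P t) v F) (p : Fin n) : Prop :=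
  ∃ N, ∀ S ∈ R.views, count S p ≤ N

variable (R) in
lemma exists_forall_stalled_count_le :
    ∃ N, ∀ p, Stalled R p → ∀ S ∈ R.views, count S p ≤ N := by
  have hbound : ∀ p, Stalled R p → ∃ N, ∀ S ∈ R.views, count S p ≤ N := fun _ => id
  choose! N hN using hbound
  exact ⟨Finset.univ.sup N, fun p hp S hS =>
    (hN p hp S hS).trans (Finset.le_sup (Finset.mem_univ p))⟩

namespace Trace

variable {h : ℕ → History n V P.Local} {r : ℕ → Record n V P.Local}
  {S : ℕ → Finset (History n V P.Local)}

lemma ncard_stalled_le (Q : Trace R h r S) : {p | Stalled R p}.ncard ≤ t := by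
  by_contra! hlt
  obtain ⟨N, hN⟩ := exists_forall_stalled_count_le R
  -- Some stalled process is always available, so the process with the least count has at most `N`
  -- states.
  have hsub : {j | Idle (h j)} ⊆ ⋃ p, ⋃ c ∈ Set.Iic N, {j | ∃ l d, r j = enter p c l d} := by
    intro j hj
    obtain ⟨p, c, l, d, hr⟩ := (Q.move j).exists_enter_of_idle hj
    obtain ⟨hready, htarget, rfl, -⟩ := Q.of_eq_enter hr
    obtain ⟨p', hstalled, havailable⟩ := hready.exists_available hlt
    simp only [Set.mem_iUnion]
    exact ⟨p, _, (htarget.2 p' havailable).trans (hN p' hstalled _ (Q.view j)), l, d, hr⟩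
  have hfinite : {j | Idle (h j)}.Finite :=
    (Set.finite_iUnion fun p => (Set.finite_Iic N).biUnion fun c _ =>
      Q.finite_setOf_enter p c).subset hsub
  obtain ⟨b, hb⟩ := hfinite.bddAbove
  obtain ⟨i, hi, hidle⟩ := Q.exists_idle (b + 1)
  exact absurd (hb hidle) (by lia)

lemma exists_output {T : ColorlessTask V W} (Q : Trace R h r S) (hP : P.SolvesResilient t T)
    (htn : t < n) (s : {s : Finset V // s ∈ T.input.faces}) (hv : ∀ p, v p ∈ s.1) :
    ∃ U ∈ R.views, ∃ w, Output P U w := by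
  obtain ⟨u, time, hu, X⟩ := exists_replay R
  have hgrow : ∀ p ∉ {p | Stalled R p}, ∀ N, ∃ U ∈ R.views, N < count U p := by
    intro p hp N
    simpa using not_exists.1 hp N
  obtain ⟨p, hp⟩ : ∃ p, p ∉ {p | Stalled R p} := by
    by_contra! hall
    have hle := Q.ncard_stalled_le
    rw [Set.eq_univ_of_forall hall, Set.ncard_univ, Nat.card_fin] at hle
    lia
  have huv : ∀ p, u p ∈ s.1 := by
    intro p
    obtain ⟨q, hq⟩ := hu p
    exact hq ▸ hv q
  have hsteps : ∀ p ∉ {p | Stalled R p}, ∀ N, ∃ k, N < (X.schedule k).count p := by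
    intro p hp N
    obtain ⟨U, hU, hlt⟩ := hgrow p hp (N + 1)
    refine ⟨U.card, ?_⟩
    rw [X.count_schedule, Protocol.Replay.steps, SetRun.viewAt_card hU]
    split_ifs <;> lia
  obtain ⟨k, w, hw⟩ :=
    hP.exists_hasDecided_of_isPrefix s u huv X.schedule_isPrefix Q.ncard_stalled_le hsteps hp
  rw [X.hasDecided_exec_schedule] at hw
  obtain ⟨U, hU, hlt⟩ := hgrow p hp (X.steps k p)
  exact ⟨U, hU, w, p, _, _, decided_state_of_lt_count hU hlt, hw⟩

end Trace

lemma simulation_solves {T : ColorlessTask V W} (hP : P.SolvesResilient t T) (htn : t < n) :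
    (simulation P t).Solves n t T := by
  intro s v hv F hF R
  refine ⟨?_, ?_⟩
  · by_cases hconst : ∃ K, ∀ k ≥ K, R.item k = R.item K
    · obtain ⟨K, hK⟩ := hconst
      exact fun p hp => exists_decides_of_eventually_const htn hF hK hp
    · push Not at hconst
      obtain ⟨q, hq⟩ := exists_unbounded hconst
      obtain ⟨h, r, S, Q⟩ := exists_trace hq
      obtain ⟨U, hU, w, hw⟩ := Q.exists_output hP htn s hv
      exact absurd hw (Q.not_output hU w)
  · obtain ⟨τ, hτ, hout⟩ := exists_face_forall_output_mem R hP (by lia) s hv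
    refine ⟨τ, hτ, fun p w hw => ?_⟩
    obtain ⟨k, S, hS, hact⟩ := R.decides p w hw
    exact hout S hS w (output_of_act_eq_decide hact)

end Termination

end History

lemma SnapshotSolvable.exists_setCode {n t : ℕ} {V W : Type} {T : ColorlessTask V W}
    (h : SnapshotSolvable n t T) (htn : t < n) :
    ∃ (X : Type) (C : SetCode V W X), (∀ x S, C.act x S ≠ .advance x) ∧ C.Solves n t T := by
  obtain ⟨K, Y, y₀, P, hP⟩ := h
  rcases isEmpty_or_nonempty V with hV | hV
  · exact ⟨Unit, ⟨fun _ => (), fun _ _ => .wait⟩, fun _ _ => nofun,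
      fun _ v => isEmptyElim (v ⟨0, by lia⟩)⟩
  · have : Nonempty P.Local := ⟨P.start ⟨0, by lia⟩ hV.some⟩
    refine ⟨_, History.simulation P t, fun x S hx => ?_, History.simulation_solves hP htn⟩
    obtain ⟨-, r, hr, -⟩ := History.exists_move_of_act_eq_advance hx
    exact List.cons_ne_self r x hr.symm

end AnonTask

theorem mainTheorem1_general (n t : ℕ) (htn : t < n) (V W : Type)
    (T : AnonTask.ColorlessTask V W) :
    (AnonTask.AnonymousWeakSetSolvable n t T ↔ AnonTask.SnapshotSolvable n t T) ∧
    (AnonTask.AnonymousWeakSetSolvable n t T ∨ (∃ m, AnonTask.AnonymousRegisterSolvable n t m T) →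
      AnonTask.AnonymousRegisterSolvable n t n T) := by
  refine ⟨⟨fun h => h.snapshotSolvable htn, fun h => ?_⟩, fun h => ?_⟩
  · obtain ⟨X, C, hne, hC⟩ := h.exists_setCode htn
    exact hC.anonymousWeakSetSolvable hne htn
  · have hsnapshot : AnonTask.SnapshotSolvable n t T := by
      rcases h with h | ⟨m, h⟩
      exacts [h.snapshotSolvable htn, h.snapshotSolvable htn]
    obtain ⟨X, C, hne, hC⟩ := hsnapshot.exists_setCode htn
    exact hC.anonymousRegisterSolvable hne htn

theorem mainTheorem1 (n t : ℕ) (ht : 1 ≤ t) (htn : t < n) (V W : Type) [Finite V] [Finite W]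
    (T : AnonTask.ColorlessTask V W) :
    (AnonTask.AnonymousWeakSetSolvable n t T ↔ AnonTask.SnapshotSolvable n t T) ∧
    (AnonTask.AnonymousWeakSetSolvable n t T ∨ (∃ m, AnonTask.AnonymousRegisterSolvable n t m T) →
      AnonTask.AnonymousRegisterSolvable n t n T) :=
  mainTheorem1_general n t htn V W T
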